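/- **Setting.** Let $\mathfrak g$ be a finite-dimensional simple complex Lie algebra with Cartan subalgebra $\mathfrak h$, simple roots $\alpha_i$ ($i\in I$), positive roots $R^+$, and a Chevalley basis with root vectors $x_\alpha$ ($x_\alpha^{\pm}=x_{\pm\alpha}$ for $\alpha\in R^+$), $h_\alpha=[x_\alpha,x_{-\alpha}]$, $h_i=h_{\alpha_i}$. Let $\sigma$ be a diagram automorphism of order $m\in\{1,2,3\}$, acting on roots and, by $\sigma(x_{i}^{\pm})=x_{\sigma(i)}^\pm$, on $\mathfrak g$. Let $\zeta\in\mathbb C$ be a primitive $m$-th root of unity, $\mathfrak g_\epsilon=\{x:\sigma(x)=\zeta^\epsilon x\}$ and $\tilde{\mathfrak g}^\sigma=\bigoplus_{r\in\mathbb Z}\mathfrak g_{-r}\otimes t^r\subseteq\tilde{\mathfrak g}=\mathfrak g\otimes\mathbb C[t,t^{-1}]$; put $\tilde{\mathfrak h}^\sigma=\tilde{\mathfrak g}^\sigma\cap(\mathfrak h\otimes\mathbb C[t,t^{-1}])$ and $\mathfrak h_0=\mathfrak h\cap\mathfrak g_0$. Let $O\subseteq R^+$ be a set of representatives of the $\sigma$-orbits;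 if $m=3$, take $O=\{\alpha\in R^+:\sigma\alpha=\alpha\}\cup\{\alpha_i,\alpha_j+\alpha_i,\alpha_j+\sigma\alpha_i+\sigma^2\alpha_i\}$ with $\sigma(j)=j$, $\sigma(i)\ne i$. Let $I_0=\{i\in I:\alpha_i\in O\}$. For a root $\alpha$ with $\sigma(\alpha)\neq\alpha$ put $x_{\alpha,\epsilon}=\kappa\sum_{j=0}^{m-1}\zeta^{-j\epsilon}\sigma^j(x_\alpha)$, where $\kappa=\sqrt2$ if $\alpha+\sigma(\alpha)$ is a root (this occurs only in type $A_{2n}$) and $\kappa=1$ otherwise. If $\sigma(\alpha)=\alpha$, put $x_{\alpha,\epsilon}=x_\alpha$ when $x_\alpha\in\mathfrak g_\epsilon$ and $x_{\alpha,\epsilon}=0$ otherwise. For $i\in I_0$ put $h_{i,\epsilon}=\sum_{j=0}^{m-1}\zeta^{-j\epsilon}h_{\sigma^j(i)}$ if $\sigma(i)\ne i$; if $\sigma(i)=i$, put $h_{i,\epsilon}=h_i$ when $m\mid\epsilon$ and $h_{i,\epsilon}=0$ otherwise. Write $x^{(k)}=x^k/k!$. Let $U_{\mathbb Z}(\mathfrak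 g)\subseteq U(\mathfrak g)$ be the subring generated by all $x_\alpha^{(k)}$ ($\alpha$ a root), and $U_{\mathbb Z}(\tilde{\mathfrak g}^\sigma)\subseteq U(\tilde{\mathfrak g}^\sigma)$ the subring generated by all $(x_{\alpha,-r}\otimes t^r)^{(k)}$, $\pm\alpha\in O$, $r\in\mathbb Z$. Put $U_{\mathbb Z}(\mathfrak h)=U(\mathfrak h)\cap U_{\mathbb Z}(\mathfrak g)$ and $U_{\mathbb Z}(\tilde{\mathfrak h}^\sigma)=U(\tilde{\mathfrak h}^\sigma)\cap U_{\mathbb Z}(\tilde{\mathfrak g}^\sigma)$. For an algebraically closed field $\mathbb F$ of any characteristic put $U_{\mathbb F}(\cdot)=\mathbb F\otimes_{\mathbb Z}U_{\mathbb Z}(\cdot)$. For $i\in I_0$ define $$\Lambda_i^{\sigma,\pm}(u)=\begin{cases}\exp\Big(-\sum_{n\ge1}\frac{h_{i,\mp n}\otimes t^{\pm n}}{n}u^n\Big),&\sigma(i)\ne i,\\[2pt] \exp\Big(-\sum_{n\ge1}\frac{h_{i,0}\otimes t^{\pm mn}}{n}u^n\Big),&\sigma(i)=i.\end{cases}$$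 *Twisted evaluation.* Fix $a\in\mathbb F^\times$ and a ring homomorphism $\chi:\mathbb Z[\zeta,\sqrt2]\to\mathbb F$. An element $u\in U(\tilde{\mathfrak g})$ *evaluates to* $x\in U_{\mathbb F}(\mathfrak g)$ if the image of $u$ under $U(\tilde{\mathfrak g})\to U(\mathfrak g)\otimes\mathbb C[t,t^{-1}]$ (the map induced by the identity of $\tilde{\mathfrak g}$) comes from an element of $U_{\mathbb Z}(\mathfrak g)\otimes_{\mathbb Z}\mathbb Z[\zeta,\sqrt2][t,t^{-1}]$ whose image under $\chi$ and $t\mapsto a$ is $x$. *Weights.* Let $P_0^{\sigma,+}$ be the set of $\lambda\in\mathfrak h_0^*$ with $\lambda(h_{i,0})\in\mathbb Z_{\ge0}$ for all $i\in I_0$. View such a $\lambda$ as a dominant weight of $\mathfrak g$ by $\lambda(h_i)=\lambda(h_{i,0})$ for $i\in I_0$ and $\lambda(h_i)=0$ for $i\in I\setminus I_0$. A *highest-weight vector of weight $\lambda$* of a $U_{\mathbb F}(\mathfrak g)$-module is a nonzero $v$ with $x_\alpha^{(k)}v=0$ for all $\alpha\in R^+$, $k>0$, on which $U_{\mathbb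 F}(\mathfrak h)$ acts by a character sending $\binom{h_i}{k}$ to $\binom{\lambda(h_i)}{k}$. Let $\mathcal P^{\sigma,+}_{\mathbb F}$ be the set of families $\omega=(\omega_i)_{i\in I_0}$ of polynomials in $\mathbb F[u]$ with constant term $1$. If $\omega_i=\prod_j(1-a_ju)$ with all $a_j\ne0$, put $\omega_i^+=\omega_i$ and $\omega_i^-=\prod_j(1-a_j^{-1}u)$. A *highest-$\ell$-weight vector of $\ell$-weight $\omega$* (with *Drinfeld polynomial* $\omega$) of a $U_{\mathbb F}(\tilde{\mathfrak g}^\sigma)$-module is a nonzero $v$ with $(x_{\alpha,-r}\otimes t^r)^{(k)}v=0$ for all $\alpha\in O$, $r\in\mathbb Z$, $k>0$, on which $U_{\mathbb F}(\tilde{\mathfrak h}^\sigma)$ acts by a character sending $\binom{h_{i,0}}{k}$ to $\binom{\deg\omega_i}{k}$ and the coefficients of $\Lambda_i^{\sigma,\pm}(u)$ to those of $\omega_i^{\pm}(u)$. For $\lambda\in P_0^{\sigma,+}$ define $\omega^\sigma_{\lambda,a}$ by $$(\omega^\sigma_{\lambda,a})_i(u)=\begin{cases}(1-au)^{\lambda(h_{i,0})},&\sigma(i)\ne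 i,\\(1-a^mu)^{\lambda(h_{i,0})},&\sigma(i)=i.\end{cases}$$ **Proposition.** There is a unique $\mathbb F$-algebra homomorphism $\mathrm{ev}_a^\sigma:U_{\mathbb F}(\tilde{\mathfrak g}^\sigma)\to U_{\mathbb F}(\mathfrak g)$ such that every $y\in U_{\mathbb Z}(\tilde{\mathfrak g}^\sigma)$ evaluates to $\mathrm{ev}_a^\sigma(1\otimes y)$. Let $\lambda\in P_0^{\sigma,+}$, let $V$ be a $U_{\mathbb F}(\mathfrak g)$-module generated by a highest-weight vector $v$ of weight $\lambda$, and let $V(a)$ be its pullback along $\mathrm{ev}_a^\sigma$. Then: 1. $v$ is a highest-$\ell$-weight vector of $V(a)$ of $\ell$-weight $\omega^\sigma_{\lambda,a}$. 2. If the characteristic of $\mathbb F$ is not $m$, then $v$ generates $V(a)$ over $U_{\mathbb F}(\tilde{\mathfrak g}^\sigma)$, so that $V(a)$ is a highest-$\ell$-weight module with Drinfeld polynomial $\omega^\sigma_{\lambda,a}$. 3. For all $i\in I_0$ the coefficients of $\Lambda_i^{\sigma,+}(u)$ and of $\Lambda_i^{\sigma,-}(u)$ evaluate to elements of $U_{\mathbb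 F}(\mathfrak g)$, which act on $v$ by the coefficients of $(\omega^\sigma_{\lambda,a})_i(u)$ and of $(\omega^\sigma_{\lambda,a})_i^-(u)$, respectively. -/

import Mathlib

open scoped TensorProduct LaurentPolynomial

namespace TwistedHyperLoop

noncomputable section

attribute [local instance 2000] LieRing.ofAssociativeRing

/-! ### General algebra -/

/-- The divided power `x ^ k / k!`. -/
def divPow {A : Type*} [Ring A] [Algebra ℂ A] (x : A) (k : ℕ) : A :=
  ((k.factorial : ℂ)⁻¹) • x ^ k

/-- The binomial `x (x - 1) ⋯ (x - k + 1) / k!`. -/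
def binom {A : Type*} [Ring A] [Algebra ℂ A] (x : A) (k : ℕ) : A :=
  ((k.factorial : ℂ)⁻¹) • Polynomial.aeval x (descPochhammer ℂ k)

/-- The exponential `∑ f ^ k / k!` of a formal power series `f` without constant term (so that only
the `k ≤ r` contribute to the coefficient of `u ^ r`). -/
def expSeries {A : Type*} [Ring A] [Algebra ℂ A] (f : PowerSeries A) : PowerSeries A :=
  PowerSeries.mk fun r =>
    ∑ k ∈ Finset.range (r + 1), ((k.factorial : ℂ)⁻¹) • PowerSeries.coeff r (f ^ k)

/-- Extension of scalars `F ⊗_ℤ S` of a `ℤ`-form `S`. -/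
abbrev Hyper (F : Type*) [Field F] {A : Type*} [Ring A] (S : Subalgebra ℤ A) : Type _ :=
  F ⊗[ℤ] S

/-- `F ⊗_ℤ S → F ⊗_ℤ S'` for `S ≤ S'`. -/
def hyperIncl (F : Type*) [Field F] {A : Type*} [Ring A] {S S' : Subalgebra ℤ A} (h : S ≤ S') :
    Hyper F S →ₐ[F] Hyper F S' :=
  Algebra.TensorProduct.map (AlgHom.id F F) (Subalgebra.inclusion h)

/-- The module given by the representation `ρ` is generated by the vector `v`. -/
def IsGeneratedBy {F B V : Type*} [Field F] [Ring B] [Algebra F B] [AddCommGroup V] [Module F V]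
    (ρ : B →ₐ[F] Module.End F V) (v : V) : Prop :=
  ∀ w : V, ∃ x : B, ρ x v = w

/-! ### The simple Lie algebra, Chevalley bases, diagram automorphisms -/

section Simple

open LieAlgebra LieAlgebra.IsKilling

variable {g : Type*} [LieRing g] [LieAlgebra ℂ g] [FiniteDimensional ℂ g] [LieAlgebra.IsSimple ℂ g]
variable {H : LieSubalgebra ℂ g} [H.IsCartanSubalgebra]

/-- The root `-α`. -/
def negRoot (α : H.root) : H.root := (rootSystem H).reflectionPerm α α

variable (H) in
/-- A Chevalley basis of `g` relative to the Cartan subalgebra `H`, given by its root vectors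
(the remaining elements are the simple coroots): `x_α ∈ g_α`, `[x_α, x_{-α}] = h_α`, and
`[x_α, x_β] = ± (q + 1) x_{α + β}` if `α + β` is a root, where `q` is maximal such that
`β - q α` is a root. -/
structure ChevalleyBasis where
  x : H.root → g
  mem : ∀ α : H.root, x α ∈ rootSpace H (α.1 : H → ℂ)
  lie_neg : ∀ α : H.root, ⁅x α, x (negRoot α)⁆ = (((rootSystem H).coroot α : H) : g)
  lie_add : ∀ α β γ : H.root,
    (rootSystem H).root γ = (rootSystem H).root α + (rootSystem H).root β →
      ∃ s : ℤˣ, ⁅x α, x β⁆ =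
        (((s : ℤ) * ((rootSystem H).chainBotCoeff α β + 1) : ℤ) : ℂ) • x γ

/-- A diagram automorphism `σ`: an automorphism of the root system permuting the simple roots,
together with the Lie algebra automorphism it induces, which is the one with
`σ (x_i^±) = x_{σ i}^±` for all simple roots. -/
structure DiagramAut (C : ChevalleyBasis H) (b : (rootSystem H).Base) where
  toAut : (rootSystem H).Aut
  map_base : ∀ i ∈ b.support, toAut.indexEquiv i ∈ b.support
  toLie : g ≃ₗ⁅ℂ⁆ g
  map_pos : ∀ i ∈ b.support, toLie (C.x i) = C.x (toAut.indexEquiv i)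
  map_neg : ∀ i ∈ b.support, toLie (C.x (negRoot i)) = C.x (negRoot (toAut.indexEquiv i))

namespace DiagramAut

variable {C : ChevalleyBasis H} {b : (rootSystem H).Base} (D : DiagramAut C b)

/-- The order `m` of `σ`. -/
def order : ℕ := orderOf D.toAut

/-- The permutation `α ↦ σ(α)` of the roots. -/
def perm (α : H.root) : H.root := D.toAut.indexEquiv α

/-- The eigenspace `g_ε = {x | σ x = ζ^ε x}`. -/
def piece (ζ : ℂ) (ε : ℤ) : Submodule ℂ g :=
  Module.End.eigenspace (D.toLie : g →ₗ[ℂ] g) (ζ ^ ε)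

/-- The Cartan subalgebra `h_0 = h ∩ g^σ` of `g^σ`. -/
def cartanFixed : Submodule ℂ H where
  carrier := {h | D.toLie (h : g) = h}
  add_mem' {x y} hx hy := by
    simp only [Set.mem_ofPred_eq] at hx hy ⊢
    simp [hx, hy]
  zero_mem' := by simp
  smul_mem' c x hx := by
    simp only [Set.mem_ofPred_eq] at hx ⊢
    simp [hx]

open Classical in
/-- The vectors `x_{α,ε}`, for any root `α`, where `x_{-α,ε}` stands for `x_{α,ε}^-`. If
`σ(α) = α` this is `x_α` or `0` according to whether `x_α ∈ g_ε`. Otherwise it is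
`∑_j ζ^{-jε} σ^j(x_α)`, rescaled by `√2` if `α + σ(α)` is a root (which occurs only in type
`A_{2n}`, exactly when `α` restricts to a short root of `g^σ`). -/
def xTw (ζ : ℂ) (α : H.root) (ε : ℤ) : g :=
  if D.perm α = α then
    if C.x α ∈ D.piece ζ ε then C.x α else 0
  else
    (if ∃ β : H.root, (rootSystem H).root β =
        (rootSystem H).root α + (rootSystem H).root (D.perm α) then ((Real.sqrt 2 : ℝ) : ℂ) else 1) •
      ∑ j ∈ Finset.range D.order, ζ ^ (-((j : ℤ) * ε)) • (D.toLie)^[j] (C.x α)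

open Classical in
/-- The elements `h_{i,ε}` of the Cartan subalgebra: `∑_j ζ^{-jε} h_{σ^j(i)}` if `σ(i) ≠ i`, and
`δ_{ε,0} h_i` (with `ε` modulo `m`) otherwise. -/
def hTw (ζ : ℂ) (i : H.root) (ε : ℤ) : H :=
  if D.perm i = i then
    if (D.order : ℤ) ∣ ε then (rootSystem H).coroot i else 0
  else
    ∑ j ∈ Finset.range D.order, ζ ^ (-((j : ℤ) * ε)) • (rootSystem H).coroot (D.perm^[j] i)

theorem perm_mem_base {i : H.root} (hi : i ∈ b.support) : D.perm i ∈ b.support :=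
  D.map_base i hi

theorem perm_iterate_mem_base {i : H.root} (hi : i ∈ b.support) (j : ℕ) :
    D.perm^[j] i ∈ b.support := by
  induction j with
  | zero => exact hi
  | succ j ih =>
    rw [Function.iterate_succ_apply']
    exact D.perm_mem_base ih

theorem toLie_coroot {i : H.root} (hi : i ∈ b.support) :
    D.toLie (((rootSystem H).coroot i : H) : g) = (((rootSystem H).coroot (D.perm i) : H) : g) := by
  rw [← C.lie_neg, ← C.lie_neg, LieEquiv.map_lie, D.map_pos i hi, D.map_neg i hi]
  rfl

theorem perm_iterate_order (i : H.root) : D.perm^[D.order] i = i := by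
  have key : ∀ n : ℕ, D.perm^[n] i = (D.toAut ^ n) • i := by
    intro n
    induction n with
    | zero => simp
    | succ n ih =>
      rw [Function.iterate_succ_apply', ih, pow_succ', mul_smul]
      rfl
  rw [key, order, pow_orderOf_eq_one, one_smul]

theorem hTw_zero_mem (ζ : ℂ) {i : H.root} (hi : i ∈ b.support) :
    D.hTw ζ i 0 ∈ D.cartanFixed := by
  change D.toLie ((D.hTw ζ i 0 : H) : g) = ((D.hTw ζ i 0 : H) : g)
  unfold hTw
  split_ifs with h h'
  · rw [D.toLie_coroot hi, h]
  · simp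
  · simp only [mul_zero, neg_zero, zpow_zero, one_smul]
    have h1 : ∀ n : ℕ, ((∑ j ∈ Finset.range n, (rootSystem H).coroot (D.perm^[j] i) : H) : g)
        = ∑ j ∈ Finset.range n, (((rootSystem H).coroot (D.perm^[j] i) : H) : g) := by
      intro n
      induction n with
      | zero => simp
      | succ n ih => rw [Finset.sum_range_succ, Finset.sum_range_succ, ← ih]; rfl
    rw [h1, map_sum]
    have h2 : ∀ j : ℕ, D.toLie (((rootSystem H).coroot (D.perm^[j] i) : H) : g)
        = (((rootSystem H).coroot (D.perm^[j + 1] i) : H) : g) := by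
      intro j
      rw [D.toLie_coroot (D.perm_iterate_mem_base hi j), Function.iterate_succ_apply']
    simp only [h2]
    have h3 := Finset.sum_range_succ
      (fun j => (((rootSystem H).coroot (D.perm^[j] i) : H) : g)) D.order
    have h4 := Finset.sum_range_succ'
      (fun j => (((rootSystem H).coroot (D.perm^[j] i) : H) : g)) D.order
    rw [h3, D.perm_iterate_order] at h4
    simpa using h4.symm

/-- A complete set `O` of representatives of the `σ`-orbits of positive roots. If `m = 3` (so `g`
has type `D_4`), it is of the form
`{α | σ(α) = α} ∪ {α_i, α_j + α_i, α_j + σ(α_i) + σ²(α_i)}` with `j` the simple root fixed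
by `σ` and `i` another simple root. -/
structure OrbitReps where
  carrier : Set H.root
  pos : ∀ α ∈ carrier, b.IsPos α
  existsUnique : ∀ α : H.root, b.IsPos α → ∃! β : H.root, β ∈ carrier ∧ ∃ k : ℕ, D.perm^[k] α = β
  triality : D.order = 3 → ∃ i ∈ b.support, ∃ j ∈ b.support, D.perm i ≠ i ∧ D.perm j = j ∧
    ∀ α : H.root, α ∈ carrier ↔ (b.IsPos α ∧ D.perm α = α) ∨
      (rootSystem H).root α = (rootSystem H).root i ∨
      (rootSystem H).root α = (rootSystem H).root j + (rootSystem H).root i ∨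
      (rootSystem H).root α = (rootSystem H).root j + (rootSystem H).root (D.perm i)
        + (rootSystem H).root (D.perm (D.perm i))

variable {D}

/-- The vertices `I_0` of the Dynkin diagram of `g^σ`, identified with the simple roots of `g`
that lie in `O`. -/
def OrbitReps.I₀ (O : D.OrbitReps) : Type _ := {i : H.root // i ∈ b.support ∧ i ∈ O.carrier}

/-- The elements `λ` of `P_0^{σ,+}`: linear forms on `h_0` whose values on the `h_{i,0}`, `i ∈ I_0`
(recorded in `val`) are nonnegative integers. If `g` has type `A_{2n}` and `α_i` is short, the
coroot of `α_i` is `2 h_{i,0}`; in all other cases it is `h_{i,0}`. -/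
structure DominantWeight (ζ : ℂ) (O : D.OrbitReps) where
  toDual : Module.Dual ℂ D.cartanFixed
  val : O.I₀ → ℕ
  apply_eq : ∀ i : O.I₀, toDual ⟨D.hTw ζ i.1 0, D.hTw_zero_mem ζ i.2.1⟩ = (val i : ℂ)

open Classical in
/-- `λ` as an element of `P^+`, given by its values on the simple coroots of `g`:
`λ(h_i) = λ(h_{i,0})` for `i ∈ I_0`, and `λ(h_i) = 0` for the other simple roots. -/
def DominantWeight.extend {ζ : ℂ} {O : D.OrbitReps} (lam : DominantWeight ζ O)
    (i : b.support) : ℕ :=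
  if h : (i : H.root) ∈ O.carrier then lam.val ⟨i, i.2, h⟩ else 0

end DiagramAut

/-! ### The hyperalgebra of `g` and its highest-weight modules -/

/-- Kostant's integral form `U_ℤ(g)`. -/
def kostant (C : ChevalleyBasis H) : Subalgebra ℤ (UniversalEnvelopingAlgebra ℂ g) :=
  Algebra.adjoin ℤ {y | ∃ (α : H.root) (k : ℕ),
    y = divPow (UniversalEnvelopingAlgebra.ι ℂ (C.x α)) k}

/-- `(x_α)^{(k)}` as an element of `U_ℤ(g)`. -/
def kostantGen (C : ChevalleyBasis H) (α : H.root) (k : ℕ) : kostant C :=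
  ⟨divPow (UniversalEnvelopingAlgebra.ι ℂ (C.x α)) k, Algebra.subset_adjoin ⟨α, k, rfl⟩⟩

/-- `U_ℤ(h) = U(h) ∩ U_ℤ(g)`. -/
def kostantCartan (C : ChevalleyBasis H) : Subalgebra ℤ (UniversalEnvelopingAlgebra ℂ g) :=
  kostant C ⊓ (Algebra.adjoin ℂ
    {y | ∃ h : H, y = UniversalEnvelopingAlgebra.ι ℂ (h : g)}).restrictScalars ℤ

/-- `μ : U_F(h) → F` is the character determined by the dominant weight with values `n i` on the
simple coroots, i.e. `μ(binom(h_i, k)) = binom(n i, k)`. -/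
def IsWeightCharacter {C : ChevalleyBasis H} {b : (rootSystem H).Base} {F : Type*} [Field F]
    (n : b.support → ℕ) (μ : Hyper F (kostantCartan C) →ₐ[F] F) : Prop :=
  ∀ (i : b.support) (k : ℕ) (y : kostantCartan C),
    (y : UniversalEnvelopingAlgebra ℂ g) =
        binom (UniversalEnvelopingAlgebra.ι ℂ (((rootSystem H).coroot i : H) : g)) k →
      μ (1 ⊗ₜ y) = ((n i).choose k : F)

/-- `v` is a highest-weight vector, of dominant weight `n`, of a `U_F(g)`-module. -/
structure IsHighestWeightVector {C : ChevalleyBasis H} {b : (rootSystem H).Base} {F V : Type*}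
    [Field F] [AddCommGroup V] [Module F V] (ρ : Hyper F (kostant C) →ₐ[F] Module.End F V)
    (n : b.support → ℕ) (v : V) : Prop where
  ne_zero : v ≠ 0
  weight : ∃ μ : Hyper F (kostantCartan C) →ₐ[F] F, IsWeightCharacter n μ ∧
    ∀ x, ρ (hyperIncl F (inf_le_left : kostantCartan C ≤ kostant C) x) v = μ x • v
  pos : ∀ α : H.root, b.IsPos α → ∀ k : ℕ, 0 < k → ρ (1 ⊗ₜ kostantGen C α k) v = 0

/-! ### Loop algebras and the twisted hyper loop algebra -/

/-- The loop algebra `ℂ[t,t⁻¹] ⊗ g`. -/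
abbrev Loop (g : Type*) [LieRing g] [LieAlgebra ℂ g] : Type _ := LieAlgebra.loopAlgebra ℂ ℤ g

/-- The element `x ⊗ t^r` of the loop algebra, viewed in its universal enveloping algebra. -/
def loopElt (x : g) (r : ℤ) : UniversalEnvelopingAlgebra ℂ (Loop g) :=
  UniversalEnvelopingAlgebra.ι ℂ ((LaurentPolynomial.T r : ℂ[T;T⁻¹]) ⊗ₜ[ℂ] x : Loop g)

variable {C : ChevalleyBasis H} {b : (rootSystem H).Base} {D : DiagramAut C b}

/-- The integral form `U_ℤ(g̃^σ)`, generated by the divided powers of the elements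
`x^±_{μ,-r} ⊗ t^r` of `g̃^σ = ⨁_r g_{-r} ⊗ t^r`. The algebra `U(g̃^σ)` is viewed inside `U(g̃)`. -/
def twistedForm (ζ : ℂ) (O : D.OrbitReps) :
    Subalgebra ℤ (UniversalEnvelopingAlgebra ℂ (Loop g)) :=
  Algebra.adjoin ℤ {y | ∃ (α : H.root) (r : ℤ) (k : ℕ), (α ∈ O.carrier ∨ negRoot α ∈ O.carrier) ∧
    y = divPow (loopElt (D.xTw ζ α (-r)) r) k}

/-- `(x^+_{μ,-r} ⊗ t^r)^{(k)}` as an element of `U_ℤ(g̃^σ)`, where `α ∈ O` restricts to `μ`. -/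
def twistedGen (ζ : ℂ) (O : D.OrbitReps) (α : O.carrier) (r : ℤ) (k : ℕ) : twistedForm ζ O :=
  ⟨divPow (loopElt (D.xTw ζ α (-r)) r) k, Algebra.subset_adjoin ⟨α, r, k, Or.inl α.2, rfl⟩⟩

/-- `U_ℤ(h̃^σ) = U(h̃^σ) ∩ U_ℤ(g̃^σ)`, where `h̃^σ = ⨁_r (h ∩ g_{-r}) ⊗ t^r`. -/
def twistedCartan (ζ : ℂ) (O : D.OrbitReps) :
    Subalgebra ℤ (UniversalEnvelopingAlgebra ℂ (Loop g)) :=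
  twistedForm ζ O ⊓ (Algebra.adjoin ℂ
    {y | ∃ (h : H) (r : ℤ), (h : g) ∈ D.piece ζ (-r) ∧ y = loopElt (h : g) r}).restrictScalars ℤ

open Classical in
/-- The series `Λ_i^{σ,±}(u)`, with `s = ±1` the sign:
`exp(-∑_{n ≥ 1} (h_{i,∓n} ⊗ t^{±n}) u^n / n)` if `σ(i) ≠ i`, and
`exp(-∑_{n ≥ 1} (h_{i,0} ⊗ t^{±mn}) u^n / n)` if `σ(i) = i`. -/
def lambdaSeries (ζ : ℂ) (O : D.OrbitReps) (i : O.I₀) (s : ℤˣ) :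
    PowerSeries (UniversalEnvelopingAlgebra ℂ (Loop g)) :=
  expSeries (-PowerSeries.mk fun n =>
    if n = 0 then 0
    else if D.perm i.1 = i.1 then
      ((n : ℂ)⁻¹) • loopElt (D.hTw ζ i.1 0 : g) (s * (D.order * n))
    else
      ((n : ℂ)⁻¹) • loopElt (D.hTw ζ i.1 (-(s * n)) : g) (s * n))

/-! ### Drinfeld polynomials and highest-`ℓ`-weight vectors -/

/-- The monoid `P_F^{σ,+}` of families of polynomials with constant term `1`. -/
def DrinfeldPolynomial (F : Type*) [Field F] (O : D.OrbitReps) : Type _ :=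
  {ω : O.I₀ → Polynomial F // ∀ i, (ω i).coeff 0 = 1}

/-- For a polynomial `f = ∏ (1 - a_j u)` with all `a_j ≠ 0`, the polynomial
`f^- = ∏ (1 - a_j⁻¹ u)`. -/
def minusPoly {F : Type*} [Field F] (f : Polynomial F) : Polynomial F :=
  Polynomial.C f.leadingCoeff⁻¹ * f.reverse

open Classical in
/-- The Drinfeld polynomial `ω^σ_{λ,a}`. -/
def DiagramAut.DominantWeight.drinfeld {ζ : ℂ} {O : D.OrbitReps} (lam : D.DominantWeight ζ O)
    {F : Type*} [Field F] (a : Fˣ) : DrinfeldPolynomial F O :=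
  ⟨fun i => (1 - Polynomial.C ((a : F) ^ (if D.perm i.1 = i.1 then D.order else 1)) *
      Polynomial.X) ^ lam.val i, fun i => by simp [Polynomial.coeff_zero_eq_eval_zero]⟩

/-- `ξ : U_F(h̃^σ) → F` is the character attached to `ω ∈ P_F^{σ,+}`:
`ξ(binom(h_{i,0}, k)) = binom(deg ω_i, k)` and `ξ(Λ_i^{σ,±}(u)) = ω_i^±(u)`. -/
structure IsEllWeightCharacter {ζ : ℂ} {O : D.OrbitReps} {F : Type*} [Field F]
    (ω : DrinfeldPolynomial F O) (ξ : Hyper F (twistedCartan ζ O) →ₐ[F] F) : Prop where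
  binom_eq : ∀ (i : O.I₀) (k : ℕ) (y : twistedCartan ζ O),
    (y : UniversalEnvelopingAlgebra ℂ (Loop g)) = binom (loopElt (D.hTw ζ i.1 0 : g) 0) k →
      ξ (1 ⊗ₜ y) = ((ω.1 i).natDegree.choose k : F)
  plus_eq : ∀ (i : O.I₀) (r : ℕ) (y : twistedCartan ζ O),
    (y : UniversalEnvelopingAlgebra ℂ (Loop g)) = PowerSeries.coeff r (lambdaSeries ζ O i 1) →
      ξ (1 ⊗ₜ y) = (ω.1 i).coeff r
  minus_eq : ∀ (i : O.I₀) (r : ℕ) (y : twistedCartan ζ O),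
    (y : UniversalEnvelopingAlgebra ℂ (Loop g)) = PowerSeries.coeff r (lambdaSeries ζ O i (-1)) →
      ξ (1 ⊗ₜ y) = (minusPoly (ω.1 i)).coeff r

/-- `v` is a highest-`ℓ`-weight vector of `ℓ`-weight `ω` of a `U_F(g̃^σ)`-module. -/
structure IsHighestEllWeightVector {ζ : ℂ} {O : D.OrbitReps} {F V : Type*} [Field F]
    [AddCommGroup V] [Module F V] (π : Hyper F (twistedForm ζ O) →ₐ[F] Module.End F V)
    (ω : DrinfeldPolynomial F O) (v : V) : Prop where
  ne_zero : v ≠ 0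
  ellWeight : ∃ ξ : Hyper F (twistedCartan ζ O) →ₐ[F] F, IsEllWeightCharacter ω ξ ∧
    ∀ x, π (hyperIncl F (inf_le_left : twistedCartan ζ O ≤ twistedForm ζ O) x) v = ξ x • v
  pos : ∀ (α : O.carrier) (r : ℤ) (k : ℕ), 0 < k → π (1 ⊗ₜ twistedGen ζ O α r k) v = 0

/-! ### Evaluation maps -/

variable (g) in
/-- The formal evaluation map `U(g̃) → ℂ[t,t⁻¹] ⊗ U(g)`, induced by the identity `f ⊗ x ↦ f ⊗ x`
of the loop algebra. -/
def evFormal : UniversalEnvelopingAlgebra ℂ (Loop g) →ₐ[ℂ]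
    (ℂ[T;T⁻¹] ⊗[ℂ] UniversalEnvelopingAlgebra ℂ g) :=
  UniversalEnvelopingAlgebra.lift ℂ
    { toLinearMap := LinearMap.lTensor ℂ[T;T⁻¹]
        (UniversalEnvelopingAlgebra.ι ℂ : g →ₗ⁅ℂ⁆ UniversalEnvelopingAlgebra ℂ g).toLinearMap
      map_lie' := by
        intro x y
        induction x using TensorProduct.induction_on with
        | zero => simp
        | add x₁ x₂ h₁ h₂ =>
          simp only [AddHom.toFun_eq_coe, LinearMap.coe_toAddHom, add_lie, map_add] at h₁ h₂ ⊢
          rw [h₁, h₂]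
        | tmul p u =>
          induction y using TensorProduct.induction_on with
          | zero => simp
          | add y₁ y₂ h₁ h₂ =>
            simp only [AddHom.toFun_eq_coe, LinearMap.coe_toAddHom, lie_add, map_add] at h₁ h₂ ⊢
            rw [h₁, h₂]
          | tmul q w =>
            simp only [AddHom.toFun_eq_coe, LinearMap.coe_toAddHom,
              LieAlgebra.ExtendScalars.bracket_tmul, LinearMap.lTensor_tmul,
              LieHom.coe_toLinearMap, LieHom.map_lie, LieRing.of_associative_ring_bracket,
              Algebra.TensorProduct.tmul_mul_tmul, TensorProduct.tmul_sub, mul_comm q p] }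

/-- The subring `ℤ[ζ, √2]` of `ℂ`, containing the coefficients of the `x_{α,ε}`. -/
abbrev coeffRing (ζ : ℂ) : Subalgebra ℤ ℂ := Algebra.adjoin ℤ {ζ, ((Real.sqrt 2 : ℝ) : ℂ)}

/-- The map `ℤ[ζ,√2][t,t⁻¹] ⊗_ℤ U_ℤ(g) → ℂ[t,t⁻¹] ⊗_ℂ U(g)`. -/
def toComplex (C : ChevalleyBasis H) (ζ : ℂ) :
    ((coeffRing ζ)[T;T⁻¹] ⊗[ℤ] kostant C) →ₐ[ℤ]
      (ℂ[T;T⁻¹] ⊗[ℂ] UniversalEnvelopingAlgebra ℂ g) :=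
  Algebra.TensorProduct.lift
    (((Algebra.TensorProduct.includeLeft : ℂ[T;T⁻¹] →ₐ[ℂ]
        (ℂ[T;T⁻¹] ⊗[ℂ] UniversalEnvelopingAlgebra ℂ g)).restrictScalars ℤ).comp
      (AddMonoidAlgebra.mapAlgHom ℤ (coeffRing ζ).val))
    (((Algebra.TensorProduct.includeRight : UniversalEnvelopingAlgebra ℂ g →ₐ[ℂ]
        (ℂ[T;T⁻¹] ⊗[ℂ] UniversalEnvelopingAlgebra ℂ g)).restrictScalars ℤ).comp (kostant C).val)
    (fun x y => by
      change (AddMonoidAlgebra.mapAlgHom ℤ (coeffRing ζ).val x ⊗ₜ[ℂ] (1 : UniversalEnvelopingAlgebra ℂ g)) *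
          ((1 : ℂ[T;T⁻¹]) ⊗ₜ[ℂ] (y : UniversalEnvelopingAlgebra ℂ g)) =
        ((1 : ℂ[T;T⁻¹]) ⊗ₜ[ℂ] (y : UniversalEnvelopingAlgebra ℂ g)) *
          (AddMonoidAlgebra.mapAlgHom ℤ (coeffRing ζ).val x ⊗ₜ[ℂ] (1 : UniversalEnvelopingAlgebra ℂ g))
      rw [Algebra.TensorProduct.tmul_mul_tmul, Algebra.TensorProduct.tmul_mul_tmul]
      simp)

/-- The map `ℤ[ζ,√2][t,t⁻¹] ⊗_ℤ U_ℤ(g) → U_F(g)`, `f ⊗ y ↦ f(a) ⊗ y`, where the coefficients of `f`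
are mapped to `F` by `χ`. -/
def specialize (C : ChevalleyBasis H) {ζ : ℂ} {F : Type*} [Field F] (χ : coeffRing ζ →+* F)
    (a : Fˣ) : ((coeffRing ζ)[T;T⁻¹] ⊗[ℤ] kostant C) →ₐ[ℤ] Hyper F (kostant C) :=
  Algebra.TensorProduct.map (LaurentPolynomial.eval₂ χ a).toIntAlgHom (AlgHom.id ℤ _)

/-- The evaluation at `a` of `u ∈ U(g̃)` is `x ∈ U_F(g)`: the formal evaluation of `u` has
coefficients in `ℤ[ζ,√2] ⊗ U_ℤ(g)`, and `x` is obtained from it by specialization. -/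
def EvaluatesTo (C : ChevalleyBasis H) {ζ : ℂ} {F : Type*} [Field F] (χ : coeffRing ζ →+* F)
    (a : Fˣ) (u : UniversalEnvelopingAlgebra ℂ (Loop g)) (x : Hyper F (kostant C)) : Prop :=
  ∃ z : (coeffRing ζ)[T;T⁻¹] ⊗[ℤ] kostant C,
    toComplex C ζ z = evFormal g u ∧ x = specialize C χ a z

/-- `φ` is the twisted evaluation map `ev_a^σ : U_F(g̃^σ) → U_F(g)`. -/
def IsTwistedEvaluation {ζ : ℂ} (O : D.OrbitReps) {F : Type*} [Field F] (χ : coeffRing ζ →+* F)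
    (a : Fˣ) (φ : Hyper F (twistedForm ζ O) →ₐ[F] Hyper F (kostant C)) : Prop :=
  ∀ y : twistedForm ζ O, EvaluatesTo C χ a (y : UniversalEnvelopingAlgebra ℂ (Loop g)) (φ (1 ⊗ₜ y))

end Simple

end

end TwistedHyperLoop

/-! Write R = ℤ[ζ,√2]. The formal evaluation lands in ℂ[t,t⁻¹] ⊗ U(g); the task is to show that it
sends the twisted ℤ-form into R[t,t⁻¹] ⊗ U_ℤ(g), and that an element there has only one
specialization.

Uniqueness is the injectivity of `toComplex`. The structure constants of a Chevalley basis are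
integers, so g maps to ℂ ⊗ U_ℚ(g), where U_ℚ(g) is generated over ℚ by the root vectors. Hence
ℚ-linear forms on U_ℚ(g) extend to U(g) (`extendForm`), and they detect the coefficients of an
element with respect to a ℤ-basis of R[t,t⁻¹]. The same argument with forms vanishing on the
rational form of U(h) shows that elements evaluating into U(h) come from U_ℤ(h)
(`mem_span_kostantCartan`).

Existence concerns divided powers of the x_{α,ε} (`divSpec_xTw`). If α + σ(α) is not a root, the
σ^j(x_α) commute and the divided-power binomial formula applies. If β = α + σ(α) is a root, then m =
2 and x_α, σ(x_α) span with x_β a Heisenberg algebra. The factor √2 makes the commutator of the two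
summands equal to -2w with w an R-multiple of x_β, and then (x+y)^{(n)} is a sum of products x^{(i)}
y^{(j)} w^{(k)} with i + j + 2k = n (`divPow_add_of_central`).

Surjectivity, when m ≠ 0 in F, is Fourier inversion over ℤ/m: m σ^l(x_α) is a combination of the
x_{α,-r} (`sum_xTw`). In the Heisenberg case the multiple obtained is 2√2 x_α or 2√2 σ(x_α).

For the ℓ-weight, Λ_i evaluates to a product of series (1 - c_j u)^{h_j} with h_j the coroots in the
orbit of i (`expSeries_neg_sum_logSeries`). On v each factor acts by a power of a linear polynomial,
and λ vanishes on every coroot of the orbit other than h_i, so one factor survives. -/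

namespace TwistedHyperLoop

noncomputable section

set_option linter.unusedSectionVars false

open Finset.HasAntidiagonal (antidiagonal)
open scoped TensorProduct LaurentPolynomial

/-! ### Divided powers -/

section DivPow

variable {A : Type*} [Ring A] [Algebra ℂ A]

@[simp] theorem divPow_zero (x : A) : divPow x 0 = 1 := by simp [divPow]

@[simp] theorem divPow_one (x : A) : divPow x 1 = x := by simp [divPow]

theorem succ_smul_divPow_succ (x : A) (k : ℕ) :
    ((k : ℂ) + 1) • divPow x (k + 1) = x * divPow x k := by
  have h : (k : ℂ) + 1 ≠ 0 := by exact_mod_cast k.succ_ne_zero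
  have h' : (k.factorial : ℂ) ≠ 0 := by exact_mod_cast k.factorial_ne_zero
  rw [divPow, divPow, mul_smul_comm, ← pow_succ', smul_smul, Nat.factorial_succ]
  congr 1
  push_cast
  field_simp

theorem divPow_smul {S : Type*} [CommSemiring S] [Algebra S A] [SMulCommClass S ℂ A]
    (c : S) (x : A) (k : ℕ) :
    divPow (c • x) k = c ^ k • divPow x k := by
  rw [divPow, divPow, smul_pow, smul_comm]

theorem map_divPow {B : Type*} [Ring B] [Algebra ℂ B] (f : A →ₐ[ℂ] B) (x : A) (k : ℕ) :
    f (divPow x k) = divPow (f x) k := by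
  simp [divPow]

theorem divPow_zero_left {k : ℕ} (hk : 0 < k) : divPow (0 : A) k = 0 := by
  simp [divPow, hk.ne']

theorem commute_divPow {x y : A} (h : Commute y x) (k : ℕ) : Commute y (divPow x k) :=
  (h.pow_right k).smul_right _

/-- The formal derivative of a power series over a not necessarily commutative ring. -/
def formalDeriv (f : PowerSeries A) : PowerSeries A :=
  PowerSeries.mk fun n => ((n : ℂ) + 1) • PowerSeries.coeff (n + 1) f

theorem coeff_formalDeriv (f : PowerSeries A) (n : ℕ) :
    PowerSeries.coeff n (formalDeriv f) = ((n : ℂ) + 1) • PowerSeries.coeff (n + 1) f := by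
  simp [formalDeriv]

theorem formalDeriv_mul (f g : PowerSeries A) :
    formalDeriv (f * g) = formalDeriv f * g + f * formalDeriv g := by
  ext n
  rw [coeff_formalDeriv, map_add, PowerSeries.coeff_mul, PowerSeries.coeff_mul,
    PowerSeries.coeff_mul]
  have key : ((n : ℂ) + 1) • ∑ p ∈ antidiagonal (n + 1),
      PowerSeries.coeff p.1 f * PowerSeries.coeff p.2 g =
      ∑ p ∈ antidiagonal (n + 1),
        (p.1 : ℂ) • (PowerSeries.coeff p.1 f * PowerSeries.coeff p.2 g) +
      ∑ p ∈ antidiagonal (n + 1),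
        (p.2 : ℂ) • (PowerSeries.coeff p.1 f * PowerSeries.coeff p.2 g) := by
    rw [Finset.smul_sum, ← Finset.sum_add_distrib]
    refine Finset.sum_congr rfl fun p hp => ?_
    rw [← add_smul]
    congr 1
    rw [Finset.HasAntidiagonal.mem_antidiagonal] at hp
    exact_mod_cast hp.symm
  rw [key]
  congr 1
  · rw [Finset.Nat.sum_antidiagonal_succ]
    simp [coeff_formalDeriv]
  · rw [Finset.Nat.sum_antidiagonal_succ']
    simp [coeff_formalDeriv]

/-- The equation f' = x f is the recursion (n+1) f_{n+1} = x f_n, and n+1 is invertible. Identities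
between divided powers in a noncommutative ring are proved by exhibiting both sides as solutions. -/
theorem eq_of_formalDeriv_eq {x : A} {f g : PowerSeries A}
    (hf : formalDeriv f = PowerSeries.C x * f) (hg : formalDeriv g = PowerSeries.C x * g)
    (h0 : PowerSeries.coeff 0 f = PowerSeries.coeff 0 g) : f = g := by
  ext n
  induction n with
  | zero => exact h0
  | succ n ih =>
    have h : (n : ℂ) + 1 ≠ 0 := by exact_mod_cast n.succ_ne_zero
    have h1 := congrArg (PowerSeries.coeff n) hf
    have h2 := congrArg (PowerSeries.coeff n) hg
    rw [coeff_formalDeriv, PowerSeries.coeff_C_mul] at h1 h2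
    rw [ih, ← h2] at h1
    exact smul_right_injective _ h h1

/-- The generating series of the divided powers of `x`. -/
def divPowSeries (x : A) : PowerSeries A := PowerSeries.mk (divPow x)

theorem formalDeriv_divPowSeries (x : A) :
    formalDeriv (divPowSeries x) = PowerSeries.C x * divPowSeries x := by
  ext n
  rw [coeff_formalDeriv, PowerSeries.coeff_C_mul]
  simp [divPowSeries, succ_smul_divPow_succ]

theorem divPow_add {x y : A} (h : Commute x y) (n : ℕ) :
    divPow (x + y) n = ∑ p ∈ antidiagonal n, divPow x p.1 * divPow y p.2 := by
  have hc : divPowSeries x * PowerSeries.C y = PowerSeries.C y * divPowSeries x := by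
    ext n
    rw [PowerSeries.coeff_mul_C, PowerSeries.coeff_C_mul]
    simpa [divPowSeries] using (commute_divPow h.symm n).symm.eq
  -- This is e^{(x+y)s} = e^{xs} e^{ys}; commutation is needed only to bring y to the left of e^{xs}
  -- after differentiating.
  have key : divPowSeries (x + y) = divPowSeries x * divPowSeries y := by
    refine eq_of_formalDeriv_eq (formalDeriv_divPowSeries _) ?_ ?_
    · rw [formalDeriv_mul, formalDeriv_divPowSeries, formalDeriv_divPowSeries, ← mul_assoc,
        hc, map_add, add_mul]
      simp only [mul_assoc]
    · simp [divPowSeries, PowerSeries.coeff_mul]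
  have := congrArg (PowerSeries.coeff n) key
  simpa [divPowSeries, PowerSeries.coeff_mul] using this

/-- The generating series in `s` of the divided powers of `w`, evaluated at `s²`. -/
def divPowSqSeries (w : A) : PowerSeries A :=
  PowerSeries.mk fun n => if Even n then divPow w (n / 2) else 0

theorem formalDeriv_divPowSqSeries (w : A) :
    formalDeriv (divPowSqSeries w) =
      PowerSeries.X * (PowerSeries.C ((2 : ℂ) • w) * divPowSqSeries w) := by
  ext n
  rw [coeff_formalDeriv]
  cases n with
  | zero => simp [divPowSqSeries]
  | succ n =>
    rw [PowerSeries.coeff_succ_X_mul, PowerSeries.coeff_C_mul]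
    simp only [divPowSqSeries, PowerSeries.coeff_mk]
    by_cases hn : Even n
    · obtain ⟨l, rfl⟩ := hn
      have h1 : Even (l + l + 1 + 1) := ⟨l + 1, by ring⟩
      have h2 : (l + l + 1 + 1) / 2 = l + 1 := by omega
      have h3 : (l + l) / 2 = l := by omega
      rw [if_pos h1, if_pos (Even.add_self l), h2, h3, smul_mul_assoc, ← succ_smul_divPow_succ,
        smul_smul]
      congr 1
      push_cast
      ring
    · have h1 : ¬ Even (n + 1 + 1) := by simpa [Nat.even_add_one] using hn
      simp [h1, hn]

/-- Divided powers of a sum of two elements with central commutator. -/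
theorem divPow_add_of_central {x y w : A} (hxy : x * y - y * x = (-2 : ℂ) • w)
    (hx : Commute x w) (hy : Commute y w) (n : ℕ) :
    divPow (x + y) n = ∑ p ∈ antidiagonal n,
      (∑ q ∈ antidiagonal p.1, divPow x q.1 * divPow y q.2) *
        if Even p.2 then divPow w (p.2 / 2) else 0 := by
  have hxy' : x * y = y * x + (-2 : ℂ) • w := by rw [← hxy]; abel
  -- Moving y to the left past a divided power of x lowers that power by one and leaves a single
  -- central term.
  have hpow : ∀ k : ℕ, divPow x (k + 1) * y = y * divPow x (k + 1) +
      (-2 : ℂ) • (w * divPow x k) := by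
    intro k
    induction k with
    | zero => simpa using hxy'
    | succ k ih =>
      have h : ((k + 1 : ℕ) : ℂ) + 1 ≠ 0 := by exact_mod_cast (k + 1).succ_ne_zero
      apply smul_right_injective A h
      change (((k + 1 : ℕ) : ℂ) + 1) • (_ * _) = (((k + 1 : ℕ) : ℂ) + 1) • _
      rw [← smul_mul_assoc, succ_smul_divPow_succ, smul_add, ← mul_smul_comm,
        succ_smul_divPow_succ, mul_assoc, ih, mul_add, ← mul_assoc, hxy', mul_smul_comm,
        ← mul_assoc, hx.eq, mul_assoc w, ← succ_smul_divPow_succ]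
      simp only [add_mul, mul_assoc, mul_smul_comm, smul_mul_assoc, smul_smul, Nat.cast_add,
        Nat.cast_one]
      rw [add_assoc, ← add_smul, ← succ_smul_divPow_succ]
      simp only [mul_smul_comm]
      congr 2
      ring
  have hc : divPowSeries x * PowerSeries.C y = PowerSeries.C y * divPowSeries x +
      PowerSeries.X * (PowerSeries.C ((-2 : ℂ) • w) * divPowSeries x) := by
    ext n
    rw [PowerSeries.coeff_mul_C, map_add, PowerSeries.coeff_C_mul]
    cases n with
    | zero => simp [divPowSeries]
    | succ n =>
      rw [PowerSeries.coeff_succ_X_mul, PowerSeries.coeff_C_mul]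
      simpa [divPowSeries] using hpow n
  have hw : ∀ z : A, Commute z w →
      divPowSeries z * PowerSeries.C ((2 : ℂ) • w) = PowerSeries.C ((2 : ℂ) • w) *
        divPowSeries z := by
    intro z hz
    ext n
    rw [PowerSeries.coeff_mul_C, PowerSeries.coeff_C_mul]
    simpa [divPowSeries] using congrArg ((2 : ℂ) • ·) (commute_divPow hz.symm n).symm.eq
  -- This is e^{(x+y)s} = e^{xs} e^{ys} e^{ws²}. In the derivative, the -2sw produced by moving y to
  -- the left past e^{xs} cancels the 2sw coming from e^{ws²}.
  have key : divPowSeries (x + y) = divPowSeries x * divPowSeries y * divPowSqSeries w := by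
    refine eq_of_formalDeriv_eq (formalDeriv_divPowSeries _) ?_ ?_
    · have hX : ∀ f : PowerSeries A, f * PowerSeries.X = PowerSeries.X * f := fun f =>
        PowerSeries.X_mul.symm
      rw [formalDeriv_mul, formalDeriv_mul, formalDeriv_divPowSeries, formalDeriv_divPowSeries,
        formalDeriv_divPowSqSeries, ← mul_assoc (divPowSeries x) (PowerSeries.C y), hc]
      have h1 : divPowSeries x * divPowSeries y *
          (PowerSeries.X * (PowerSeries.C ((2 : ℂ) • w) * divPowSqSeries w)) =
          PowerSeries.X * (PowerSeries.C ((2 : ℂ) • w) * (divPowSeries x * divPowSeries y *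
            divPowSqSeries w)) := by
        rw [← mul_assoc, hX, mul_assoc, ← mul_assoc _ _ (divPowSqSeries w),
          mul_assoc (divPowSeries x), hw y hy, ← mul_assoc (divPowSeries x), hw x hx]
        simp only [mul_assoc]
      have h2 : PowerSeries.C ((-2 : ℂ) • w) = - PowerSeries.C ((2 : ℂ) • w) := by
        rw [← map_neg, neg_smul]
      rw [h1, h2, map_add]
      noncomm_ring
    · simp [divPowSeries, divPowSqSeries, PowerSeries.coeff_mul]
  have := congrArg (PowerSeries.coeff n) key
  simpa [divPowSeries, divPowSqSeries, PowerSeries.coeff_mul] using this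

end DivPow

/-! ### Binomials -/

section Binom

variable {A : Type*} [Ring A] [Algebra ℂ A]

@[simp] theorem binom_zero (x : A) : binom x 0 = 1 := by simp [binom]

theorem factorial_inv_mul_succ (k : ℕ) :
    ((k : ℂ) + 1) * ((k + 1).factorial : ℂ)⁻¹ = (k.factorial : ℂ)⁻¹ := by
  have h : (k : ℂ) + 1 ≠ 0 := by exact_mod_cast k.succ_ne_zero
  have h' : (k.factorial : ℂ) ≠ 0 := by exact_mod_cast k.factorial_ne_zero
  rw [Nat.factorial_succ]
  push_cast
  field_simp

theorem succ_smul_binom_succ (x : A) (k : ℕ) :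
    ((k : ℂ) + 1) • binom x (k + 1) = (x - k) * binom x k := by
  rw [binom, binom, smul_smul, factorial_inv_mul_succ, mul_smul_comm, descPochhammer_succ_right,
    mul_comm (descPochhammer ℂ k), map_mul]
  simp

theorem succ_smul_binom_succ' (x : A) (k : ℕ) :
    ((k : ℂ) + 1) • binom x (k + 1) = x * binom (x - 1) k := by
  rw [binom, binom, smul_smul, factorial_inv_mul_succ, mul_smul_comm, descPochhammer_succ_left,
    map_mul, Polynomial.aeval_comp]
  simp

theorem binom_pascal (x : A) (k : ℕ) :
    binom x (k + 1) = binom (x - 1) (k + 1) + binom (x - 1) k := by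
  have hk : (k : ℂ) + 1 ≠ 0 := by exact_mod_cast k.succ_ne_zero
  apply smul_right_injective A hk
  change ((k : ℂ) + 1) • _ = ((k : ℂ) + 1) • _
  rw [smul_add, succ_smul_binom_succ', succ_smul_binom_succ, add_smul, one_smul]
  have : (k : ℂ) • binom (x - 1) k = (k : A) * binom (x - 1) k := by
    rw [Algebra.smul_def, map_natCast]
  rw [this]
  noncomm_ring

theorem semiconjBy_binom {e x y : A} (h : SemiconjBy e x y) (k : ℕ) :
    SemiconjBy e (binom x k) (binom y k) := by
  induction k with
  | zero => simp
  | succ k ih =>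
    have hk : (k : ℂ) + 1 ≠ 0 := by exact_mod_cast k.succ_ne_zero
    have h1 : SemiconjBy e (((k : ℂ) + 1) • binom x (k + 1)) (((k : ℂ) + 1) • binom y (k + 1)) := by
      rw [succ_smul_binom_succ, succ_smul_binom_succ]
      refine SemiconjBy.mul_right (h.sub_right ?_) ih
      exact (Nat.cast_commute k e).symm
    unfold SemiconjBy at h1 ⊢
    rw [mul_smul_comm, smul_mul_assoc] at h1
    exact smul_right_injective A hk h1

theorem map_binom {B : Type*} [Ring B] [Algebra ℂ B] (f : A →ₐ[ℂ] B) (x : A) (k : ℕ) :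
    f (binom x k) = binom (f x) k := by
  simp [binom, Polynomial.aeval_algHom_apply]

/-- The case of one e in the commutation formula for `sl₂`: each time e passes an f it leaves an h,
and h crosses the remaining f's at the cost of 2 for each. -/
theorem mul_divPow_succ {e f h : A} (hef : e * f = f * e + h) (hhf : h * f = f * h - 2 * f)
    (s : ℕ) :
    e * divPow f (s + 1) = divPow f (s + 1) * e + divPow f s * (h - s) := by
  induction s with
  | zero => simp [hef]
  | succ s ih =>
    have hk : ((s + 1 : ℕ) : ℂ) + 1 ≠ 0 := by exact_mod_cast (s + 1).succ_ne_zero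
    apply smul_right_injective A hk
    change (((s + 1 : ℕ) : ℂ) + 1) • _ = (((s + 1 : ℕ) : ℂ) + 1) • _
    have hh : ∀ s : ℕ, h * divPow f s = divPow f s * (h - 2 * s) := by
      intro s
      induction s with
      | zero => simp
      | succ s ih =>
        have hk : (s : ℂ) + 1 ≠ 0 := by exact_mod_cast s.succ_ne_zero
        apply smul_right_injective A hk
        change ((s : ℂ) + 1) • _ = ((s : ℂ) + 1) • _
        rw [← mul_smul_comm, ← smul_mul_assoc, succ_smul_divPow_succ, ← mul_assoc, hhf,
          sub_mul, mul_assoc, ih]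
        have : Commute f (divPow f s) := commute_divPow (Commute.refl f) s
        push_cast
        noncomm_ring
    rw [← mul_smul_comm, succ_smul_divPow_succ, smul_add, ← smul_mul_assoc,
      succ_smul_divPow_succ, ← mul_assoc, hef, add_mul, mul_assoc, ih, hh]
    have h1 : (((s + 1 : ℕ) : ℂ) + 1) • (divPow f (s + 1) * (h - ((s + 1 : ℕ) : A))) =
        ((s : ℂ) + 1) • (divPow f (s + 1) * (h - ((s + 1 : ℕ) : A))) +
          divPow f (s + 1) * (h - ((s + 1 : ℕ) : A)) := by
      push_cast
      rw [add_smul _ (1 : ℂ), one_smul]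
    rw [h1, ← smul_mul_assoc, succ_smul_divPow_succ]
    have h2 : divPow f (s + 1) * (s : A) + divPow f (s + 1) = f * divPow f s := by
      rw [← succ_smul_divPow_succ, add_smul, one_smul, Algebra.smul_def, map_natCast]
      congr 1
      exact (Nat.cast_commute s _).symm.eq
    push_cast
    have h3 : f * (divPow f s * (h - s)) = f * divPow f s * (h - (s + 1)) + f * divPow f s := by
      noncomm_ring
    rw [mul_add, h3, ← h2]
    noncomm_ring

/-- The commutation formula for divided powers of the standard generators of `sl₂`. -/
theorem divPow_mul_divPow {e f h : A} (hef : e * f = f * e + h) (hhf : h * f = f * h - 2 * f)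
    (hhe : h * e = e * h + 2 * e) (r s : ℕ) (hrs : r ≤ s) :
    divPow e r * divPow f s = ∑ p ∈ antidiagonal r,
      divPow f (s - p.2) * binom (h + ((2 * p.2 - r - s : ℤ) : A)) p.2 * divPow e p.1 := by
  induction r with
  | zero => simp
  | succ r ih =>
    have hk : (r : ℂ) + 1 ≠ 0 := by exact_mod_cast r.succ_ne_zero
    apply smul_right_injective A hk
    change ((r : ℂ) + 1) • _ = ((r : ℂ) + 1) • _
    rw [← smul_mul_assoc, succ_smul_divPow_succ, mul_assoc, ih (by omega), Finset.mul_sum,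
      Finset.smul_sum]
    -- `y j` is the argument of the binomial of order j at stage r + 1. At stage r it is `y j + 1`,
    -- and raising j by one adds 2.
    set y : ℕ → A := fun j => h + ((2 * j - (r + 1 : ℕ) - s : ℤ) : A) with hy
    -- Splitting r + 1 as p.1 + p.2 separates the terms in which the new e travels to the far right
    -- from those in which it is absorbed into the Cartan part. The first kind vanishes at p.1 = 0,
    -- the second at p.2 = 0, so both sums reindex over the antidiagonal of r.
    have hR : ∀ p ∈ antidiagonal (r + 1),
        ((r : ℂ) + 1) • (divPow f (s - p.2) * binom (y p.2) p.2 * divPow e p.1) =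
        (p.1 : ℂ) • (divPow f (s - p.2) * binom (y p.2 - 1) p.2 * divPow e p.1) +
        divPow f (s - p.2) * ((p.2 : ℂ) • binom (y p.2) p.2 +
          (p.1 : ℂ) • (binom (y p.2) p.2 - binom (y p.2 - 1) p.2)) * divPow e p.1 := by
      intro p hp
      have : (r : ℂ) + 1 = p.1 + p.2 := by
        rw [Finset.HasAntidiagonal.mem_antidiagonal] at hp
        exact_mod_cast hp.symm
      rw [this]
      simp only [mul_add, add_mul, mul_smul_comm, smul_mul_assoc, mul_sub, sub_mul, smul_sub,
        add_smul]
      abel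
    have hrhs := Finset.sum_congr (rfl : antidiagonal (r + 1) = _) hR
    refine Eq.trans ?_ hrhs.symm
    rw [Finset.sum_add_distrib]
    rw [Finset.Nat.sum_antidiagonal_succ, Finset.Nat.sum_antidiagonal_succ']
    simp only [Nat.cast_zero, zero_smul, zero_add, binom_zero, sub_self, add_zero, mul_zero,
      zero_mul, smul_zero]
    rw [← Finset.sum_add_distrib]
    refine Finset.sum_congr rfl fun p hp => ?_
    obtain ⟨i, j⟩ := p
    rw [Finset.HasAntidiagonal.mem_antidiagonal] at hp
    simp only at hp ⊢
    -- Here the bound r + 1 ≤ s enters: no subtraction truncates, and e always meets a positive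
    -- divided power of f.
    obtain ⟨t, ht⟩ : ∃ t, s - j = t + 1 := ⟨s - j - 1, by omega⟩
    have ht' : s - (j + 1) = t := by omega
    rw [ht, ht', ← mul_assoc, ← mul_assoc, mul_divPow_succ hef hhf, add_mul, add_mul]
    have hyj : h + ((2 * j - r - s : ℤ) : A) = y j + 1 := by
      simp only [hy]; push_cast; abel
    have hyj' : y (j + 1) = y j + 2 := by
      simp only [hy]; push_cast; rw [← one_add_one_eq_two]; noncomm_ring
    rw [hyj, hyj']
    congr 1
    · have hs : SemiconjBy e (y j + 1) (y j - 1) := by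
        unfold SemiconjBy
        simp only [hy]
        rw [sub_mul, add_mul, hhe, mul_add, mul_add]
        rw [(Int.cast_commute _ e).eq]
        noncomm_ring
      rw [mul_assoc _ e, (semiconjBy_binom hs j).eq, ← mul_assoc, mul_assoc _ e,
        ← succ_smul_divPow_succ, mul_smul_comm]
      push_cast
      rfl
    · congr 1
      rw [mul_assoc]
      congr 1
      -- By Pascal and absorption, the Cartan part is y j + 2 + i times the binomial of order j at y
      -- j + 1, and y j + 2 + i = h - t.
      have h1 := binom_pascal (y j + 2) j
      have h2 : y j + 2 - 1 = y j + 1 := by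
        rw [add_sub_assoc]; norm_num
      rw [h2] at h1
      rw [h2, h1, add_sub_cancel_left]
      have h3 := succ_smul_binom_succ' (y j + 2) j
      rw [h2, h1] at h3
      push_cast
      rw [h3]
      have h4 : (i : ℂ) • binom (y j + 1) j = (i : A) * binom (y j + 1) j := by
        rw [Algebra.smul_def, map_natCast]
      rw [h4, ← add_mul]
      congr 1
      have : (s : ℤ) = t + 1 + j := by omega
      simp only [hy]
      rw [this, ← hp]
      push_cast
      rw [← one_add_one_eq_two]
      noncomm_ring

/-- In the formula for e^{(k)} f^{(k)} the term p = (0, k) is exactly the binomial of h of order k,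
without shift. All other terms contain binomials of smaller order, so the claim follows by strong
induction. -/
theorem binom_mem_of_divPow_mem {e f h : A} (hef : e * f = f * e + h)
    (hhf : h * f = f * h - 2 * f) (hhe : h * e = e * h + 2 * e) (S : Subalgebra ℤ A)
    (he : ∀ k, divPow e k ∈ S) (hf : ∀ k, divPow f k ∈ S) (k : ℕ) : binom h k ∈ S := by
  induction k using Nat.strong_induction_on with
  | _ k ih =>
    -- The other terms have h shifted down by a natural number; Pascal's rule lowers the argument
    -- one unit at a time without raising the order.
    have hshift : ∀ c : ℕ, ∀ i < k, binom (h - c) i ∈ S := by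
      intro c
      induction c with
      | zero => simpa using ih
      | succ c ihc =>
        intro i hi
        induction i with
        | zero => simp
        | succ i ihi =>
          have h1 := binom_pascal (h - c) i
          have h2 : h - c - 1 = h - ((c + 1 : ℕ) : A) := by push_cast; abel
          rw [h2] at h1
          rw [← sub_eq_iff_eq_add] at h1
          rw [← h1]
          exact S.sub_mem (ihc _ hi) (ihi (by omega))
    have key := divPow_mul_divPow hef hhf hhe k k le_rfl
    rw [← Finset.add_sum_erase _ _ (show (0, k) ∈ antidiagonal k by simp)] at key
    have hz : (2 * (k : ℤ) - k - k : ℤ) = 0 := by ring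
    simp only [Nat.sub_self, divPow_zero, one_mul, mul_one, hz, Int.cast_zero, add_zero] at key
    rw [← sub_eq_iff_eq_add] at key
    rw [← key]
    refine S.sub_mem (S.mul_mem (he k) (hf k)) (S.sum_mem fun p hp => ?_)
    rw [Finset.mem_erase, Finset.HasAntidiagonal.mem_antidiagonal] at hp
    have hlt : p.2 < k := by
      rcases Nat.lt_or_ge p.2 k with h | h
      · exact h
      · exact absurd (Prod.ext (by simp; omega) (by simp; omega)) hp.1
    refine S.mul_mem (S.mul_mem (hf _) ?_) (he _)
    have h3 : h + ((2 * p.2 - k - k : ℤ) : A) = h - ((2 * (k - p.2) : ℕ) : A) := by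
      have : (2 * p.2 - k - k : ℤ) = -((2 * (k - p.2) : ℕ) : ℤ) := by push_cast; omega
      rw [this]
      push_cast
      abel
    rw [h3]
    exact hshift _ _ hlt

end Binom

/-! ### Exponentials and binomial series over commutative algebras -/

section Series

theorem coeff_pow_eq_zero {B : Type*} [CommRing B] {f : PowerSeries B} (hf : PowerSeries.coeff 0 f = 0) {r k : ℕ}
    (h : r < k) : PowerSeries.coeff r (f ^ k) = 0 := by
  have h1 : (PowerSeries.X : PowerSeries B) ∣ f := by
    rw [PowerSeries.X_dvd_iff]
    simpa using hf
  exact PowerSeries.X_pow_dvd_iff.mp (pow_dvd_pow_of_dvd h1 k) r h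

variable {B : Type*} [CommRing B] [Algebra ℂ B]

/-- Powers f^k with k > r do not reach degree r, so the exponential may be cut off at any common
bound. This is what lets coefficients of different degrees be summed together. -/
theorem coeff_expSeries {f : PowerSeries B} (hf : PowerSeries.coeff 0 f = 0) {r n : ℕ}
    (h : r ≤ n) : PowerSeries.coeff r (expSeries f) =
      ∑ k ∈ Finset.range (n + 1), ((k.factorial : ℂ)⁻¹) • PowerSeries.coeff r (f ^ k) := by
  rw [expSeries, PowerSeries.coeff_mk]
  refine Finset.sum_subset (fun k hk => ?_) fun k _ hk => ?_
  · rw [Finset.mem_range] at hk ⊢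
    omega
  · rw [Finset.mem_range] at hk
    rw [coeff_pow_eq_zero hf (by omega), smul_zero]

theorem derivative_expSeries {f : PowerSeries B} (hf : PowerSeries.coeff 0 f = 0) :
    PowerSeries.derivative B (expSeries f) = PowerSeries.derivative B f * expSeries f := by
  ext r
  rw [PowerSeries.coeff_derivative, coeff_expSeries hf le_rfl, Finset.sum_mul,
    PowerSeries.coeff_mul, Finset.sum_range_succ']
  have h1 : ∀ p ∈ antidiagonal r, PowerSeries.coeff p.1 (PowerSeries.derivative B f) *
      PowerSeries.coeff p.2 (expSeries f) = ∑ k ∈ Finset.range (r + 1),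
        ((k.factorial : ℂ)⁻¹) • (PowerSeries.coeff p.1 (PowerSeries.derivative B f) *
          PowerSeries.coeff p.2 (f ^ k)) := by
    intro p hp
    rw [Finset.HasAntidiagonal.mem_antidiagonal] at hp
    rw [coeff_expSeries hf (show p.2 ≤ r by omega), Finset.mul_sum]
    simp only [mul_smul_comm]
  rw [Finset.sum_congr rfl h1, Finset.sum_comm]
  have h0 : PowerSeries.coeff (r + 1) (f ^ 0) = 0 := by
    rw [pow_zero, PowerSeries.coeff_one, if_neg (Nat.succ_ne_zero r)]
  rw [h0, smul_zero, zero_mul, add_zero]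
  refine Finset.sum_congr rfl fun k _ => ?_
  rw [← Finset.smul_sum, ← PowerSeries.coeff_mul, smul_mul_assoc,
    ← PowerSeries.coeff_derivative, Derivation.leibniz_pow, Nat.add_sub_cancel, map_nsmul,
    smul_eq_mul, mul_comm (f ^ k), ← Nat.cast_smul_eq_nsmul ℂ, smul_smul, mul_comm _ ((k + 1 : ℕ) : ℂ),
    Nat.cast_add, Nat.cast_one, factorial_inv_mul_succ]

/-- The coefficient of degree n + 1 is determined by those of degree at most n, because n + 1 is
invertible. -/
theorem eq_of_derivative_eq {f₁ f₂ g : PowerSeries B}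
    (h₁ : PowerSeries.derivative B f₁ = g * f₁) (h₂ : PowerSeries.derivative B f₂ = g * f₂)
    (h0 : PowerSeries.coeff 0 f₁ = PowerSeries.coeff 0 f₂) : f₁ = f₂ := by
  ext n
  induction n using Nat.strong_induction_on with
  | _ n ih =>
    cases n with
    | zero => exact h0
    | succ n =>
      have hn : (n : ℂ) + 1 ≠ 0 := by exact_mod_cast n.succ_ne_zero
      have e1 := congrArg (PowerSeries.coeff n) h₁
      have e2 := congrArg (PowerSeries.coeff n) h₂
      rw [PowerSeries.coeff_derivative, PowerSeries.coeff_mul] at e1 e2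
      have e3 : ∑ p ∈ antidiagonal n, PowerSeries.coeff p.1 g * PowerSeries.coeff p.2 f₁ =
          ∑ p ∈ antidiagonal n, PowerSeries.coeff p.1 g * PowerSeries.coeff p.2 f₂ := by
        refine Finset.sum_congr rfl fun p hp => ?_
        rw [Finset.HasAntidiagonal.mem_antidiagonal] at hp
        rw [ih p.2 (by omega)]
      rw [e3, ← e2, mul_comm, mul_comm (PowerSeries.coeff (n + 1) f₂)] at e1
      have hs : ∀ x : B, ((n : B) + 1) * x = ((n : ℂ) + 1) • x := by
        intro x
        rw [Algebra.smul_def]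
        simp
      rw [hs, hs] at e1
      exact smul_right_injective _ hn e1

/-- The series `(1 - c u) ^ h = ∑ (-c) ^ k binom(h, k) u ^ k`. -/
def binomSeries (c h : B) : PowerSeries B := PowerSeries.mk fun k => (-c) ^ k * binom h k

/-- The series `∑_{n ≥ 1} h c ^ n u ^ n / n`. -/
def logSeries (c h : B) : PowerSeries B :=
  PowerSeries.mk fun n => if n = 0 then 0 else ((n : ℂ)⁻¹) • (h * c ^ n)

/-- The derivative is the geometric series hc/(1 - cu); clearing the denominator allows comparison
with the differential equation of (1 - cu)^h. -/
theorem one_sub_mul_derivative_logSeries (c h : B) :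
    (1 - PowerSeries.C c * PowerSeries.X) * PowerSeries.derivative B (logSeries c h) =
      PowerSeries.C (h * c) := by
  have hcoef : ∀ n, PowerSeries.coeff n (PowerSeries.derivative B (logSeries c h)) =
      h * c ^ (n + 1) := by
    intro n
    have hn : (n : ℂ) + 1 ≠ 0 := by exact_mod_cast n.succ_ne_zero
    rw [PowerSeries.coeff_derivative, logSeries, PowerSeries.coeff_mk, if_neg n.succ_ne_zero,
      mul_comm]
    have : ((n : B) + 1) = algebraMap ℂ B ((n : ℂ) + 1) := by simp
    rw [this, ← Algebra.smul_def, smul_smul]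
    push_cast
    rw [mul_inv_cancel₀ hn, one_smul]
  ext n
  rw [sub_mul, one_mul, map_sub, hcoef, mul_assoc, PowerSeries.coeff_C_mul]
  cases n with
  | zero => simp
  | succ n =>
    rw [PowerSeries.coeff_succ_X_mul, hcoef, PowerSeries.coeff_C, if_neg n.succ_ne_zero]
    ring

theorem one_sub_mul_derivative_binomSeries (c h : B) :
    (1 - PowerSeries.C c * PowerSeries.X) * PowerSeries.derivative B (binomSeries c h) =
      - (PowerSeries.C (h * c) * binomSeries c h) := by
  have hb : ∀ k : ℕ, binom h (k + 1) * ((k : B) + 1) = (h - k) * binom h k := by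
    intro k
    rw [← succ_smul_binom_succ, Algebra.smul_def, mul_comm]
    simp
  ext n
  rw [sub_mul, one_mul, map_sub, map_neg, mul_assoc, PowerSeries.coeff_C_mul,
    PowerSeries.coeff_C_mul, PowerSeries.coeff_derivative]
  cases n with
  | zero =>
    have h1 : binom h 1 = h := by simpa using hb 0
    simp [binomSeries, h1, mul_comm]
  | succ n =>
    rw [PowerSeries.coeff_succ_X_mul, PowerSeries.coeff_derivative]
    simp only [binomSeries, PowerSeries.coeff_mk]
    rw [mul_assoc, hb (n + 1)]
    push_cast
    ring

theorem derivative_binomSeries (c h : B) :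
    PowerSeries.derivative B (binomSeries c h) =
      - PowerSeries.derivative B (logSeries c h) * binomSeries c h := by
  have hu : IsUnit (1 - PowerSeries.C c * PowerSeries.X : PowerSeries B) := by
    rw [PowerSeries.isUnit_iff_constantCoeff]
    simp
  apply hu.mul_left_cancel
  rw [one_sub_mul_derivative_binomSeries, ← mul_assoc, mul_neg, one_sub_mul_derivative_logSeries,
    neg_mul]

/-- `exp (-∑_j ∑_n h_j c_j ^ n u ^ n / n) = ∏_j (1 - c_j u) ^ {h_j}`. -/
theorem expSeries_neg_sum_logSeries {J : Type*} (s : Finset J) (c h : J → B) :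
    expSeries (-∑ j ∈ s, logSeries (c j) (h j)) = ∏ j ∈ s, binomSeries (c j) (h j) := by
  classical
  have h0 : PowerSeries.coeff 0 (-∑ j ∈ s, logSeries (c j) (h j)) = 0 := by
    simp [logSeries]
  -- Both sides have the same logarithmic derivative, minus the sum of the derivatives of the
  -- logarithmic series, and the same constant term 1.
  refine eq_of_derivative_eq (derivative_expSeries h0) ?_ ?_
  · clear h0
    induction s using Finset.induction_on with
    | empty => simp
    | insert j s hj ih =>
      rw [Finset.prod_insert hj, Derivation.leibniz, ih, derivative_binomSeries,
        Finset.sum_insert hj, smul_eq_mul, smul_eq_mul, neg_add, map_add]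
      simp only [map_neg]
      ring
  · rw [coeff_expSeries h0 le_rfl]
    simp only [zero_add, Finset.range_one, Finset.sum_singleton, Nat.factorial_zero, Nat.cast_one,
      inv_one, one_smul, pow_zero, PowerSeries.coeff_zero_one]
    rw [PowerSeries.coeff_zero_eq_constantCoeff_apply, map_prod]
    symm
    refine Finset.prod_eq_one fun j _ => ?_
    rw [← PowerSeries.coeff_zero_eq_constantCoeff_apply]
    simp [binomSeries]

/-- Vandermonde's identity. -/
theorem binomSeries_sum {J : Type*} (s : Finset J) (c : B) (h : J → B) :
    binomSeries c (∑ j ∈ s, h j) = ∏ j ∈ s, binomSeries c (h j) := by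
  rw [← expSeries_neg_sum_logSeries]
  have := expSeries_neg_sum_logSeries (Finset.univ : Finset Unit) (fun _ => c)
    (fun _ => ∑ j ∈ s, h j)
  simp only [Finset.univ_unique, Finset.sum_singleton, Finset.prod_singleton] at this
  rw [← this]
  congr 2
  ext n
  simp [logSeries, Finset.sum_mul, Finset.smul_sum, Finset.sum_ite_irrel]

end Series

theorem map_expSeries {A B : Type*} [Ring A] [Algebra ℂ A] [Ring B] [Algebra ℂ B] (φ : A →ₐ[ℂ] B)
    (f : PowerSeries A) :
    PowerSeries.map (φ : A →+* B) (expSeries f) = expSeries (PowerSeries.map (φ : A →+* B) f) := by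
  ext r
  simp only [expSeries, PowerSeries.coeff_map, PowerSeries.coeff_mk, map_sum, ← map_pow]
  simp

/-! ### Automorphisms of root systems -/

section RootAut

open RootPairing

variable {ι R M N : Type*} [CommRing R] [AddCommGroup M] [Module R M] [AddCommGroup N] [Module R N]
  {P : RootPairing ι R M N} (w : P.Aut)

theorem aut_root (i : ι) : P.root (w.indexEquiv i) = Equiv.weightEquiv (P := P) (Q := P) w (P.root i) := by
  rw [Equiv.weightEquiv_apply]
  exact (Hom.root_weightMap_apply P P i w.toHom).symm

theorem weightEquiv_mem_range_root_iff (m : M) :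
    Equiv.weightEquiv (P := P) (Q := P) w m ∈ Set.range P.root ↔ m ∈ Set.range P.root := by
  constructor
  · rintro ⟨j, hj⟩
    obtain ⟨i, rfl⟩ := w.indexEquiv.surjective j
    rw [aut_root] at hj
    exact ⟨i, (Equiv.weightEquiv (P := P) (Q := P) w).injective hj⟩
  · rintro ⟨i, rfl⟩
    exact ⟨w.indexEquiv i, aut_root w i⟩

theorem aut_pairing (i j : ι) :
    P.pairing (w.indexEquiv i) (w.indexEquiv j) = P.pairing i j := by
  have h1 := Hom.weight_coweight_transpose_apply P P (P.coroot (w.indexEquiv j)) w.toHom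
  rw [Hom.coroot_coweightMap_apply] at h1
  have h2 := LinearMap.congr_fun h1 (P.root i)
  simp only [LinearMap.dualMap_apply, Hom.root_weightMap_apply] at h2
  simpa [-Equiv.root_indexEquiv_eq_smul] using h2

theorem aut_pairingIn [CharZero R] [P.IsCrystallographic] (i j : ι) :
    P.pairingIn ℤ (w.indexEquiv i) (w.indexEquiv j) = P.pairingIn ℤ i j := by
  have := aut_pairing w i j
  rw [← P.algebraMap_pairingIn ℤ, ← P.algebraMap_pairingIn ℤ] at this
  simpa using this

theorem linearIndependent_aut_iff (i j : ι) :
    LinearIndependent R ![P.root (w.indexEquiv i), P.root (w.indexEquiv j)] ↔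
      LinearIndependent R ![P.root i, P.root j] := by
  have h : ((Equiv.weightEquiv (P := P) (Q := P) w : M →ₗ[R] M) ∘ ![P.root i, P.root j]) =
      ![P.root (w.indexEquiv i), P.root (w.indexEquiv j)] := by
    rw [aut_root, aut_root]
    ext k
    fin_cases k <;> rfl
  rw [← h]
  exact LinearMap.linearIndependent_iff _ (LinearEquiv.ker _)

/-- Root strings are defined by membership of root j - k · root i in the set of roots, which the
linear map underlying the automorphism respects. Hence the absolute values q + 1 of the Chevalley
structure constants are invariant. -/
theorem aut_chainBotCoeff [CharZero R] [IsDomain R] [Finite ι] [P.IsCrystallographic] (i j : ι) :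
    P.chainBotCoeff (w.indexEquiv i) (w.indexEquiv j) = P.chainBotCoeff i j := by
  by_cases h : LinearIndependent R ![P.root i, P.root j]
  · rw [chainBotCoeff_eq_sSup h, chainBotCoeff_eq_sSup ((linearIndependent_aut_iff w i j).mpr h)]
    congr 1
    ext k
    simp only [Set.mem_ofPred_eq]
    rw [aut_root, aut_root, ← map_nsmul, ← map_sub, weightEquiv_mem_range_root_iff]
  · rw [chainBotCoeff_of_not_linearIndependent h, chainBotCoeff_of_not_linearIndependent
      (mt (linearIndependent_aut_iff w i j).mp h)]

end RootAut

/-! ### Sums of roots whose difference is not a root -/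

section RootSum

open RootPairing

variable {ι R M N : Type*} [Field R] [CharZero R] [AddCommGroup M] [Module R M] [AddCommGroup N]
  [Module R N] {P : RootPairing ι R M N} [Finite ι] [P.IsCrystallographic] [P.IsReduced]

/-- The pairing is the bottom length minus the top length of the i-string through j; the bottom is 0
and the top is at least 1. -/
theorem pairingIn_neg_of_add_root {i j : ι} (h : P.root i + P.root j ∈ Set.range P.root)
    (h' : P.root j - P.root i ∉ Set.range P.root) : P.pairingIn ℤ j i < 0 := by
  have hli := P.linearIndependent_of_add_mem_range_root' h
  rw [← chainBotCoeff_sub_chainTopCoeff hli]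
  have h1 : P.chainBotCoeff i j = 0 := by
    rw [chainBotCoeff_eq_zero_iff]; exact Or.inr h'
  have h2 : 1 ≤ P.chainTopCoeff i j := one_le_chainTopCoeff_of_root_add_mem h
  omega

end RootSum

attribute [local instance 2000] LieRing.ofAssociativeRing

/-! ### The action of a diagram automorphism on root vectors -/

section RootVectors

open LieAlgebra LieAlgebra.IsKilling

variable {g : Type*} [LieRing g] [LieAlgebra ℂ g] [FiniteDimensional ℂ g] [LieAlgebra.IsSimple ℂ g]
variable {H : LieSubalgebra ℂ g} [H.IsCartanSubalgebra]

theorem root_negRoot (α : H.root) :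
    (rootSystem H).root (negRoot α) = - (rootSystem H).root α := by
  rw [negRoot, RootPairing.root_reflectionPerm, RootPairing.reflection_apply_self]

theorem negRoot_negRoot (α : H.root) : negRoot (negRoot α) = α := by
  apply (rootSystem H).root.injective
  rw [root_negRoot, root_negRoot, neg_neg]

theorem height_negRoot (b : (rootSystem H).Base) (α : H.root) :
    b.height (negRoot α) = - b.height α :=
  b.height_reflectionPerm_self α

/-- Root vectors commute if the sum of their roots is neither zero nor a root. -/
theorem lie_rootVector_eq_zero (C : ChevalleyBasis H) {α β : H.root}
    (h0 : (rootSystem H).root α + (rootSystem H).root β ≠ 0)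
    (h : (rootSystem H).root α + (rootSystem H).root β ∉ Set.range (rootSystem H).root) :
    ⁅C.x α, C.x β⁆ = 0 := by
  have hmem := LieAlgebra.lie_mem_genWeightSpace_of_mem_genWeightSpace (C.mem α) (C.mem β)
  -- A nonzero bracket would make the sum a weight of g, and a nonzero weight is a root.
  by_contra hne
  have hbot : LieModule.genWeightSpace g ((α.1 : H → ℂ) + (β.1 : H → ℂ)) ≠ ⊥ := by
    intro hb
    rw [hb] at hmem
    exact hne hmem
  let χ : LieModule.Weight ℂ H g := ⟨_, hbot⟩
  have hχ : χ.toLinear = (rootSystem H).root α + (rootSystem H).root β := by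
    ext x
    simp [χ]
  have hnz : χ.IsNonZero := by
    intro hz
    apply h0
    rw [← hχ]
    ext x
    exact congrFun hz x
  exact h ⟨⟨χ, by simpa using hnz⟩, hχ⟩

theorem lie_rootVector_coroot (C : ChevalleyBasis H) (α : H.root) (h : H) :
    ⁅(h : g), C.x α⁆ = (rootSystem H).root α h • C.x α :=
  lie_eq_smul_of_mem_rootSpace (C.mem α) h

theorem rootVector_ne_zero (C : ChevalleyBasis H) (α : H.root) : C.x α ≠ 0 := by
  intro h
  have h1 := C.lie_neg α
  rw [h, zero_lie] at h1
  exact (rootSystem H).flip.ne_zero α (Subtype.ext h1.symm)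

variable {C : ChevalleyBasis H} {b : (rootSystem H).Base} (D : DiagramAut C b)

theorem root_perm_add {α β γ : H.root}
    (h : (rootSystem H).root γ = (rootSystem H).root α + (rootSystem H).root β) :
    (rootSystem H).root (D.perm γ) =
      (rootSystem H).root (D.perm α) + (rootSystem H).root (D.perm β) := by
  simp only [DiagramAut.perm, aut_root] at *
  rw [h, map_add]

theorem toLie_smul (c : ℂ) (x : g) : D.toLie (c • x) = c • D.toLie x :=
  (D.toLie : g →ₗ[ℂ] g).map_smul c x

theorem perm_injective : Function.Injective D.perm := D.toAut.indexEquiv.injective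

theorem perm_negRoot (α : H.root) : D.perm (negRoot α) = negRoot (D.perm α) := by
  apply (rootSystem H).root.injective
  rw [root_negRoot]
  simp only [DiagramAut.perm, aut_root]
  rw [root_negRoot, map_neg]

theorem perm_iterate_negRoot (α : H.root) (j : ℕ) :
    D.perm^[j] (negRoot α) = negRoot (D.perm^[j] α) := by
  induction j with
  | zero => rfl
  | succ j ih => rw [Function.iterate_succ_apply', ih, perm_negRoot, Function.iterate_succ_apply']

/-- The simple roots are permuted, so the height is constant on orbits. Two members of an orbit are
therefore never opposite and never differ by a root. -/
theorem height_perm (α : H.root) : b.height (D.perm α) = b.height α := by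
  refine b.induction_add α (p := fun α => b.height (D.perm α) = b.height α) ?_ ?_ ?_
  · intro i hi
    change b.height (D.perm (negRoot i)) = b.height (negRoot i)
    rw [perm_negRoot, height_negRoot, height_negRoot, hi]
  · intro i hi
    rw [RootPairing.Base.height_one_of_mem_support hi,
      RootPairing.Base.height_one_of_mem_support (D.perm_mem_base hi)]
  · intro i j k hk hi hj
    rw [b.height_add (root_perm_add D hk), b.height_add hk, hi,
      RootPairing.Base.height_one_of_mem_support hj,
      RootPairing.Base.height_one_of_mem_support (D.perm_mem_base hj)]

theorem height_perm_iterate (α : H.root) (j : ℕ) : b.height (D.perm^[j] α) = b.height α := by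
  induction j with
  | zero => rfl
  | succ j ih => rw [Function.iterate_succ_apply', height_perm, ih]

theorem add_root_ne_zero_of_height_eq {α β : H.root} (h : b.height α = b.height β) :
    (rootSystem H).root α + (rootSystem H).root β ≠ 0 := by
  intro h0
  have h1 : β = negRoot α := by
    apply (rootSystem H).root.injective
    rw [root_negRoot, eq_neg_iff_add_eq_zero, add_comm, h0]
  have h2 := b.height_ne_zero α
  rw [h1, height_negRoot] at h
  omega

/-- The difference would be a root of height zero. -/
theorem sub_root_notMem_of_height_eq {α β : H.root} (h : b.height α = b.height β) :
    (rootSystem H).root α - (rootSystem H).root β ∉ Set.range (rootSystem H).root := by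
  rintro ⟨γ, hγ⟩
  have h1 := b.height_sub hγ
  exact b.height_ne_zero γ (by omega)

/-- A diagram automorphism permutes the root vectors up to sign. -/
theorem exists_toLie_rootVector (α : H.root) :
    ∃ s : ℤˣ, D.toLie (C.x α) = ((s : ℤ) : ℂ) • C.x (D.perm α) := by
  -- Applying σ to [x_i, x_j] = ±(q+1) x_k and using that q is the same for the image pair, q + 1
  -- cancels and only a product of signs remains.
  have key : ∀ i j k : H.root,
      (rootSystem H).root k = (rootSystem H).root i + (rootSystem H).root j →
      (∃ s : ℤˣ, D.toLie (C.x i) = ((s : ℤ) : ℂ) • C.x (D.perm i)) →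
      (∃ s : ℤˣ, D.toLie (C.x j) = ((s : ℤ) : ℂ) • C.x (D.perm j)) →
      ∃ s : ℤˣ, D.toLie (C.x k) = ((s : ℤ) : ℂ) • C.x (D.perm k) := by
    rintro i j k hk ⟨s, hs⟩ ⟨t, ht⟩
    obtain ⟨u, hu⟩ := C.lie_add i j k hk
    obtain ⟨v, hv⟩ := C.lie_add _ _ _ (root_perm_add D hk)
    have hq : (rootSystem H).chainBotCoeff (D.perm i) (D.perm j) =
        (rootSystem H).chainBotCoeff i j := aut_chainBotCoeff _ _ _
    rw [hq] at hv
    set q := (rootSystem H).chainBotCoeff i j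
    have hq0 : (((q : ℤ) + 1 : ℤ) : ℂ) ≠ 0 := by
      have : (q : ℤ) + 1 ≠ 0 := by omega
      exact_mod_cast this
    have h1 := congrArg D.toLie hu
    rw [LieEquiv.map_lie, hs, ht, smul_lie, lie_smul, hv, toLie_smul] at h1
    refine ⟨u * s * t * v, ?_⟩
    have hu2 : ((u : ℤ) : ℂ) * ((u : ℤ) : ℂ) = 1 := by
      rcases Int.units_eq_one_or u with rfl | rfl <;> simp
    apply smul_right_injective g hq0
    change _ • _ = _ • _
    have h2 := congrArg (((u : ℤ) : ℂ) • ·) h1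
    simp only [smul_smul] at h2
    rw [smul_smul]
    have e1 : ((u : ℤ) : ℂ) * ((((u : ℤ) * (q + 1) : ℤ) : ℂ)) = (((q : ℤ) + 1 : ℤ) : ℂ) := by
      rw [Int.cast_mul, ← mul_assoc, hu2, one_mul]
    rw [e1] at h2
    rw [← h2]
    congr 1
    push_cast
    ring
  have pos : ∀ α : H.root, b.IsPos α →
      (∃ s : ℤˣ, D.toLie (C.x α) = ((s : ℤ) : ℂ) • C.x (D.perm α)) ∧
      (∃ s : ℤˣ, D.toLie (C.x (negRoot α)) = ((s : ℤ) : ℂ) • C.x (D.perm (negRoot α))) := by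
    intro α hα
    refine hα.induction_on_add (p := fun α =>
      (∃ s : ℤˣ, D.toLie (C.x α) = ((s : ℤ) : ℂ) • C.x (D.perm α)) ∧
      (∃ s : ℤˣ, D.toLie (C.x (negRoot α)) = ((s : ℤ) : ℂ) • C.x (D.perm (negRoot α)))) ?_ ?_
    · intro i hi
      refine ⟨⟨1, ?_⟩, ⟨1, ?_⟩⟩
      · rw [Units.val_one, Int.cast_one, one_smul]; exact D.map_pos i hi
      · rw [perm_negRoot]
        rw [Units.val_one, Int.cast_one, one_smul]; exact D.map_neg i hi
    · intro i j k hk hi hj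
      refine ⟨key i j k hk hi.1 ⟨1, by rw [Units.val_one, Int.cast_one, one_smul]; exact D.map_pos j hj⟩,
        key (negRoot i) (negRoot j) (negRoot k) ?_ hi.2 ⟨1, ?_⟩⟩
      · rw [root_negRoot, root_negRoot, root_negRoot, hk, neg_add]
      · rw [perm_negRoot]
        rw [Units.val_one, Int.cast_one, one_smul]; exact D.map_neg j hj
  rcases RootPairing.Base.IsPos.or_neg b α with h | h
  · exact (pos α h).1
  · have := (pos (negRoot α) h).2
    rwa [negRoot_negRoot] at this

theorem exists_toLie_iterate_rootVector (α : H.root) (j : ℕ) :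
    ∃ s : ℤˣ, D.toLie^[j] (C.x α) = ((s : ℤ) : ℂ) • C.x (D.perm^[j] α) := by
  induction j with
  | zero => exact ⟨1, by simp⟩
  | succ j ih =>
    obtain ⟨s, hs⟩ := ih
    obtain ⟨t, ht⟩ := exists_toLie_rootVector D (D.perm^[j] α)
    refine ⟨s * t, ?_⟩
    rw [Function.iterate_succ_apply', hs, toLie_smul, ht, smul_smul,
      Function.iterate_succ_apply']
    simp

theorem toLie_iterate_lie (x y : g) (n : ℕ) :
    D.toLie^[n] ⁅x, y⁆ = ⁅D.toLie^[n] x, D.toLie^[n] y⁆ := by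
  induction n with
  | zero => rfl
  | succ n ih => simp only [Function.iterate_succ_apply', ih, LieEquiv.map_lie]

theorem toLie_iterate_smul (c : ℂ) (x : g) (n : ℕ) :
    D.toLie^[n] (c • x) = c • D.toLie^[n] x := by
  induction n with
  | zero => rfl
  | succ n ih => simp only [Function.iterate_succ_apply', ih, toLie_smul]

/-- The number m is defined as the order on the root system, and the signs of σ on root vectors
might a priori accumulate. They do not: σ^m fixes the simple root vectors of both signs, and
brackets with nonzero structure constants reach all the others. -/
theorem toLie_iterate_order (α : H.root) : D.toLie^[D.order] (C.x α) = C.x α := by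
  have simple : ∀ i ∈ b.support, ∀ n : ℕ, D.toLie^[n] (C.x i) = C.x (D.perm^[n] i) ∧
      D.toLie^[n] (C.x (negRoot i)) = C.x (negRoot (D.perm^[n] i)) := by
    intro i hi n
    induction n with
    | zero => exact ⟨rfl, rfl⟩
    | succ n ih =>
      simp only [Function.iterate_succ_apply', ih.1, ih.2]
      exact ⟨D.map_pos _ (D.perm_iterate_mem_base hi n), D.map_neg _ (D.perm_iterate_mem_base hi n)⟩
  have key : ∀ i j k : H.root,
      (rootSystem H).root k = (rootSystem H).root i + (rootSystem H).root j →
      D.toLie^[D.order] (C.x i) = C.x i → D.toLie^[D.order] (C.x j) = C.x j →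
      D.toLie^[D.order] (C.x k) = C.x k := by
    intro i j k hk hi hj
    obtain ⟨u, hu⟩ := C.lie_add i j k hk
    have h1 := toLie_iterate_lie D (C.x i) (C.x j) D.order
    rw [hi, hj, hu, toLie_iterate_smul] at h1
    refine smul_right_injective g ?_ h1
    have : (u : ℤ) * ((rootSystem H).chainBotCoeff i j + 1) ≠ 0 :=
      mul_ne_zero u.ne_zero (by omega)
    exact_mod_cast this
  have pos : ∀ α : H.root, b.IsPos α → D.toLie^[D.order] (C.x α) = C.x α ∧
      D.toLie^[D.order] (C.x (negRoot α)) = C.x (negRoot α) := by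
    intro α hα
    refine hα.induction_on_add (p := fun α => D.toLie^[D.order] (C.x α) = C.x α ∧
      D.toLie^[D.order] (C.x (negRoot α)) = C.x (negRoot α)) ?_ ?_
    · intro i hi
      have := simple i hi D.order
      rwa [D.perm_iterate_order] at this
    · intro i j k hk hi hj
      have := simple j hj D.order
      rw [D.perm_iterate_order] at this
      refine ⟨key i j k hk hi.1 this.1, key _ _ _ ?_ hi.2 this.2⟩
      rw [root_negRoot, root_negRoot, root_negRoot, hk, neg_add]
  rcases RootPairing.Base.IsPos.or_neg b α with h | h
  · exact (pos α h).1
  · have := (pos (negRoot α) h).2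
    rwa [negRoot_negRoot] at this

/-- A root vector for a `σ`-fixed root is an eigenvector of `σ`. -/
theorem exists_rootVector_mem_piece {ζ : ℂ} (hζ : IsPrimitiveRoot ζ D.order) (h0 : D.order ≠ 0)
    {α : H.root} (hα : D.perm α = α) : ∃ r : ℤ, C.x α ∈ D.piece ζ (-r) := by
  obtain ⟨s, hs⟩ := exists_toLie_rootVector D α
  rw [hα] at hs
  have h1 : ∀ n : ℕ, D.toLie^[n] (C.x α) = ((s : ℤ) : ℂ) ^ n • C.x α := by
    intro n
    induction n with
    | zero => simp
    | succ n ih =>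
      rw [Function.iterate_succ_apply', ih, toLie_smul, hs, smul_smul, pow_succ]
  have h2 := toLie_iterate_order D α
  rw [h1] at h2
  -- The eigenvalue of σ is an m-th root of unity, hence a power of ζ.
  have h3 : ((s : ℤ) : ℂ) ^ D.order = 1 := by
    have : (((s : ℤ) : ℂ) ^ D.order - 1) • C.x α = 0 := by rw [sub_smul, h2, one_smul, sub_self]
    rcases smul_eq_zero.mp this with h | h
    · exact sub_eq_zero.mp h
    · exact absurd h (rootVector_ne_zero C α)
  have : NeZero D.order := ⟨h0⟩
  obtain ⟨i, -, hi⟩ := hζ.eq_pow_of_pow_eq_one h3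
  refine ⟨-i, ?_⟩
  rw [DiagramAut.piece, Module.End.mem_eigenspace_iff]
  simp only [neg_neg, zpow_natCast, hi]
  exact hs

/-- `α + σ(α)` is a root. -/
def SumIsRoot (α : H.root) : Prop :=
  ∃ β : H.root, (rootSystem H).root β =
    (rootSystem H).root α + (rootSystem H).root (D.perm α)

theorem pairingIn_perm (α β : H.root) :
    (rootSystem H).pairingIn ℤ (D.perm α) (D.perm β) = (rootSystem H).pairingIn ℤ α β :=
  aut_pairingIn _ _ _

variable {D}

theorem SumIsRoot.perm {α : H.root} (h : SumIsRoot D α) : SumIsRoot D (D.perm α) := by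
  obtain ⟨β, hβ⟩ := h
  exact ⟨D.perm β, root_perm_add D hβ⟩

theorem SumIsRoot.pairingIn_neg {α : H.root} (h : SumIsRoot D α) :
    (rootSystem H).pairingIn ℤ (D.perm α) α < 0 ∧
      (rootSystem H).pairingIn ℤ α (D.perm α) < 0 := by
  obtain ⟨β, hβ⟩ := h
  constructor
  · exact pairingIn_neg_of_add_root ⟨β, hβ⟩ (sub_root_notMem_of_height_eq (height_perm D α))
  · exact pairingIn_neg_of_add_root ⟨β, by rw [hβ, add_comm]⟩
      (sub_root_notMem_of_height_eq (height_perm D α).symm)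

/-- Suppose m = 3. All pairings between neighbours in the cycle α, σα, σ²α are negative, so α + σα
pairs negatively with σ²α and δ = α + σα + σ²α is a root. It is fixed by σ, so 2 = ⟨δ, δ⟩ is three
times the integer ⟨α, δ⟩, which is impossible. -/
theorem SumIsRoot.order_ne_three {α : H.root} (h : SumIsRoot D α) : D.order ≠ 3 := by
  intro h3
  have h3' : D.perm (D.perm (D.perm α)) = α := by
    have := D.perm_iterate_order α
    rwa [h3] at this
  have p1 := h.pairingIn_neg
  have p2 := h.perm.pairingIn_neg
  have p3 := h.perm.perm.pairingIn_neg
  rw [h3'] at p3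
  obtain ⟨γ, hγ⟩ := h
  set α₁ := D.perm α with hα₁
  set α₂ := D.perm α₁ with hα₂
  have hγ2 : (rootSystem H).pairingIn ℤ γ α₂ < 0 := by
    have : (rootSystem H).pairingIn ℤ γ α₂ =
        (rootSystem H).pairingIn ℤ α α₂ + (rootSystem H).pairingIn ℤ α₁ α₂ := by
      apply Int.cast_injective (α := ℂ)
      have e : ∀ i j, (((rootSystem H).pairingIn ℤ i j : ℤ) : ℂ) = (rootSystem H).pairing i j :=
        fun i j => (rootSystem H).algebraMap_pairingIn ℤ i j
      rw [Int.cast_add, e, e, e]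
      simp only [RootPairing.pairing, RootPairing.root', hγ, map_add, LinearMap.add_apply]
    omega
  have hne : (rootSystem H).root γ ≠ - (rootSystem H).root α₂ := by
    intro hc
    have h4 : γ = negRoot α₂ := (rootSystem H).root.injective (by rw [root_negRoot, hc])
    have h5 := b.height_add hγ
    rw [h4, height_negRoot, hα₂, height_perm, hα₁, height_perm] at h5
    have := b.height_ne_zero α
    omega
  obtain ⟨δ, hδ⟩ := (rootSystem H).root_add_root_mem_of_pairingIn_neg hγ2 hne
  have hδσ : D.perm δ = δ := by
    apply (rootSystem H).root.injective
    rw [root_perm_add D hδ, root_perm_add D hγ, h3', hδ, hγ]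
    abel
  have q1 : (rootSystem H).pairingIn ℤ α₁ δ = (rootSystem H).pairingIn ℤ α δ := by
    conv_lhs => rw [← hδσ, hα₁]
    exact pairingIn_perm D α δ
  have q2 : (rootSystem H).pairingIn ℤ α₂ δ = (rootSystem H).pairingIn ℤ α₁ δ := by
    conv_lhs => rw [← hδσ, hα₂]
    exact pairingIn_perm D α₁ δ
  have q3 : (rootSystem H).pairingIn ℤ δ δ = (rootSystem H).pairingIn ℤ α δ +
      (rootSystem H).pairingIn ℤ α₁ δ + (rootSystem H).pairingIn ℤ α₂ δ := by
    apply Int.cast_injective (α := ℂ)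
    have e : ∀ i j, (((rootSystem H).pairingIn ℤ i j : ℤ) : ℂ) = (rootSystem H).pairing i j :=
      fun i j => (rootSystem H).algebraMap_pairingIn ℤ i j
    rw [Int.cast_add, Int.cast_add, e, e, e, e]
    conv_lhs => rw [RootPairing.pairing, RootPairing.root', hδ, hγ]
    simp only [RootPairing.pairing, RootPairing.root', map_add, LinearMap.add_apply]
  have q4 : (rootSystem H).pairingIn ℤ δ δ = 2 := (rootSystem H).pairingIn_same ℤ δ
  omega

theorem SumIsRoot.perm_ne {α : H.root} (h : SumIsRoot D α) : D.perm α ≠ α := by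
  intro hc
  have := h.pairingIn_neg.1
  rw [hc, (rootSystem H).pairingIn_same] at this
  omega

/-- If `σ² = 1` and `β = α + σ(α)` is a root, then `α + β` is not a root. -/
theorem SumIsRoot.add_notMem {α β : H.root} (h2 : D.perm (D.perm α) = α)
    (hβ : (rootSystem H).root β = (rootSystem H).root α + (rootSystem H).root (D.perm α)) :
    (rootSystem H).root α + (rootSystem H).root β ∉ Set.range (rootSystem H).root := by
  have h : SumIsRoot D α := ⟨β, hβ⟩
  have hli : LinearIndependent ℂ ![(rootSystem H).root α, (rootSystem H).root (D.perm α)] :=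
    (rootSystem H).linearIndependent_of_add_mem_range_root' ⟨β, hβ⟩
  have hp := h.pairingIn_neg
  have heq : (rootSystem H).pairingIn ℤ (D.perm α) α =
      (rootSystem H).pairingIn ℤ α (D.perm α) := by
    have := pairingIn_perm D α (D.perm α)
    rwa [h2] at this
  -- The two pairings of α and σ(α) are the same negative integer a, and a² is at most 3 by
  -- independence. So the α-string through σ(α) goes up just once, whereas α + β = σ(α) + 2α would
  -- need two steps.
  have hw := (rootSystem H).coxeterWeightIn_mem_set_of_isCrystallographic α (D.perm α)
  have hw4 := (RootPairing.linearIndependent_iff_coxeterWeightIn_ne_four (rootSystem H) ℤ).mp hli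
  rw [RootPairing.coxeterWeightIn, heq] at hw hw4
  have hbot : (rootSystem H).chainBotCoeff α (D.perm α) = 0 := by
    rw [RootPairing.chainBotCoeff_eq_zero_iff]
    exact Or.inr (sub_root_notMem_of_height_eq (height_perm D α))
  have htop := RootPairing.chainTopCoeff_sub_chainBotCoeff hli
  rw [hbot, heq] at htop
  intro hmem
  have h3 : (rootSystem H).root (D.perm α) + 2 • (rootSystem H).root α ∈
      Set.range (rootSystem H).root := by
    rw [hβ] at hmem
    convert hmem using 1
    rw [two_smul]
    abel
  rw [RootPairing.root_add_nsmul_mem_range_iff_le_chainTopCoeff hli] at h3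
  set a := (rootSystem H).pairingIn ℤ α (D.perm α)
  simp only [Set.mem_insert_iff, Set.mem_singleton_iff] at hw
  have h4 : a ≤ -2 := by omega
  have h5 : 4 ≤ a * a := by nlinarith
  omega

/-- Commutation of the vectors `σ^j(x_α)` when `α + σ(α)` is not a root. -/
theorem lie_toLie_iterate_eq_zero (hm : D.order = 1 ∨ D.order = 2 ∨ D.order = 3) {α : H.root}
    (h : ¬ SumIsRoot D α) {i j : ℕ} (hi : i < D.order) (hj : j < D.order) :
    ⁅D.toLie^[i] (C.x α), D.toLie^[j] (C.x α)⁆ = 0 := by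
  rcases eq_or_ne i j with rfl | hij
  · exact lie_self _
  obtain ⟨s, hs⟩ := exists_toLie_iterate_rootVector D α i
  obtain ⟨t, ht⟩ := exists_toLie_iterate_rootVector D α j
  rw [hs, ht, smul_lie, lie_smul]
  have key : ⁅C.x (D.perm^[i] α), C.x (D.perm^[j] α)⁆ = 0 := by
    refine lie_rootVector_eq_zero C (add_root_ne_zero_of_height_eq (b := b) ?_) ?_
    · rw [height_perm_iterate, height_perm_iterate]
    · rintro ⟨β, hβ⟩
      have hsucc : ∀ k l γ, (rootSystem H).root γ = (rootSystem H).root (D.perm^[k] α) +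
          (rootSystem H).root (D.perm^[l] α) → ∃ γ', (rootSystem H).root γ' =
          (rootSystem H).root (D.perm^[k + 1] α) + (rootSystem H).root (D.perm^[l + 1] α) := by
        intro k l γ hγ
        rw [Function.iterate_succ_apply', Function.iterate_succ_apply']
        exact ⟨D.perm γ, root_perm_add D hγ⟩
      have hord := D.perm_iterate_order α
      wlog hlt : i < j generalizing i j s t
      · exact this hj hi hij.symm t ht s hs (by rw [hβ, add_comm]) (by omega)
      rcases hm with hm | hm | hm
      · omega
      · obtain rfl : i = 0 := by omega
        obtain rfl : j = 1 := by omega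
        exact h ⟨β, hβ⟩
      · rw [hm] at hord
        -- Each pair of exponents modulo 3 is carried to {0, 1} by applying σ zero, one or two
        -- times, so the sum of the two roots is conjugate to α + σ(α).
        obtain ⟨rfl, rfl⟩ | ⟨rfl, rfl⟩ | ⟨rfl, rfl⟩ :
            (i = 0 ∧ j = 1) ∨ (i = 0 ∧ j = 2) ∨ (i = 1 ∧ j = 2) := by omega
        · exact h ⟨β, hβ⟩
        · obtain ⟨γ, hγ⟩ := hsucc _ _ _ hβ
          have e : D.perm^[2 + 1] α = α := hord
          rw [e, add_comm] at hγ
          exact h ⟨γ, hγ⟩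
        · obtain ⟨γ, hγ⟩ := hsucc _ _ _ hβ
          obtain ⟨γ', hγ'⟩ := hsucc _ _ _ hγ
          have e : D.perm^[2 + 1] α = α := hord
          have e' : D.perm^[2 + 1 + 1] α = D.perm α := by
            rw [Function.iterate_succ_apply', e]
          have e'' : D.perm^[1 + 1 + 1] α = α := hord
          rw [e', e''] at hγ'
          exact h ⟨γ', hγ'⟩
  rw [key, smul_zero, smul_zero]

/-- If `α + σ(α)` is a root `β`, then `m = 2` and `x_α`, `σ(x_α)` generate a Heisenberg algebra with
central element `± x_β`. -/
theorem SumIsRoot.heisenberg (hm : D.order = 1 ∨ D.order = 2 ∨ D.order = 3) {α : H.root}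
    (h : SumIsRoot D α) : D.order = 2 ∧ ∃ (β : H.root) (s : ℤˣ), D.perm β = β ∧
      b.height β = 2 * b.height α ∧
      ⁅C.x α, D.toLie (C.x α)⁆ = ((s : ℤ) : ℂ) • C.x β ∧ ⁅C.x α, C.x β⁆ = 0 ∧
      ⁅D.toLie (C.x α), C.x β⁆ = 0 := by
  have hord := D.perm_iterate_order α
  have hm2 : D.order = 2 := by
    rcases hm with hm | hm | hm
    · rw [hm] at hord
      exact absurd hord h.perm_ne
    · exact hm
    · exact absurd hm h.order_ne_three
  rw [hm2] at hord
  have h2 : D.perm (D.perm α) = α := hord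
  obtain ⟨β, hβ⟩ := h
  have hβσ : D.perm β = β := by
    apply (rootSystem H).root.injective
    rw [root_perm_add D hβ, h2, hβ, add_comm]
  have hht : b.height β = 2 * b.height α := by
    rw [b.height_add hβ, height_perm]
    ring
  have hne0 : ∀ γ : H.root, b.height γ = b.height α →
      (rootSystem H).root γ + (rootSystem H).root β ≠ 0 := by
    intro γ hγ h0
    have h1 : β = negRoot γ := by
      apply (rootSystem H).root.injective
      rw [root_negRoot, eq_neg_iff_add_eq_zero, add_comm, h0]
    rw [h1, height_negRoot, hγ] at hht
    have := b.height_ne_zero α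
    omega
  obtain ⟨s, hs⟩ := exists_toLie_rootVector D α
  obtain ⟨t, ht⟩ := C.lie_add _ _ _ hβ
  -- Since σ(α) - α is not a root, q = 0 and the structure constant is a sign.
  have hbot : (rootSystem H).chainBotCoeff α (D.perm α) = 0 := by
    rw [RootPairing.chainBotCoeff_eq_zero_iff]
    exact Or.inr (sub_root_notMem_of_height_eq (height_perm D α))
  refine ⟨hm2, β, s * t, hβσ, hht, ?_, ?_, ?_⟩
  · rw [hs, lie_smul, ht, hbot, smul_smul]
    simp
  · exact lie_rootVector_eq_zero C (hne0 α rfl) (SumIsRoot.add_notMem h2 hβ)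
  · rw [hs, smul_lie]
    rw [lie_rootVector_eq_zero C (hne0 _ (height_perm D α)), smul_zero]
    refine SumIsRoot.add_notMem (D := D) (by rw [h2]) ?_
    rw [h2, hβ, add_comm]

/-- Every root lies in the orbit of an element of `± O`. -/
theorem exists_orbitRep (O : D.OrbitReps) (h0 : D.order ≠ 0) (γ : H.root) :
    ∃ (α : H.root) (l : ℕ), (α ∈ O.carrier ∨ negRoot α ∈ O.carrier) ∧ l < D.order ∧
      D.perm^[l] α = γ := by
  have hper : ∀ (α : H.root) (k : ℕ), D.perm^[D.order * k] α = α := by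
    intro α k
    induction k with
    | zero => rfl
    | succ k ih => rw [Nat.mul_succ, Function.iterate_add_apply, D.perm_iterate_order, ih]
  have pos : ∀ γ : H.root, b.IsPos γ → ∃ α ∈ O.carrier, ∃ l < D.order, D.perm^[l] α = γ := by
    intro γ hγ
    obtain ⟨α, ⟨hα, k, hk⟩, -⟩ := O.existsUnique γ hγ
    -- The representative is σ^k(γ); the exponent leading back is -k modulo m, written as mk - k to
    -- stay in the natural numbers.
    refine ⟨α, hα, (D.order * k - k) % D.order, Nat.mod_lt _ (Nat.pos_of_ne_zero h0), ?_⟩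
    have hle : k ≤ D.order * k := Nat.le_mul_of_pos_left k (Nat.pos_of_ne_zero h0)
    have h1 : D.perm^[D.order * k - k] α = γ := by
      rw [← hk, ← Function.iterate_add_apply, Nat.sub_add_cancel hle, hper]
    conv_rhs => rw [← h1, ← Nat.mod_add_div (D.order * k - k) D.order,
      Function.iterate_add_apply, hper]
  rcases RootPairing.Base.IsPos.or_neg b γ with h | h
  · obtain ⟨α, hα, l, hl, e⟩ := pos γ h
    exact ⟨α, l, Or.inl hα, hl, e⟩
  · obtain ⟨α, hα, l, hl, e⟩ := pos (negRoot γ) h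
    refine ⟨negRoot α, l, Or.inr (by rwa [negRoot_negRoot]), hl, ?_⟩
    rw [perm_iterate_negRoot, e, negRoot_negRoot]

end RootVectors

/-! ### The rational form of the enveloping algebra -/

section RatAlgebra

variable {g : Type*} [LieRing g] [LieAlgebra ℂ g]

/-- `U(g)` as an algebra over the rational numbers. -/
@[reducible] def envelopingRatAlgebra : Algebra ℚ (UniversalEnvelopingAlgebra ℂ g) :=
  Algebra.compHom _ (algebraMap ℚ ℂ)

attribute [local instance] envelopingRatAlgebra

theorem envelopingRatTower : IsScalarTower ℚ ℂ (UniversalEnvelopingAlgebra ℂ g) :=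
  IsScalarTower.of_algebraMap_eq fun _ => rfl

attribute [local instance] envelopingRatTower

theorem rat_smul_eq (q : ℚ) (u : UniversalEnvelopingAlgebra ℂ g) : q • u = (q : ℂ) • u := by
  rw [← algebraMap_smul ℂ q u]
  rfl

end RatAlgebra

section RationalForm

open LieAlgebra LieAlgebra.IsKilling

variable {g : Type*} [LieRing g] [LieAlgebra ℂ g] [FiniteDimensional ℂ g] [LieAlgebra.IsSimple ℂ g]
variable {H : LieSubalgebra ℂ g} [H.IsCartanSubalgebra]

theorem span_simple_coroot (b : (rootSystem H).Base) :
    Submodule.span ℂ (Set.range fun i : b.support => (((rootSystem H).coroot i : H) : g)) =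
      H.toSubmodule := by
  have h1 : Submodule.span ℂ ((rootSystem H).coroot '' b.support) = ⊤ := by
    rw [b.span_coroot_support]
    exact RootPairing.IsRootSystem.span_coroot_eq_top
  have h2 : (Set.range fun i : b.support => (((rootSystem H).coroot i : H) : g)) =
      H.toSubmodule.subtype '' ((rootSystem H).coroot '' b.support) := by
    ext y
    constructor
    · rintro ⟨i, rfl⟩
      exact ⟨_, ⟨i, i.2, rfl⟩, rfl⟩
    · rintro ⟨_, ⟨i, hi, rfl⟩, rfl⟩
      exact ⟨⟨i, hi⟩, rfl⟩
  rw [h2]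
  refine (Submodule.map_span H.toSubmodule.subtype _).symm.trans ?_
  refine (congrArg (Submodule.map H.toSubmodule.subtype) h1).trans ?_
  exact Submodule.map_subtype_top H.toSubmodule

theorem linearIndependent_rootVector_coroot (C : ChevalleyBasis H) (b : (rootSystem H).Base) :
    LinearIndependent ℂ (Sum.elim C.x
      fun i : b.support => (((rootSystem H).coroot i : H) : g)) := by
  have hind := LieSubmodule.iSupIndep_toSubmodule.mpr (LieModule.iSupIndep_genWeightSpace ℂ H g)
  refine LinearIndependent.sum_type ?_ ?_ ?_
  · have hinj : Function.Injective (fun α : H.root => (α.1 : H → ℂ)) :=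
      fun α β h => Subtype.ext (DFunLike.coe_injective h)
    exact (hind.comp hinj).linearIndependent _ (fun α => C.mem α) (rootVector_ne_zero C)
  · have h1 : LinearIndependent ℂ (fun i : b.support => (rootSystem H).coroot i) :=
      b.linearIndepOn_coroot
    exact h1.map' H.toSubmodule.subtype (Submodule.ker_subtype _)
  · have h0 := hind 0
    rw [span_simple_coroot, disjoint_comm]
    refine h0.mono ?_ ?_
    · exact (congrArg LieSubmodule.toSubmodule (rootSpace_zero_eq ℂ g H)).ge
    · rw [Submodule.span_le]
      rintro _ ⟨α, rfl⟩
      refine Submodule.mem_iSup_of_mem (α.1 : H → ℂ) (Submodule.mem_iSup_of_mem ?_ (C.mem α))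
      intro hz
      exact H.isNonZero_coe_root α hz

/-- The root space decomposition: the zero weight space is the Cartan subalgebra, and every root
space is one-dimensional. -/
theorem span_rootVector_coroot (C : ChevalleyBasis H) (b : (rootSystem H).Base) :
    ⊤ ≤ Submodule.span ℂ (Set.range (Sum.elim C.x
      fun i : b.support => (((rootSystem H).coroot i : H) : g))) := by
  have htop := LieModule.iSup_genWeightSpace_eq_top' ℂ H g
  rw [← LieSubmodule.toSubmodule_inj, LieSubmodule.iSup_toSubmodule,
    LieSubmodule.top_toSubmodule] at htop
  rw [← htop, Set.Sum.elim_range, Submodule.span_union, span_simple_coroot]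
  refine iSup_le fun χ => ?_
  by_cases hχ : χ.IsZero
  · refine le_trans ?_ le_sup_right
    have h0 : (χ : H → ℂ) = 0 := hχ
    rw [h0]
    exact (congrArg LieSubmodule.toSubmodule (rootSpace_zero_eq ℂ g H)).le
  · refine le_trans ?_ le_sup_left
    let α : H.root := ⟨χ, by simpa using hχ⟩
    intro y hy
    have h1 := (finrank_eq_one_iff_of_nonzero' (⟨C.x α, C.mem α⟩ : rootSpace H χ)
      (fun h => rootVector_ne_zero C α (congrArg Subtype.val h))).mp
      (finrank_rootSpace_eq_one χ hχ) ⟨y, hy⟩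
    obtain ⟨c, hc⟩ := h1
    have h2 : c • C.x α = y := congrArg Subtype.val hc
    rw [← h2]
    exact Submodule.smul_mem _ _ (Submodule.subset_span ⟨α, rfl⟩)

/-- The basis of `g` consisting of the root vectors and the simple coroots. -/
def rootVectorBasis (C : ChevalleyBasis H) (b : (rootSystem H).Base) :
    Module.Basis (H.root ⊕ b.support) ℂ g :=
  Module.Basis.mk (linearIndependent_rootVector_coroot C b) (span_rootVector_coroot C b)

attribute [local instance] envelopingRatAlgebra

attribute [local instance] envelopingRatTower

/-- The rational form of `U(g)`. -/
def ratForm (C : ChevalleyBasis H) : Subalgebra ℚ (UniversalEnvelopingAlgebra ℂ g) :=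
  Algebra.adjoin ℚ (Set.range fun α => UniversalEnvelopingAlgebra.ι ℂ (C.x α))

variable (C : ChevalleyBasis H)

/-- `x_α` in the rational form. -/
def ratX (α : H.root) : ratForm C :=
  ⟨UniversalEnvelopingAlgebra.ι ℂ (C.x α), Algebra.subset_adjoin ⟨α, rfl⟩⟩

theorem ι_coroot_mem_ratForm (α : H.root) :
    UniversalEnvelopingAlgebra.ι ℂ (((rootSystem H).coroot α : H) : g) ∈ ratForm C := by
  rw [← C.lie_neg, LieHom.map_lie, LieRing.of_associative_ring_bracket]
  exact sub_mem (mul_mem (ratX C _).2 (ratX C _).2) (mul_mem (ratX C _).2 (ratX C _).2)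

/-- `h_α` in the rational form. -/
def ratH (α : H.root) : ratForm C :=
  ⟨UniversalEnvelopingAlgebra.ι ℂ (((rootSystem H).coroot α : H) : g), ι_coroot_mem_ratForm C α⟩

/-- The linear map `g → ℂ ⊗_ℚ U_ℚ(g)` underlying `ratLie`. -/
def ratLin (b : (rootSystem H).Base) : g →ₗ[ℂ] ℂ ⊗[ℚ] ratForm C :=
  (rootVectorBasis C b).constr ℂ (Sum.elim (fun α => 1 ⊗ₜ ratX C α) fun i => 1 ⊗ₜ ratH C i)

/-- `y ∈ g` is defined over the rational numbers. -/
def IsRational (b : (rootSystem H).Base) (y : g) : Prop :=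
  ∃ z : ratForm C, (z : UniversalEnvelopingAlgebra ℂ g) = UniversalEnvelopingAlgebra.ι ℂ y ∧
    ratLin C b y = 1 ⊗ₜ z

variable {C}

theorem IsRational.zero (b : (rootSystem H).Base) : IsRational C b 0 :=
  ⟨0, by simp, by simp⟩

theorem IsRational.add {b : (rootSystem H).Base} {y₁ y₂ : g} (h₁ : IsRational C b y₁)
    (h₂ : IsRational C b y₂) : IsRational C b (y₁ + y₂) := by
  obtain ⟨z₁, e₁, f₁⟩ := h₁
  obtain ⟨z₂, e₂, f₂⟩ := h₂
  exact ⟨z₁ + z₂, by simp [e₁, e₂], by simp [f₁, f₂, TensorProduct.tmul_add]⟩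

theorem IsRational.zsmul {b : (rootSystem H).Base} {y : g} (h : IsRational C b y) (n : ℤ) :
    IsRational C b (n • y) := by
  obtain ⟨z, e, f⟩ := h
  exact ⟨n • z, by rw [map_zsmul, ← e]; rfl, by rw [map_zsmul, f, TensorProduct.tmul_smul]⟩

theorem IsRational.intCast_smul {b : (rootSystem H).Base} {y : g} (h : IsRational C b y) (n : ℤ) :
    IsRational C b ((n : ℂ) • y) := by
  rw [Int.cast_smul_eq_zsmul]
  exact h.zsmul n

theorem IsRational.rootVector (b : (rootSystem H).Base) (α : H.root) :
    IsRational C b (C.x α) := by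
  refine ⟨ratX C α, rfl, ?_⟩
  have hb : rootVectorBasis C b (Sum.inl α) = C.x α := by simp [rootVectorBasis]
  rw [ratLin, ← hb, Module.Basis.constr_basis]
  rfl

theorem IsRational.coroot (b : (rootSystem H).Base) (α : H.root) :
    IsRational C b (((rootSystem H).coroot α : H) : g) := by
  -- Only simple coroots are basis vectors; a general coroot is an integral combination of them.
  have key : ∀ y ∈ Submodule.span ℤ ((rootSystem H).coroot '' b.support),
      IsRational C b ((y : H) : g) := by
    intro y hy
    induction hy using Submodule.span_induction with
    | mem y hy =>
      obtain ⟨i, hi, rfl⟩ := hy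
      refine ⟨ratH C i, rfl, ?_⟩
      have hb : rootVectorBasis C b (Sum.inr ⟨i, hi⟩) = (((rootSystem H).coroot i : H) : g) := by
        simp [rootVectorBasis]
      rw [ratLin, ← hb, Module.Basis.constr_basis]
      rfl
    | zero => exact IsRational.zero b
    | add y₁ y₂ _ _ h₁ h₂ => exact h₁.add h₂
    | smul n y _ h =>
      have : ((n • y : H) : g) = n • (y : g) := map_zsmul H.toSubmodule.subtype n y
      rw [this]
      exact h.zsmul n
  exact key _ (b.coroot_mem_span_int α)

/-- The commutator identity holds inside the rational form, because it holds in U(g), and it is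
transported by z ↦ 1 ⊗ z. This is why the bracket must also be known to be rational. -/
theorem IsRational.ratLin_lie {b : (rootSystem H).Base} {x y : g} (hx : IsRational C b x)
    (hy : IsRational C b y) (hxy : IsRational C b ⁅x, y⁆) :
    ratLin C b ⁅x, y⁆ = ratLin C b x * ratLin C b y - ratLin C b y * ratLin C b x := by
  obtain ⟨u, hu, hu'⟩ := hx
  obtain ⟨v, hv, hv'⟩ := hy
  obtain ⟨w, hw, hw'⟩ := hxy
  have h : w = u * v - v * u := by
    apply Subtype.ext
    rw [hw, LieHom.map_lie, LieRing.of_associative_ring_bracket, ← hu, ← hv]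
    rfl
  rw [hw', hu', hv', Algebra.TensorProduct.tmul_mul_tmul,
    Algebra.TensorProduct.tmul_mul_tmul, h, TensorProduct.tmul_sub, one_mul]

theorem isRational_lie_rootVector (b : (rootSystem H).Base) (α β : H.root) :
    IsRational C b ⁅C.x α, C.x β⁆ := by
  by_cases h0 : (rootSystem H).root α + (rootSystem H).root β = 0
  · have h1 : β = negRoot α := by
      apply (rootSystem H).root.injective
      rw [root_negRoot, eq_neg_iff_add_eq_zero, add_comm, h0]
    rw [h1, C.lie_neg]
    exact IsRational.coroot b α
  · by_cases h : (rootSystem H).root α + (rootSystem H).root β ∈ Set.range (rootSystem H).root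
    · obtain ⟨γ, hγ⟩ := h
      obtain ⟨s, hs⟩ := C.lie_add α β γ hγ
      rw [hs]
      exact (IsRational.rootVector b γ).intCast_smul _
    · rw [lie_rootVector_eq_zero C h0 h]
      exact IsRational.zero b

theorem isRational_lie_coroot_rootVector (b : (rootSystem H).Base) (α β : H.root) :
    IsRational C b ⁅(((rootSystem H).coroot α : H) : g), C.x β⁆ := by
  rw [lie_rootVector_coroot]
  have h : (rootSystem H).root β ((rootSystem H).coroot α) =
      (((rootSystem H).pairingIn ℤ β α : ℤ) : ℂ) :=
    ((rootSystem H).algebraMap_pairingIn ℤ β α).symm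
  rw [h]
  exact (IsRational.rootVector b β).intCast_smul _

variable (C)

/-- The Lie algebra homomorphism `g → ℂ ⊗_ℚ U_ℚ(g)`. -/
def ratLie (b : (rootSystem H).Base) : g →ₗ⁅ℂ⁆ ℂ ⊗[ℚ] ratForm C :=
  { ratLin C b with
    map_lie' := by
      have gen : ∀ i j, IsRational C b ⁅rootVectorBasis C b i, rootVectorBasis C b j⁆ := by
        intro i j
        simp only [rootVectorBasis, Module.Basis.coe_mk]
        rcases i with α | i <;> rcases j with β | j <;> simp only [Sum.elim_inl, Sum.elim_inr]
        · exact isRational_lie_rootVector b α β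
        · rw [← lie_skew, ← neg_one_zsmul]
          exact (isRational_lie_coroot_rootVector b _ _).zsmul _
        · exact isRational_lie_coroot_rootVector b _ _
        · have h0 : ⁅(rootSystem H).coroot i, (rootSystem H).coroot j⁆ = 0 :=
            LieModule.IsTrivial.trivial _ _
          have h1 := congrArg (Subtype.val : H → g) h0
          rw [LieSubalgebra.coe_bracket] at h1
          rw [h1]
          exact IsRational.zero b
      have rat : ∀ i, IsRational C b (rootVectorBasis C b i) := by
        intro i
        simp only [rootVectorBasis, Module.Basis.coe_mk]
        rcases i with α | i
        · exact IsRational.rootVector b α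
        · exact IsRational.coroot b i
      intro x y
      change ratLin C b ⁅x, y⁆ = ratLin C b x * ratLin C b y - ratLin C b y * ratLin C b x
      have hx : x ∈ Submodule.span ℂ (Set.range (rootVectorBasis C b)) := by
        rw [Module.Basis.span_eq]; trivial
      have hy : y ∈ Submodule.span ℂ (Set.range (rootVectorBasis C b)) := by
        rw [Module.Basis.span_eq]; trivial
      induction hx using Submodule.span_induction with
      | mem x hx =>
        obtain ⟨i, rfl⟩ := hx
        induction hy using Submodule.span_induction with
        | mem y hy =>
          obtain ⟨j, rfl⟩ := hy
          exact (rat i).ratLin_lie (rat j) (gen i j)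
        | zero => simp
        | add y₁ y₂ _ _ h₁ h₂ => rw [lie_add, map_add, map_add, h₁, h₂]; noncomm_ring
        | smul c y _ h => rw [lie_smul, map_smul, map_smul, h, mul_smul_comm, smul_mul_assoc, smul_sub]
      | zero => simp
      | add x₁ x₂ _ _ h₁ h₂ => rw [add_lie, map_add, map_add, h₁, h₂]; noncomm_ring
      | smul c x _ h => rw [smul_lie, map_smul, map_smul, h, mul_smul_comm, smul_mul_assoc, smul_sub] }

/-- The homomorphism `U(g) → ℂ ⊗_ℚ U_ℚ(g)`. -/
def ratMap (b : (rootSystem H).Base) : UniversalEnvelopingAlgebra ℂ g →ₐ[ℂ] ℂ ⊗[ℚ] ratForm C :=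
  UniversalEnvelopingAlgebra.lift ℂ (ratLie C b)

theorem ratMap_ι (b : (rootSystem H).Base) (y : g) :
    ratMap C b (UniversalEnvelopingAlgebra.ι ℂ y) = ratLin C b y :=
  UniversalEnvelopingAlgebra.lift_ι_apply ℂ _ y

/-- Consequently ℂ ⊗ U_ℚ(g) → U(g) has a left inverse, so ℚ-independent elements of the rational
form stay independent over ℂ. It is obtained from the universal property alone and takes the place
of the Poincaré–Birkhoff–Witt theorem. -/
theorem ratMap_coe (b : (rootSystem H).Base) (z : ratForm C) :
    ratMap C b (z : UniversalEnvelopingAlgebra ℂ g) = 1 ⊗ₜ z := by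
  obtain ⟨z, hz⟩ := z
  induction hz using Algebra.adjoin_induction with
  | mem y hy =>
    obtain ⟨α, rfl⟩ := hy
    obtain ⟨w, hw, hw'⟩ := IsRational.rootVector (C := C) b α
    rw [ratMap_ι, hw']
    congr 1
    exact Subtype.ext hw
  | algebraMap q =>
    have h1 : (algebraMap ℚ (UniversalEnvelopingAlgebra ℂ g) q) =
        algebraMap ℂ (UniversalEnvelopingAlgebra ℂ g) (q : ℂ) := rfl
    change ratMap C b (algebraMap ℚ (UniversalEnvelopingAlgebra ℂ g) q) =
      1 ⊗ₜ algebraMap ℚ (ratForm C) q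
    rw [h1, AlgHom.commutes, Algebra.algebraMap_eq_smul_one q, Algebra.algebraMap_eq_smul_one,
      Algebra.TensorProduct.one_def, TensorProduct.tmul_smul, TensorProduct.smul_tmul',
      TensorProduct.smul_tmul']
    congr 1
  | add x y hx hy ihx ihy =>
    have h : (⟨x + y, add_mem hx hy⟩ : ratForm C) = ⟨x, hx⟩ + ⟨y, hy⟩ := rfl
    rw [h, TensorProduct.tmul_add, ← ihx, ← ihy, ← map_add]
    rfl
  | mul x y hx hy ihx ihy =>
    have h : (⟨x * y, mul_mem hx hy⟩ : ratForm C) = ⟨x, hx⟩ * ⟨y, hy⟩ := rfl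
    have h1 : (1 : ℂ) ⊗ₜ[ℚ] ((⟨x, hx⟩ : ratForm C) * ⟨y, hy⟩) =
        (1 : ℂ) ⊗ₜ[ℚ] (⟨x, hx⟩ : ratForm C) * (1 : ℂ) ⊗ₜ[ℚ] (⟨y, hy⟩ : ratForm C) := by
      rw [Algebra.TensorProduct.tmul_mul_tmul, one_mul]
    rw [h, h1, ← ihx, ← ihy, ← map_mul]
    rfl

theorem kostant_le_ratForm {y : UniversalEnvelopingAlgebra ℂ g} (hy : y ∈ kostant C) :
    y ∈ ratForm C := by
  induction hy using Algebra.adjoin_induction with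
  | mem y hy =>
    obtain ⟨α, k, rfl⟩ := hy
    have : divPow (UniversalEnvelopingAlgebra.ι ℂ (C.x α)) k =
        ((k.factorial : ℚ)⁻¹) • (UniversalEnvelopingAlgebra.ι ℂ (C.x α)) ^ k := by
      rw [rat_smul_eq, divPow]
      push_cast
      rfl
    rw [this]
    exact Subalgebra.smul_mem _ (pow_mem (ratX C α).2 k) _
  | algebraMap n =>
    rw [Algebra.algebraMap_eq_smul_one]
    exact zsmul_mem (one_mem _) n
  | add x y _ _ hx hy => exact add_mem hx hy
  | mul x y _ _ hx hy => exact mul_mem hx hy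

/-- The extension to `U(g)` of a linear form on its rational form. -/
def extendForm (b : (rootSystem H).Base) (f : ratForm C →ₗ[ℚ] ℚ) :
    UniversalEnvelopingAlgebra ℂ g →ₗ[ℂ] ℂ :=
  (TensorProduct.AlgebraTensorModule.rid ℚ ℂ ℂ).toLinearMap ∘ₗ
    (TensorProduct.AlgebraTensorModule.map (LinearMap.id : ℂ →ₗ[ℂ] ℂ) f) ∘ₗ
      (ratMap C b).toLinearMap

theorem extendForm_coe (b : (rootSystem H).Base) (f : ratForm C →ₗ[ℚ] ℚ) (z : ratForm C) :
    extendForm C b f z = ((f z : ℚ) : ℂ) := by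
  simp [extendForm, ratMap_coe, Algebra.smul_def]

end RationalForm

/-! ### Descent to the integral form -/

section CoeffRing

theorem isIntegral_sqrt_two : IsIntegral ℤ ((Real.sqrt 2 : ℝ) : ℂ) := by
  refine IsIntegral.of_pow (n := 2) (by norm_num) ?_
  have : (((Real.sqrt 2 : ℝ) : ℂ)) ^ 2 = ((2 : ℤ) : ℂ) := by
    rw [← Complex.ofReal_pow, Real.sq_sqrt (by norm_num)]
    norm_num
  rw [this]
  exact isIntegral_algebraMap

/-- The ring is finite over ℤ because ζ and √2 are integral, and it is torsion-free as a subring of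
ℂ. -/
theorem coeffRing_free {ζ : ℂ} {m : ℕ} (hm : 0 < m) (hζ : ζ ^ m = 1) :
    Module.Free ℤ (coeffRing ζ) := by
  have hfin : (Subalgebra.toSubmodule (coeffRing ζ)).FG := by
    refine fg_adjoin_of_finite (Set.toFinite _) ?_
    intro x hx
    simp only [Set.mem_insert_iff, Set.mem_singleton_iff] at hx
    rcases hx with rfl | rfl
    · refine IsIntegral.of_pow hm ?_
      rw [hζ]
      exact isIntegral_one
    · exact isIntegral_sqrt_two
  have : Module.Finite ℤ (coeffRing ζ) := Module.Finite.iff_fg.mpr hfin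
  infer_instance

/-- The inclusion `ℤ[ζ,√2][t,t⁻¹] → ℂ[t,t⁻¹]`. -/
def coeffIncl (ζ : ℂ) : (coeffRing ζ)[T;T⁻¹] →ₐ[ℤ] ℂ[T;T⁻¹] :=
  AddMonoidAlgebra.mapAlgHom ℤ (coeffRing ζ).val

theorem coeffIncl_injective (ζ : ℂ) : Function.Injective (coeffIncl ζ) := by
  intro p q h
  ext n
  have := congrArg (fun r : ℂ[T;T⁻¹] => r.coeff n) h
  simpa [coeffIncl] using this

end CoeffRing

section Descent

open LieAlgebra LieAlgebra.IsKilling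

attribute [local instance] envelopingRatAlgebra envelopingRatTower

variable {g : Type*} [LieRing g] [LieAlgebra ℂ g] [FiniteDimensional ℂ g] [LieAlgebra.IsSimple ℂ g]
variable {H : LieSubalgebra ℂ g} [H.IsCartanSubalgebra]
variable (C : ChevalleyBasis H) (b : (rootSystem H).Base)

theorem toComplex_tmul (ζ : ℂ) (p : (coeffRing ζ)[T;T⁻¹]) (n : kostant C) :
    toComplex C ζ (p ⊗ₜ n) =
      coeffIncl ζ p ⊗ₜ[ℂ] (n : UniversalEnvelopingAlgebra ℂ g) := by
  rw [toComplex, Algebra.TensorProduct.lift_tmul]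
  change (coeffIncl ζ p ⊗ₜ[ℂ] (1 : UniversalEnvelopingAlgebra ℂ g)) *
    ((1 : ℂ[T;T⁻¹]) ⊗ₜ[ℂ] (n : UniversalEnvelopingAlgebra ℂ g)) = _
  rw [Algebra.TensorProduct.tmul_mul_tmul, one_mul, mul_one]

/-- The extension of a linear form on the rational form of `U(g)` to `ℂ[t,t⁻¹] ⊗ U(g)`. -/
def loopForm (f : ratForm C →ₗ[ℚ] ℚ) :
    ℂ[T;T⁻¹] ⊗[ℂ] UniversalEnvelopingAlgebra ℂ g →ₗ[ℂ] ℂ[T;T⁻¹] :=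
  (TensorProduct.rid ℂ ℂ[T;T⁻¹]).toLinearMap ∘ₗ LinearMap.lTensor ℂ[T;T⁻¹] (extendForm C b f)

theorem loopForm_tmul (f : ratForm C →ₗ[ℚ] ℚ) (p : ℂ[T;T⁻¹]) (u : UniversalEnvelopingAlgebra ℂ g) :
    loopForm C b f (p ⊗ₜ u) = extendForm C b f u • p := by
  simp [loopForm]

variable {C}

/-- If the coefficients of an element `z` of `ℤ[ζ,√2][t,t⁻¹] ⊗ U_ℤ(g)` lie in `ℂ ⊗ W`, where `W` is a
subspace of the rational form of `U(g)`, then they can be chosen in `W ∩ U_ℤ(g)`. -/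
theorem exists_sum_of_loopForm_eq_zero {ζ : ℂ} {m : ℕ} (hm : 0 < m) (hζ : ζ ^ m = 1)
    (W : Submodule ℚ (ratForm C)) (z : (coeffRing ζ)[T;T⁻¹] ⊗[ℤ] kostant C)
    (hz : ∀ f : ratForm C →ₗ[ℚ] ℚ, W ≤ LinearMap.ker f → loopForm C b f (toComplex C ζ z) = 0) :
    z ∈ AddSubmonoid.closure {y | ∃ (p : (coeffRing ζ)[T;T⁻¹]) (n : kostant C) (w : ratForm C),
      w ∈ W ∧ (w : UniversalEnvelopingAlgebra ℂ g) = n ∧ y = p ⊗ₜ[ℤ] n} := by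
  have := coeffRing_free hm hζ
  let B := Module.Free.chooseBasis ℤ (coeffRing ζ)[T;T⁻¹]
  obtain ⟨c, rfl⟩ := TensorProduct.eq_repr_basis_left (N := kostant C) B z
  -- A ℤ-basis of R[t,t⁻¹] is independent over ℚ in ℂ[t,t⁻¹], though not over ℂ in general. This is
  -- why the forms applied to the coefficients must take rational values.
  have hli : LinearIndependent ℚ fun i => coeffIncl ζ (B i) := by
    rw [← LinearIndependent.iff_fractionRing ℤ ℚ]
    exact B.linearIndependent.map' (coeffIncl ζ).toLinearMap
      (LinearMap.ker_eq_bot.mpr (coeffIncl_injective ζ))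
  refine AddSubmonoid.sum_mem _ fun i hi => AddSubmonoid.subset_closure
    ⟨B i, c i, ⟨c i, kostant_le_ratForm C (c i).2⟩, ?_, rfl, rfl⟩
  -- A coefficient outside W is separated from W by a rational form; applying that form to z would
  -- give a nontrivial ℚ-relation between the basis elements.
  by_contra hmem
  obtain ⟨f, hf0, hf⟩ := Submodule.exists_le_ker_of_notMem hmem
  have h := hz f hf
  rw [Finsupp.sum, map_sum, map_sum] at h
  have h' : ∑ j ∈ c.support, f ⟨c j, kostant_le_ratForm C (c j).2⟩ • coeffIncl ζ (B j) = 0 := by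
    rw [← h]
    refine Finset.sum_congr rfl fun j _ => ?_
    rw [toComplex_tmul, loopForm_tmul]
    have e := extendForm_coe C b f ⟨c j, kostant_le_ratForm C (c j).2⟩
    rw [e, Rat.cast_smul_eq_qsmul]
  exact hf0 (linearIndependent_iff'.mp hli _ _ h' i hi)

/-- The case W = 0 of the descent. -/
theorem eq_zero_of_toComplex_eq_zero (b : (rootSystem H).Base) {ζ : ℂ} {m : ℕ} (hm : 0 < m)
    (hζ : ζ ^ m = 1) (z : (coeffRing ζ)[T;T⁻¹] ⊗[ℤ] kostant C) (hz : toComplex C ζ z = 0) :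
    z = 0 := by
  have h := exists_sum_of_loopForm_eq_zero b hm hζ ⊥ z fun f _ =>
    (congrArg (loopForm C b f) hz).trans (loopForm C b f).map_zero
  clear hz
  induction h using AddSubmonoid.closure_induction with
  | mem y hy =>
    obtain ⟨p, n, w, hw, hwn, rfl⟩ := hy
    have hw0 : w = 0 := hw
    have hn : (n : UniversalEnvelopingAlgebra ℂ g) = 0 := by
      rw [← hwn, hw0, ZeroMemClass.coe_zero]
    have : n = 0 := ZeroMemClass.coe_eq_zero.mp hn
    rw [this, TensorProduct.tmul_zero]
  | zero => rfl
  | add x y _ _ hx hy => rw [hx, hy, add_zero]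

theorem toComplex_injective (b : (rootSystem H).Base) {ζ : ℂ} {m : ℕ} (hm : 0 < m) (hζ : ζ ^ m = 1) :
    Function.Injective (toComplex C ζ) :=
  (injective_iff_map_eq_zero (toComplex C ζ)).mpr (eq_zero_of_toComplex_eq_zero b hm hζ)

variable (C)

/-- The rational form of `U(h)`. -/
def ratCartan : Subalgebra ℚ (ratForm C) := Algebra.adjoin ℚ (Set.range (ratH C))

theorem ratCartan_coe_mem {w : ratForm C} (hw : w ∈ ratCartan C) :
    (w : UniversalEnvelopingAlgebra ℂ g) ∈ Algebra.adjoin ℂ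
      {y | ∃ h : H, y = UniversalEnvelopingAlgebra.ι ℂ (h : g)} := by
  induction hw using Algebra.adjoin_induction with
  | mem y hy =>
    obtain ⟨α, rfl⟩ := hy
    exact Algebra.subset_adjoin ⟨_, rfl⟩
  | algebraMap q =>
    have : ((algebraMap ℚ (ratForm C) q : ratForm C) : UniversalEnvelopingAlgebra ℂ g) =
      algebraMap ℂ (UniversalEnvelopingAlgebra ℂ g) (q : ℂ) := rfl
    rw [this]
    exact Subalgebra.algebraMap_mem _ _
  | add x y _ _ hx hy => exact add_mem hx hy
  | mul x y _ _ hx hy => exact mul_mem hx hy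

/-- The simple coroots span h, so `ratMap` carries U(h) into the image of ℂ ⊗ `ratCartan C`, where f
vanishes. -/
theorem extendForm_eq_zero_of_cartan {f : ratForm C →ₗ[ℚ] ℚ}
    (hf : Subalgebra.toSubmodule (ratCartan C) ≤ LinearMap.ker f)
    {u : UniversalEnvelopingAlgebra ℂ g} (hu : u ∈ Algebra.adjoin ℂ
      {y | ∃ h : H, y = UniversalEnvelopingAlgebra.ι ℂ (h : g)}) : extendForm C b f u = 0 := by
  have h1 : ratMap C b u ∈ (Algebra.TensorProduct.map (AlgHom.id ℂ ℂ) (ratCartan C).val).range := by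
    have h2 : u ∈ ((Algebra.TensorProduct.map (AlgHom.id ℂ ℂ) (ratCartan C).val).range).comap
        (ratMap C b) := by
      refine Algebra.adjoin_le ?_ hu
      rintro _ ⟨h, rfl⟩
      change ratMap C b (UniversalEnvelopingAlgebra.ι ℂ (h : g)) ∈
        (Algebra.TensorProduct.map (AlgHom.id ℂ ℂ) (ratCartan C).val).range
      rw [ratMap_ι]
      generalize hy : (h : g) = y
      have hh : y ∈ Submodule.span ℂ
          (Set.range fun i : b.support => (((rootSystem H).coroot i : H) : g)) := by
        rw [span_simple_coroot, ← hy]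
        exact h.2
      clear hy
      induction hh using Submodule.span_induction with
      | mem y hy =>
        obtain ⟨i, rfl⟩ := hy
        obtain ⟨w, hw, hw'⟩ := IsRational.coroot (C := C) b i
        have hwi : w = ratH C i := Subtype.ext hw
        subst hwi
        exact ⟨1 ⊗ₜ ⟨ratH C i, Algebra.subset_adjoin ⟨i, rfl⟩⟩, hw'.symm⟩
      | zero => rw [map_zero]; exact zero_mem _
      | add x y _ _ hx hy => rw [map_add]; exact add_mem hx hy
      | smul c x _ hx => rw [map_smul]; exact Subalgebra.smul_mem _ hx c
    exact h2
  obtain ⟨t, ht⟩ := h1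
  change TensorProduct.AlgebraTensorModule.rid ℚ ℂ ℂ
    (TensorProduct.AlgebraTensorModule.map (LinearMap.id : ℂ →ₗ[ℂ] ℂ) f (ratMap C b u)) = 0
  rw [← ht]
  clear ht
  induction t using TensorProduct.induction_on with
  | zero => simp
  | tmul c w =>
    have : f w = 0 := hf w.2
    simp [this]
  | add x y hx hy =>
    refine Eq.trans ?_ ((congrArg₂ (· + ·) hx hy).trans (add_zero 0))
    simp only [map_add]

variable {C}

/-- An element of `ℤ[ζ,√2][t,t⁻¹] ⊗ U_ℤ(g)` whose coefficients lie in `U(h)` comes from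
`ℤ[ζ,√2][t,t⁻¹] ⊗ U_ℤ(h)`. -/
theorem mem_span_kostantCartan (b : (rootSystem H).Base) {ζ : ℂ} {m : ℕ} (hm : 0 < m) (hζ : ζ ^ m = 1)
    (z : (coeffRing ζ)[T;T⁻¹] ⊗[ℤ] kostant C)
    (hz : toComplex C ζ z ∈ Submodule.span ℂ {y | ∃ (p : ℂ[T;T⁻¹]) (u : UniversalEnvelopingAlgebra ℂ g),
      u ∈ Algebra.adjoin ℂ {y | ∃ h : H, y = UniversalEnvelopingAlgebra.ι ℂ (h : g)} ∧
        y = p ⊗ₜ u}) :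
    z ∈ AddSubmonoid.closure {y | ∃ (p : (coeffRing ζ)[T;T⁻¹]) (n : kostantCartan C),
      y = p ⊗ₜ[ℤ] (Subalgebra.inclusion (inf_le_left : kostantCartan C ≤ kostant C) n)} := by
  -- The descent with W the rational form of U(h): coefficients in W that lie in U_ℤ(g) lie in
  -- U_ℤ(h).
  have h := exists_sum_of_loopForm_eq_zero b hm hζ (Subalgebra.toSubmodule (ratCartan C)) z
    fun f hf => by
      refine (Submodule.span_le (p := LinearMap.ker (loopForm C b f))).mpr ?_ hz
      rintro _ ⟨p, u, hu, rfl⟩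
      rw [SetLike.mem_coe, LinearMap.mem_ker, loopForm_tmul,
        extendForm_eq_zero_of_cartan C b hf hu, zero_smul]
  refine AddSubmonoid.closure_mono ?_ h
  rintro _ ⟨p, n, w, hw, hwn, rfl⟩
  refine ⟨p, ⟨n, n.2, ?_⟩, rfl⟩
  rw [← hwn]
  exact ratCartan_coe_mem C hw

end Descent

/-! ### Specialization -/

section Specialization

open LieAlgebra LieAlgebra.IsKilling

variable {g : Type*} [LieRing g] [LieAlgebra ℂ g] [FiniteDimensional ℂ g] [LieAlgebra.IsSimple ℂ g]
variable {H : LieSubalgebra ℂ g} [H.IsCartanSubalgebra]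

variable (g) in
/-- The algebra `ℂ[t,t⁻¹] ⊗ U(g)`. -/
abbrev LoopEnv : Type _ := ℂ[T;T⁻¹] ⊗[ℂ] UniversalEnvelopingAlgebra ℂ g

variable (g) in
/-- The map `g → ℂ[t,t⁻¹] ⊗ U(g)`, `x ↦ 1 ⊗ x`. -/
def constLoop : g →ₗ[ℂ] LoopEnv g :=
  (Algebra.TensorProduct.includeRight : UniversalEnvelopingAlgebra ℂ g →ₐ[ℂ] LoopEnv g).toLinearMap ∘ₗ
    (UniversalEnvelopingAlgebra.ι ℂ : g →ₗ⁅ℂ⁆ UniversalEnvelopingAlgebra ℂ g).toLinearMap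

theorem constLoop_apply (x : g) :
    constLoop g x = (1 : ℂ[T;T⁻¹]) ⊗ₜ[ℂ] UniversalEnvelopingAlgebra.ι ℂ x := rfl

theorem constLoop_lie (x y : g) :
    constLoop g ⁅x, y⁆ = constLoop g x * constLoop g y - constLoop g y * constLoop g x := by
  rw [constLoop_apply, LieHom.map_lie, LieRing.of_associative_ring_bracket, TensorProduct.tmul_sub]
  simp [constLoop_apply]

theorem constLoop_commute {x y : g} (h : ⁅x, y⁆ = 0) : Commute (constLoop g x) (constLoop g y) := by
  have := constLoop_lie x y
  rw [h, map_zero] at this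
  exact (sub_eq_zero.mp this.symm)

theorem evFormal_loopElt (x : g) (r : ℤ) :
    evFormal g (loopElt x r) = (LaurentPolynomial.T r : ℂ[T;T⁻¹]) • constLoop g x := by
  rw [evFormal, loopElt, UniversalEnvelopingAlgebra.lift_ι_apply, constLoop_apply,
    TensorProduct.smul_tmul', smul_eq_mul, mul_one]
  rfl

variable (C : ChevalleyBasis H) {ζ : ℂ} {F : Type*} [Field F] (χ : coeffRing ζ →+* F) (a : Fˣ)

/-- `x` is the specialization of the element `w` of `ℤ[ζ,√2][t,t⁻¹] ⊗ U_ℤ(g)`. -/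
def Spec (w : LoopEnv g) (x : Hyper F (kostant C)) : Prop :=
  ∃ z : (coeffRing ζ)[T;T⁻¹] ⊗[ℤ] kostant C, toComplex C ζ z = w ∧ x = specialize C χ a z

variable {C χ a}

/-- The lift to R[t,t⁻¹] ⊗ U_ℤ(g) is unique by injectivity of `toComplex`, so specialization is a
partial function on ℂ[t,t⁻¹] ⊗ U(g). -/
theorem Spec.unique (b : (rootSystem H).Base) {m : ℕ} (hm : 0 < m) (hζ : ζ ^ m = 1) {w : LoopEnv g}
    {x y : Hyper F (kostant C)} (hx : Spec C χ a w x) (hy : Spec C χ a w y) : x = y := by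
  obtain ⟨z, hz, rfl⟩ := hx
  obtain ⟨z', hz', rfl⟩ := hy
  rw [toComplex_injective b hm hζ (hz.trans hz'.symm)]

theorem Spec.add {w w' : LoopEnv g} {x x' : Hyper F (kostant C)} (h : Spec C χ a w x)
    (h' : Spec C χ a w' x') : Spec C χ a (w + w') (x + x') := by
  obtain ⟨z, rfl, rfl⟩ := h
  obtain ⟨z', rfl, rfl⟩ := h'
  exact ⟨z + z', map_add _ _ _, (map_add _ _ _).symm⟩

theorem Spec.mul {w w' : LoopEnv g} {x x' : Hyper F (kostant C)} (h : Spec C χ a w x)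
    (h' : Spec C χ a w' x') : Spec C χ a (w * w') (x * x') := by
  obtain ⟨z, rfl, rfl⟩ := h
  obtain ⟨z', rfl, rfl⟩ := h'
  exact ⟨z * z', map_mul _ _ _, (map_mul _ _ _).symm⟩

theorem Spec.zero : Spec C χ a 0 0 := ⟨0, map_zero _, (map_zero _).symm⟩

theorem Spec.one : Spec C χ a 1 1 := ⟨1, map_one _, (map_one _).symm⟩

theorem Spec.sum {J : Type*} (s : Finset J) {w : J → LoopEnv g} {x : J → Hyper F (kostant C)}
    (h : ∀ j ∈ s, Spec C χ a (w j) (x j)) : Spec C χ a (∑ j ∈ s, w j) (∑ j ∈ s, x j) := by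
  classical
  induction s using Finset.induction_on with
  | empty => exact Spec.zero
  | insert j s hj ih =>
    rw [Finset.sum_insert hj, Finset.sum_insert hj]
    exact (h j (Finset.mem_insert_self j s)).add
      (ih fun i hi => h i (Finset.mem_insert_of_mem hi))

theorem specialize_tmul (p : (coeffRing ζ)[T;T⁻¹]) (y : kostant C) :
    specialize C χ a (p ⊗ₜ y) = LaurentPolynomial.eval₂ χ a p ⊗ₜ[ℤ] y := rfl

theorem Spec.coe (y : kostant C) :
    Spec C χ a ((1 : ℂ[T;T⁻¹]) ⊗ₜ[ℂ] (y : UniversalEnvelopingAlgebra ℂ g)) (1 ⊗ₜ y) := by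
  refine ⟨1 ⊗ₜ y, ?_, ?_⟩
  · rw [toComplex_tmul, map_one]
  · rw [specialize_tmul, map_one]

theorem Spec.smul (p : (coeffRing ζ)[T;T⁻¹]) {w : LoopEnv g} {x : Hyper F (kostant C)}
    (h : Spec C χ a w x) : Spec C χ a (coeffIncl ζ p • w) (LaurentPolynomial.eval₂ χ a p • x) := by
  have h0 : Spec C χ a (coeffIncl ζ p ⊗ₜ[ℂ] (1 : UniversalEnvelopingAlgebra ℂ g))
      (LaurentPolynomial.eval₂ χ a p ⊗ₜ (1 : kostant C)) := by
    refine ⟨p ⊗ₜ 1, ?_, ?_⟩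
    · rw [toComplex_tmul]
      rfl
    · rw [specialize_tmul]
  have h1 := h0.mul h
  have h2 := Algebra.smul_def (coeffIncl ζ p) w
  have h3 := Algebra.smul_def (LaurentPolynomial.eval₂ χ a p) x
  rw [h2, h3]
  exact h1

end Specialization

/-! ### Elements whose divided powers specialize into a given non-unital subalgebra -/

section DivSpec

open LieAlgebra LieAlgebra.IsKilling

variable {g : Type*} [LieRing g] [LieAlgebra ℂ g] [FiniteDimensional ℂ g] [LieAlgebra.IsSimple ℂ g]
variable {H : LieSubalgebra ℂ g} [H.IsCartanSubalgebra]
variable {C : ChevalleyBasis H} {ζ : ℂ} {F : Type*} [Field F] (χ : coeffRing ζ →+* F) (a : Fˣ)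
variable (M : NonUnitalSubalgebra F (Hyper F (kostant C)))

/-- `w` specializes into `M`, or `n = 0` and `w = 1`. -/
def SpecIn (n : ℕ) (w : LoopEnv g) : Prop :=
  if n = 0 then w = 1 else ∃ x ∈ M, Spec C χ a w x

/-- The divided powers of `X` specialize to elements of `M`. -/
def DivSpec (X : LoopEnv g) : Prop := ∀ n, SpecIn χ a M n (divPow X n)

variable {χ a M}

theorem specIn_of_pos {n : ℕ} (hn : 0 < n) {w : LoopEnv g} :
    SpecIn χ a M n w ↔ ∃ x ∈ M, Spec C χ a w x := by
  rw [SpecIn, if_neg hn.ne']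

theorem SpecIn.mul {i j : ℕ} {w w' : LoopEnv g} (h : SpecIn χ a M i w) (h' : SpecIn χ a M j w') :
    SpecIn χ a M (i + j) (w * w') := by
  rcases Nat.eq_zero_or_pos i with rfl | hi
  · rw [SpecIn, if_pos rfl] at h
    rwa [h, one_mul, zero_add]
  rcases Nat.eq_zero_or_pos j with rfl | hj
  · rw [SpecIn, if_pos rfl] at h'
    rwa [h', mul_one, add_zero]
  rw [specIn_of_pos hi] at h
  rw [specIn_of_pos hj] at h'
  rw [specIn_of_pos (by omega)]
  obtain ⟨x, hx, h⟩ := h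
  obtain ⟨x', hx', h'⟩ := h'
  exact ⟨x * x', mul_mem hx hx', h.mul h'⟩

theorem SpecIn.zero {n : ℕ} (hn : 0 < n) : SpecIn χ a M n (0 : LoopEnv g) :=
  (specIn_of_pos hn).mpr ⟨0, zero_mem M, Spec.zero⟩

theorem SpecIn.sum_antidiagonal {n : ℕ} {f : ℕ × ℕ → LoopEnv g}
    (h : ∀ p : ℕ × ℕ, p.1 + p.2 = n → SpecIn χ a M n (f p)) :
    SpecIn χ a M n (∑ p ∈ antidiagonal n, f p) := by
  rcases Nat.eq_zero_or_pos n with rfl | hn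
  · have := h (0, 0) rfl
    simpa using this
  · simp only [specIn_of_pos hn] at h ⊢
    choose! x hx hs using h
    exact ⟨∑ p ∈ antidiagonal n, x p,
      sum_mem fun p hp => hx p (Finset.HasAntidiagonal.mem_antidiagonal.mp hp),
      Spec.sum _ fun p hp => hs p (Finset.HasAntidiagonal.mem_antidiagonal.mp hp)⟩

/-- The divided-power binomial formula has all coefficients 1. As M need not contain the unit, the
factors of degree zero are exactly 1 and are tracked by degree. -/
theorem DivSpec.add {X Y : LoopEnv g} (hX : DivSpec χ a M X) (hY : DivSpec χ a M Y)
    (h : Commute X Y) : DivSpec χ a M (X + Y) := by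
  intro n
  rw [divPow_add h]
  refine SpecIn.sum_antidiagonal fun p hp => ?_
  rw [← hp]
  exact (hX p.1).mul (hY p.2)

/-- Normalizing the commutator as -2W makes the divided powers of W occur with coefficient 1; no
denominators remain. -/
theorem DivSpec.add_of_central {X Y W : LoopEnv g} (hX : DivSpec χ a M X) (hY : DivSpec χ a M Y)
    (hW : DivSpec χ a M W) (h : X * Y - Y * X = (-2 : ℂ) • W) (hXW : Commute X W)
    (hYW : Commute Y W) : DivSpec χ a M (X + Y) := by
  intro n
  rw [divPow_add_of_central h hXW hYW]
  refine SpecIn.sum_antidiagonal fun p hp => ?_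
  rw [← hp]
  refine SpecIn.mul (SpecIn.sum_antidiagonal fun q hq => ?_) ?_
  · rw [← hq]
    exact (hX q.1).mul (hY q.2)
  -- Half of a positive even degree is still positive, so the factor lies in M; odd degrees
  -- contribute zero.
  · split_ifs with he
    · rcases Nat.eq_zero_or_pos p.2 with h0 | h0
      · rw [h0]
        simp [SpecIn]
      · rw [specIn_of_pos h0]
        have hpos : 0 < p.2 / 2 := by
          obtain ⟨k, hk⟩ := he
          omega
        exact (specIn_of_pos hpos).mp (hW _)
    · refine SpecIn.zero (Nat.pos_of_ne_zero fun h0 => he ?_)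
      rw [h0]
      exact Even.zero

theorem DivSpec.smul (p : (coeffRing ζ)[T;T⁻¹]) {X : LoopEnv g} (hX : DivSpec χ a M X) :
    DivSpec χ a M (coeffIncl ζ p • X) := by
  intro n
  rw [divPow_smul]
  rcases Nat.eq_zero_or_pos n with rfl | hn
  · simp [SpecIn]
  · obtain ⟨x, hx, h⟩ := (specIn_of_pos hn).mp (hX n)
    rw [← map_pow]
    exact (specIn_of_pos hn).mpr ⟨_, SMulMemClass.smul_mem _ hx, h.smul (p ^ n)⟩

theorem DivSpec.zero : DivSpec χ a M (0 : LoopEnv g) := by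
  intro n
  rcases Nat.eq_zero_or_pos n with rfl | hn
  · simp [SpecIn]
  · rw [divPow_zero_left hn]
    exact SpecIn.zero hn

theorem DivSpec.sum {J : Type*} (s : Finset J) {X : J → LoopEnv g}
    (hX : ∀ j ∈ s, DivSpec χ a M (X j)) (h : ∀ i ∈ s, ∀ j ∈ s, Commute (X i) (X j)) :
    DivSpec χ a M (∑ j ∈ s, X j) := by
  classical
  induction s using Finset.induction_on with
  | empty => exact DivSpec.zero
  | insert j s hj ih =>
    rw [Finset.sum_insert hj]
    refine (hX j (Finset.mem_insert_self j s)).add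
      (ih (fun i hi => hX i (Finset.mem_insert_of_mem hi)) fun i hi k hk =>
        h i (Finset.mem_insert_of_mem hi) k (Finset.mem_insert_of_mem hk)) ?_
    exact Commute.sum_right _ _ _ fun i hi =>
      h j (Finset.mem_insert_self j s) i (Finset.mem_insert_of_mem hi)

theorem divPow_constLoop (x : g) (k : ℕ) : divPow (constLoop g x) k =
    (1 : ℂ[T;T⁻¹]) ⊗ₜ[ℂ] divPow (UniversalEnvelopingAlgebra.ι ℂ x) k :=
  (map_divPow (Algebra.TensorProduct.includeRight :
    UniversalEnvelopingAlgebra ℂ g →ₐ[ℂ] LoopEnv g) _ k).symm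

theorem spec_divPow_rootVector (α : H.root) (k : ℕ) :
    Spec C χ a (divPow (constLoop g (C.x α)) k) (1 ⊗ₜ kostantGen C α k) := by
  rw [divPow_constLoop]
  exact Spec.coe (kostantGen C α k)

theorem divSpec_rootVector {α : H.root}
    (h : ∀ k, 0 < k → (1 : F) ⊗ₜ[ℤ] kostantGen C α k ∈ M) :
    DivSpec χ a M (constLoop g (C.x α)) := by
  intro n
  rcases Nat.eq_zero_or_pos n with rfl | hn
  · simp [SpecIn]
  · exact (specIn_of_pos hn).mpr ⟨_, h n hn, spec_divPow_rootVector α n⟩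

/-- If a multiple of a root vector by a scalar that is invertible in `F` has its divided powers
in `M`, then so does the root vector. -/
theorem kostantGen_mem_of_divSpec (b : (rootSystem H).Base) {m : ℕ} (hm : 0 < m) (hζ : ζ ^ m = 1)
    {α : H.root} {p : (coeffRing ζ)[T;T⁻¹]} (hp : LaurentPolynomial.eval₂ χ a p ≠ 0)
    (h : DivSpec χ a M (coeffIncl ζ p • constLoop g (C.x α))) {k : ℕ} (hk : 0 < k) :
    (1 : F) ⊗ₜ[ℤ] kostantGen C α k ∈ M := by
  obtain ⟨x, hx, hs⟩ := (specIn_of_pos hk).mp (h k)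
  rw [divPow_smul, ← map_pow] at hs
  have := hs.unique b hm hζ ((spec_divPow_rootVector α k).smul (p ^ k))
  rw [this, map_pow] at hx
  have h2 := SMulMemClass.smul_mem (LaurentPolynomial.eval₂ χ a p ^ k)⁻¹ hx
  rwa [smul_smul, inv_mul_cancel₀ (pow_ne_zero k hp), one_smul] at h2

end DivSpec

/-! ### Divided powers of the generators of the twisted loop algebra -/

theorem zpow_mem_coeffRing {ζ : ℂ} {m : ℕ} (hm : 0 < m) (hζ : ζ ^ m = 1) (n : ℤ) :
    ζ ^ n ∈ coeffRing ζ := by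
  have h1 : ζ ∈ coeffRing ζ := Algebra.subset_adjoin (Set.mem_insert _ _)
  have h2 : ζ⁻¹ = ζ ^ (m - 1) := by
    refine inv_eq_of_mul_eq_one_left ?_
    rw [← pow_succ, Nat.sub_add_cancel hm, hζ]
  cases n with
  | ofNat n =>
    rw [Int.ofNat_eq_natCast, zpow_natCast]
    exact pow_mem h1 n
  | negSucc n =>
    rw [zpow_negSucc, ← inv_pow, h2]
    exact pow_mem (pow_mem h1 _) _

theorem sqrt_two_mem_coeffRing (ζ : ℂ) : ((Real.sqrt 2 : ℝ) : ℂ) ∈ coeffRing ζ :=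
  Algebra.subset_adjoin (Set.mem_insert_of_mem _ rfl)

theorem intCast_mem_coeffRing (ζ : ℂ) (n : ℤ) : (n : ℂ) ∈ coeffRing ζ :=
  intCast_mem (coeffRing ζ) n

theorem sqrt_two_mul_self : ((Real.sqrt 2 : ℝ) : ℂ) * ((Real.sqrt 2 : ℝ) : ℂ) = 2 := by
  rw [← Complex.ofReal_mul, Real.mul_self_sqrt (by norm_num)]
  norm_num

theorem smul_commutator {A : Type*} [Ring A] [Algebra ℂ A] (c d : ℂ) (x y : A) :
    (c • x) * (d • y) - (d • y) * (c • x) = (c * d) • (x * y - y * x) := by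
  simp only [smul_mul_assoc, mul_smul_comm, smul_smul, smul_sub, mul_comm c d]

theorem coeffIncl_C {ζ : ℂ} (c : coeffRing ζ) :
    coeffIncl ζ (LaurentPolynomial.C c) = LaurentPolynomial.C (c : ℂ) := by
  exact AddMonoidAlgebra.mapRingHom_single _ _ _

theorem coeffIncl_T (ζ : ℂ) (r : ℤ) :
    coeffIncl ζ (LaurentPolynomial.T r) = LaurentPolynomial.T r := by
  exact (AddMonoidAlgebra.mapRingHom_single _ _ _).trans (by rw [map_one]; rfl)

section Twisted

open LieAlgebra LieAlgebra.IsKilling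

variable {g : Type*} [LieRing g] [LieAlgebra ℂ g] [FiniteDimensional ℂ g] [LieAlgebra.IsSimple ℂ g]
variable {H : LieSubalgebra ℂ g} [H.IsCartanSubalgebra]
variable {C : ChevalleyBasis H} {ζ : ℂ} {F : Type*} [Field F] {χ : coeffRing ζ →+* F} {a : Fˣ}

theorem C_smul_loopEnv (c : ℂ) (w : LoopEnv g) :
    (LaurentPolynomial.C c : ℂ[T;T⁻¹]) • w = c • w := by
  have h : (LaurentPolynomial.C c : ℂ[T;T⁻¹]) = c • (1 : ℂ[T;T⁻¹]) := by
    rw [Algebra.smul_def, mul_one]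
    rfl
  rw [h, smul_assoc, one_smul]

theorem Spec.coeff_smul (c : coeffRing ζ) {w : LoopEnv g} {x : Hyper F (kostant C)}
    (h : Spec C χ a w x) : Spec C χ a ((c : ℂ) • w) (χ c • x) := by
  have := h.smul (LaurentPolynomial.C c)
  rwa [coeffIncl_C, C_smul_loopEnv, LaurentPolynomial.eval₂_C] at this

theorem Spec.T_smul (r : ℤ) {w : LoopEnv g} {x : Hyper F (kostant C)}
    (h : Spec C χ a w x) :
    Spec C χ a ((LaurentPolynomial.T r : ℂ[T;T⁻¹]) • w) (((a ^ r : Fˣ) : F) • x) := by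
  have := h.smul (LaurentPolynomial.T r)
  rwa [coeffIncl_T, LaurentPolynomial.eval₂_T] at this

variable {M : NonUnitalSubalgebra F (Hyper F (kostant C))}

theorem DivSpec.coeff_smul {c : ℂ} (hc : c ∈ coeffRing ζ) {X : LoopEnv g}
    (hX : DivSpec χ a M X) : DivSpec χ a M (c • X) := by
  have := hX.smul (LaurentPolynomial.C ⟨c, hc⟩)
  rwa [coeffIncl_C, C_smul_loopEnv] at this

theorem DivSpec.T_smul (r : ℤ) {X : LoopEnv g}
    (hX : DivSpec χ a M X) : DivSpec χ a M ((LaurentPolynomial.T r : ℂ[T;T⁻¹]) • X) := by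
  have := hX.smul (LaurentPolynomial.T r)
  rwa [coeffIncl_T] at this

theorem kostantGen_mem_of_divSpec_smul (b : (rootSystem H).Base) {m : ℕ} (hm : 0 < m)
    (hζ : ζ ^ m = 1) {α : H.root} (c : coeffRing ζ) (hc : χ c ≠ 0)
    (h : DivSpec χ a M ((c : ℂ) • constLoop g (C.x α))) {k : ℕ} (hk : 0 < k) :
    (1 : F) ⊗ₜ[ℤ] kostantGen C α k ∈ M := by
  refine kostantGen_mem_of_divSpec b hm hζ (p := LaurentPolynomial.C c) (χ := χ) (a := a) ?_ ?_ hk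
  · rwa [LaurentPolynomial.eval₂_C]
  · rwa [coeffIncl_C, C_smul_loopEnv]

variable {b : (rootSystem H).Base} {D : DiagramAut C b}

theorem xTw_eq_of_perm_eq {α : H.root} (h : D.perm α = α) {ε : ℤ} (hε : C.x α ∈ D.piece ζ ε) :
    D.xTw ζ α ε = C.x α := by
  rw [DiagramAut.xTw, if_pos h, if_pos hε]

theorem xTw_eq_of_sumIsRoot {α : H.root} (h : SumIsRoot D α) (h2 : D.order = 2) (ε : ℤ) :
    D.xTw ζ α ε = ((Real.sqrt 2 : ℝ) : ℂ) • (C.x α + ζ ^ (-ε) • D.toLie (C.x α)) := by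
  rw [DiagramAut.xTw, if_neg h.perm_ne, if_pos (show ∃ β, _ from h), h2]
  simp [Finset.sum_range_succ]

theorem xTw_eq_of_not_sumIsRoot {α : H.root} (hα : D.perm α ≠ α) (h : ¬ SumIsRoot D α) (ε : ℤ) :
    D.xTw ζ α ε = ∑ j ∈ Finset.range D.order, ζ ^ (-((j : ℤ) * ε)) • (D.toLie)^[j] (C.x α) := by
  rw [DiagramAut.xTw, if_neg hα, if_neg (show ¬ ∃ β, _ from h), one_smul]

theorem divSpec_toLie_iterate {α : H.root} {j : ℕ}
    (h : ∀ k, 0 < k → (1 : F) ⊗ₜ[ℤ] kostantGen C (D.perm^[j] α) k ∈ M) :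
    DivSpec χ a M (constLoop g (D.toLie^[j] (C.x α))) := by
  obtain ⟨s, hs⟩ := exists_toLie_iterate_rootVector D α j
  rw [hs, map_smul]
  exact (divSpec_rootVector h).coeff_smul (intCast_mem_coeffRing ζ _)

/-- The only root vectors involved belong to the orbit of α, of the same height, and possibly to β =
α + σ(α), of twice that height. The hypothesis is phrased by heights so that it applies when M is
the whole algebra and when M annihilates a highest-weight vector. -/
theorem divSpec_xTw (hm : D.order = 1 ∨ D.order = 2 ∨ D.order = 3) (hζ : ζ ^ D.order = 1)
    (α : H.root) (ε : ℤ)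
    (h : ∀ β : H.root, (∃ n : ℕ, 0 < n ∧ b.height β = n * b.height α) →
      ∀ k, 0 < k → (1 : F) ⊗ₜ[ℤ] kostantGen C β k ∈ M) :
    DivSpec χ a M (constLoop g (D.xTw ζ α ε)) := by
  have h0 : 0 < D.order := by omega
  have hz := zpow_mem_coeffRing h0 hζ
  have hiter : ∀ j, DivSpec χ a M (constLoop g (D.toLie^[j] (C.x α))) := fun j =>
    divSpec_toLie_iterate (h _ ⟨1, one_pos, by rw [height_perm_iterate, Nat.cast_one, one_mul]⟩)
  by_cases hα : D.perm α = α
  · rw [DiagramAut.xTw, if_pos hα]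
    split_ifs
    · exact hiter 0
    · rw [map_zero]
      exact DivSpec.zero
  by_cases hs : SumIsRoot D α
  · obtain ⟨h2, β, s, -, hβ, hxy, hx, hy⟩ := hs.heisenberg hm
    rw [xTw_eq_of_sumIsRoot hs h2, map_smul, map_add, smul_add, map_smul]
    have hβ' : DivSpec χ a M (constLoop g (C.x β)) :=
      divSpec_rootVector (h β ⟨2, two_pos, hβ⟩)
    -- The commutator of the two summands is (√2)² ζ^{-ε} s x_β, which is -2W for an integral
    -- multiple W of x_β. This is the purpose of the factor √2.
    refine DivSpec.add_of_central (W := (-ζ ^ (-ε) * ((s : ℤ) : ℂ)) • constLoop g (C.x β))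
      ((hiter 0).coeff_smul (sqrt_two_mem_coeffRing ζ))
      (((hiter 1).coeff_smul (hz (-ε))).coeff_smul (sqrt_two_mem_coeffRing ζ))
      (hβ'.coeff_smul (mul_mem (neg_mem (hz _)) (intCast_mem_coeffRing ζ _))) ?_ ?_ ?_
    · have h3 := constLoop_lie (C.x α) (D.toLie (C.x α))
      rw [hxy, map_smul] at h3
      rw [smul_smul]
      refine (smul_commutator _ _ _ _).trans ?_
      rw [← h3, smul_smul, smul_smul, ← mul_assoc, sqrt_two_mul_self]
      congr 1
      ring
    · exact ((constLoop_commute hx).smul_right _).smul_left _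
    · exact (((constLoop_commute hy).smul_right _).smul_left _).smul_left _
  · rw [xTw_eq_of_not_sumIsRoot hα hs, map_sum]
    refine DivSpec.sum _ (fun j _ => ?_) fun i hi j hj => ?_
    · rw [map_smul]
      exact (hiter j).coeff_smul (hz _)
    · rw [map_smul, map_smul]
      exact ((constLoop_commute (lie_toLie_iterate_eq_zero hm hs (Finset.mem_range.mp hi)
        (Finset.mem_range.mp hj))).smul_right _).smul_left _

end Twisted

/-! ### The twisted evaluation map -/

section Evaluation

open LieAlgebra LieAlgebra.IsKilling

variable {g : Type*} [LieRing g] [LieAlgebra ℂ g] [FiniteDimensional ℂ g] [LieAlgebra.IsSimple ℂ g]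
variable {H : LieSubalgebra ℂ g} [H.IsCartanSubalgebra]
variable {C : ChevalleyBasis H} {ζ : ℂ} {F : Type*} [Field F] {χ : coeffRing ζ →+* F} {a : Fˣ}
variable {b : (rootSystem H).Base} {D : DiagramAut C b}

theorem specIn_loopElt {M : NonUnitalSubalgebra F (Hyper F (kostant C))}
    {α : H.root} {r : ℤ} (h : DivSpec χ a M (constLoop g (D.xTw ζ α (-r)))) (k : ℕ) :
    SpecIn χ a M k (evFormal g (divPow (loopElt (D.xTw ζ α (-r)) r) k)) := by
  rw [map_divPow, evFormal_loopElt]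
  exact h.T_smul r k

variable (χ a) in
theorem exists_spec_evFormal (hm : D.order = 1 ∨ D.order = 2 ∨ D.order = 3)
    (hζ : ζ ^ D.order = 1) (O : D.OrbitReps) {y : UniversalEnvelopingAlgebra ℂ (Loop g)}
    (hy : y ∈ twistedForm ζ O) : ∃ x, Spec C χ a (evFormal g y) x := by
  induction hy using Algebra.adjoin_induction with
  | mem y hy =>
    obtain ⟨α, r, k, -, rfl⟩ := hy
    have h := specIn_loopElt (divSpec_xTw (χ := χ) (a := a) 
      (M := (⊤ : Subalgebra F (Hyper F (kostant C))).toNonUnitalSubalgebra) hm hζ α (-r)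
      fun β _ k _ => (Algebra.mem_top : (1 : F) ⊗ₜ[ℤ] kostantGen C β k ∈
        (⊤ : Subalgebra F (Hyper F (kostant C))))) k
    rcases Nat.eq_zero_or_pos k with rfl | hk
    · rw [divPow_zero, map_one]
      exact ⟨1, Spec.one⟩
    · obtain ⟨x, -, hx⟩ := (specIn_of_pos hk).mp h
      exact ⟨x, hx⟩
  | algebraMap n =>
    refine ⟨algebraMap ℤ _ n, algebraMap ℤ _ n, ?_, ?_⟩
    · rw [AlgHom.commutes, eq_intCast, eq_intCast, map_intCast]
    · rw [AlgHom.commutes]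
  | add x y _ _ hx hy =>
    obtain ⟨u, hu⟩ := hx
    obtain ⟨v, hv⟩ := hy
    exact ⟨u + v, by rw [map_add]; exact hu.add hv⟩
  | mul x y _ _ hx hy =>
    obtain ⟨u, hu⟩ := hx
    obtain ⟨v, hv⟩ := hy
    exact ⟨u * v, by rw [map_mul]; exact hu.mul hv⟩

/-- The specializations are chosen one element at a time; their uniqueness makes the choice a ring
homomorphism, which then extends to F ⊗ U_ℤ. -/
theorem exists_twistedEvaluation (hm : D.order = 1 ∨ D.order = 2 ∨ D.order = 3)
    (hζ : ζ ^ D.order = 1) (O : D.OrbitReps) :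
    ∃ φ : Hyper F (twistedForm ζ O) →ₐ[F] Hyper F (kostant C), IsTwistedEvaluation O χ a φ := by
  have h0 : 0 < D.order := by omega
  choose f hf using fun y : twistedForm ζ O => exists_spec_evFormal χ a hm hζ O y.2
  have uniq : ∀ {w : LoopEnv g} {x y : Hyper F (kostant C)}, Spec C χ a w x → Spec C χ a w y →
    x = y := fun h h' => Spec.unique b h0 hζ h h'
  let φ : twistedForm ζ O →+* Hyper F (kostant C) :=
    { toFun := f
      map_one' := uniq (hf 1) (by rw [OneMemClass.coe_one, map_one]; exact Spec.one)
      map_zero' := uniq (hf 0) (by rw [ZeroMemClass.coe_zero, map_zero]; exact Spec.zero)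
      map_add' := fun x y => uniq (hf (x + y))
        (by rw [AddMemClass.coe_add, map_add]; exact (hf x).add (hf y))
      map_mul' := fun x y => uniq (hf (x * y))
        (by rw [MulMemClass.coe_mul, map_mul]; exact (hf x).mul (hf y)) }
  refine ⟨Algebra.TensorProduct.lift (Algebra.ofId F _) φ.toIntAlgHom
    fun c y => Algebra.commute_algebraMap_left c _, fun y => ?_⟩
  have h : Algebra.TensorProduct.lift (Algebra.ofId F (Hyper F (kostant C))) φ.toIntAlgHom
      (fun c y => Algebra.commute_algebraMap_left c _) (1 ⊗ₜ y) = f y :=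
    (Algebra.TensorProduct.lift_tmul _ _ _ _ _).trans (by rw [map_one, one_mul]; rfl)
  rw [h]
  exact hf y

theorem twistedEvaluation_unique (b : (rootSystem H).Base) {D : DiagramAut C b} (h0 : 0 < D.order) (hζ : ζ ^ D.order = 1)
    (O : D.OrbitReps) {φ ψ : Hyper F (twistedForm ζ O) →ₐ[F] Hyper F (kostant C)}
    (hφ : IsTwistedEvaluation O χ a φ) (hψ : IsTwistedEvaluation O χ a ψ) : ψ = φ := by
  refine Algebra.TensorProduct.ext (by ext) ?_
  ext y
  exact Spec.unique b h0 hζ (hψ y) (hφ y)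

theorem add_commutator_sub {A : Type*} [Ring A] [Algebra ℂ A] (x y : A) :
    (x + y) * (x - y) - (x - y) * (x + y) = (-2 : ℂ) • (x * y - y * x) := by
  rw [neg_smul, two_smul]
  noncomm_ring

/-- Orthogonality of the characters of ℤ/m. -/
theorem sum_zpow_primitiveRoot {m : ℕ} (hζ : IsPrimitiveRoot ζ m) {j l : ℕ}
    (hj : j < m) (hl : l < m) :
    ∑ r ∈ Finset.range m, ζ ^ (-((l : ℤ) * r)) * ζ ^ ((j : ℤ) * r) = if j = l then (m : ℂ) else 0 := by
  have h0 : ζ ≠ 0 := hζ.ne_zero (by omega)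
  have h1 : ∀ r : ℕ, ζ ^ (-((l : ℤ) * r)) * ζ ^ ((j : ℤ) * r) = (ζ ^ ((j : ℤ) - l)) ^ r := by
    intro r
    rw [← zpow_add₀ h0, ← zpow_natCast, ← zpow_mul]
    congr 1
    ring
  simp only [h1]
  split_ifs with h
  · simp [h]
  · have hne : ζ ^ ((j : ℤ) - l) ≠ 1 := by
      rw [Ne, hζ.zpow_eq_one_iff_dvd]
      intro hd
      have := Int.eq_zero_of_abs_lt_dvd hd (by rw [abs_lt]; omega)
      omega
    rw [geom_sum_eq hne, ← zpow_natCast, ← zpow_mul, mul_comm, zpow_mul, zpow_natCast, hζ.pow_eq_one,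
      one_zpow, sub_self, zero_div]

theorem xTw_lie_xTw (hm : D.order = 1 ∨ D.order = 2 ∨ D.order = 3) {α : H.root}
    (hα : D.perm α ≠ α) (hs : ¬ SumIsRoot D α) (ε δ : ℤ) : ⁅D.xTw ζ α ε, D.xTw ζ α δ⁆ = 0 := by
  rw [xTw_eq_of_not_sumIsRoot hα hs, xTw_eq_of_not_sumIsRoot hα hs, sum_lie_sum]
  refine Finset.sum_eq_zero fun i hi => Finset.sum_eq_zero fun j hj => ?_
  rw [smul_lie, lie_smul, lie_toLie_iterate_eq_zero hm hs (Finset.mem_range.mp hi)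
    (Finset.mem_range.mp hj), smul_zero, smul_zero]

/-- Fourier inversion over ℤ/m. The factor m on the right is what must be invertible in F for
surjectivity. -/
theorem sum_xTw (hζ : IsPrimitiveRoot ζ D.order) {α : H.root}
    (hα : D.perm α ≠ α) (hs : ¬ SumIsRoot D α) {l : ℕ} (hl : l < D.order) :
    ∑ r ∈ Finset.range D.order, ζ ^ (-((l : ℤ) * r)) • D.xTw ζ α (-r) =
      (D.order : ℂ) • D.toLie^[l] (C.x α) := by
  have h1 : ∀ r : ℕ, ζ ^ (-((l : ℤ) * r)) • D.xTw ζ α (-r) =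
      ∑ j ∈ Finset.range D.order, (ζ ^ (-((l : ℤ) * r)) * ζ ^ ((j : ℤ) * r)) •
        D.toLie^[j] (C.x α) := by
    intro r
    rw [xTw_eq_of_not_sumIsRoot hα hs, Finset.smul_sum]
    refine Finset.sum_congr rfl fun j _ => ?_
    rw [smul_smul, mul_neg, neg_neg]
  simp only [h1]
  rw [Finset.sum_comm]
  simp only [← Finset.sum_smul]
  rw [Finset.sum_eq_single l]
  · rw [sum_zpow_primitiveRoot hζ hl hl, if_pos rfl]
  · intro j hj hjl
    rw [sum_zpow_primitiveRoot hζ (Finset.mem_range.mp hj) hl, if_neg hjl, zero_smul]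
  · intro h
    exact absurd (Finset.mem_range.mpr hl) h

/-- It suffices to find a multiple of each root vector, by a scalar nonzero in F, whose divided
powers evaluate into the range. Fixed roots come first, because the Heisenberg case needs x_β with β
fixed. -/
theorem kostantGen_mem_range (hm : D.order = 1 ∨ D.order = 2 ∨ D.order = 3)
    (hζ : IsPrimitiveRoot ζ D.order) {O : D.OrbitReps}
    {φ : Hyper F (twistedForm ζ O) →ₐ[F] Hyper F (kostant C)} (hφ : IsTwistedEvaluation O χ a φ)
    (hF : (D.order : F) ≠ 0) (γ : H.root) (k : ℕ) (hk : 0 < k) :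
    (1 : F) ⊗ₜ[ℤ] kostantGen C γ k ∈ φ.range := by
  have h0 : 0 < D.order := by omega
  have hζ1 := hζ.pow_eq_one
  let M : NonUnitalSubalgebra F (Hyper F (kostant C)) := φ.range.toNonUnitalSubalgebra
  have hM : ∀ α : H.root, (α ∈ O.carrier ∨ negRoot α ∈ O.carrier) → ∀ r : ℤ,
      DivSpec χ a M (constLoop g (D.xTw ζ α (-r))) := by
    intro α hα r
    have h1 : DivSpec χ a M (evFormal g (loopElt (D.xTw ζ α (-r)) r)) := by
      intro n
      rcases Nat.eq_zero_or_pos n with rfl | hn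
      · simp [SpecIn]
      · refine (specIn_of_pos hn).mpr
          ⟨φ (1 ⊗ₜ ⟨divPow (loopElt (D.xTw ζ α (-r)) r) n,
            Algebra.subset_adjoin ⟨α, r, n, hα, rfl⟩⟩), ⟨_, rfl⟩, ?_⟩
        rw [← map_divPow]
        exact hφ ⟨divPow (loopElt (D.xTw ζ α (-r)) r) n, _⟩
    -- The factor t^r is a unit and can be divided out, so the different x_{α,-r} can be combined.
    have h2 := h1.T_smul (-r)
    rwa [evFormal_loopElt, smul_smul, ← LaurentPolynomial.T_add, neg_add_cancel,
      LaurentPolynomial.T_zero, one_smul] at h2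
  have hfix : ∀ α : H.root, D.perm α = α → ∀ k, 0 < k → (1 : F) ⊗ₜ[ℤ] kostantGen C α k ∈ M := by
    intro α hα k hk
    obtain ⟨α', l, hα', -, hl⟩ := exists_orbitRep O h0.ne' α
    have : α' = α := (perm_injective D).iterate l (hl.trans (Function.iterate_fixed hα l).symm)
    subst this
    obtain ⟨r, hr⟩ := exists_rootVector_mem_piece D hζ h0.ne' hα
    have h1 := hM α' hα' r
    rw [xTw_eq_of_perm_eq hα hr] at h1
    refine kostantGen_mem_of_divSpec_smul b h0 hζ1 1 ?_ (a := a) (χ := χ) ?_ hk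
    · rw [map_one]
      exact one_ne_zero
    · rwa [OneMemClass.coe_one, one_smul]
  obtain ⟨α, l, hα, hl, rfl⟩ := exists_orbitRep O h0.ne' γ
  suffices h : ∃ c : coeffRing ζ, χ c ≠ 0 ∧
      DivSpec χ a M ((c : ℂ) • constLoop g (D.toLie^[l] (C.x α))) by
    obtain ⟨c, hc, h⟩ := h
    obtain ⟨s, hs⟩ := exists_toLie_iterate_rootVector D α l
    rw [hs, map_smul, smul_smul] at h
    refine kostantGen_mem_of_divSpec_smul b h0 hζ1 (c * (s : ℤ)) ?_ (a := a) (χ := χ) (M := M) ?_ hk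
    · rw [map_mul, map_intCast]
      refine mul_ne_zero hc ?_
      rcases Int.units_eq_one_or s with rfl | rfl <;> simp
    · simpa using h
  by_cases hp : D.perm α = α
  · refine ⟨1, by rw [map_one]; exact one_ne_zero, ?_⟩
    rw [OneMemClass.coe_one, one_smul]
    exact divSpec_toLie_iterate (hfix _ (by
      rw [Function.iterate_fixed hp l, hp]))
  by_cases hs : SumIsRoot D α
  · obtain ⟨h2, β, s, hβ, -, hxy, hx, hy⟩ := hs.heisenberg hm
    have hζ2 : ζ = -1 := IsPrimitiveRoot.eq_neg_one_of_two_right (by rwa [h2] at hζ)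
    set X := constLoop g (C.x α) with hX
    set Y := constLoop g (D.toLie (C.x α)) with hY
    set W := constLoop g (C.x β) with hW
    have hXW : Commute X W := constLoop_commute hx
    have hYW : Commute Y W := constLoop_commute hy
    have hXY : X * Y - Y * X = ((s : ℤ) : ℂ) • W := by
      rw [← constLoop_lie, hxy, map_smul]
    have hWs : DivSpec χ a M W := divSpec_rootVector (hfix β hβ)
    have hP : DivSpec χ a M (((Real.sqrt 2 : ℝ) : ℂ) • (X + Y)) := by
      have := hM α hα 0
      rwa [xTw_eq_of_sumIsRoot hs h2, neg_neg, zpow_zero, one_smul, map_smul, map_add] at this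
    have hQ : DivSpec χ a M (((Real.sqrt 2 : ℝ) : ℂ) • (X - Y)) := by
      have := hM α hα 1
      have hζY : ζ • D.toLie (C.x α) = - D.toLie (C.x α) := by rw [hζ2, neg_one_smul]
      rwa [xTw_eq_of_sumIsRoot hs h2, neg_neg, zpow_one, hζY, ← sub_eq_add_neg,
        map_smul, map_sub] at this
    -- The commutator of √2(X+Y) and t√2(X-Y) is -4ts W, which is again -2 times an integral
    -- multiple of W.
    have hPQ : ∀ t : ℤ, (((Real.sqrt 2 : ℝ) : ℂ) • (X + Y)) *
        ((t : ℂ) • (((Real.sqrt 2 : ℝ) : ℂ) • (X - Y))) - ((t : ℂ) • (((Real.sqrt 2 : ℝ) : ℂ) • (X - Y))) *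
        (((Real.sqrt 2 : ℝ) : ℂ) • (X + Y)) = (-2 : ℂ) • (((2 * t * s : ℤ) : ℂ) • W) := by
      intro t
      rw [smul_smul]
      refine (smul_commutator _ _ _ _).trans ?_
      have h3 : (X + Y) * (X - Y) - (X - Y) * (X + Y) = (-2 : ℂ) • (X * Y - Y * X) :=
        add_commutator_sub _ _
      rw [h3, hXY, smul_smul, smul_smul, smul_smul, mul_left_comm _ (t : ℂ), sqrt_two_mul_self]
      congr 1
      push_cast
      ring
    have hcomm : ∀ t : ℤ, DivSpec χ a M ((((Real.sqrt 2 : ℝ) : ℂ) • (X + Y)) +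
        ((t : ℂ) • (((Real.sqrt 2 : ℝ) : ℂ) • (X - Y)))) := fun t =>
      DivSpec.add_of_central hP (hQ.coeff_smul (intCast_mem_coeffRing ζ t))
        (hWs.coeff_smul (intCast_mem_coeffRing ζ (2 * t * s))) (hPQ t)
        (((hXW.add_left hYW).smul_left _).smul_right _)
        ((((hXW.sub_left hYW).smul_left _).smul_left _).smul_right _)
    -- The choices t = 1 and t = -1 give 2√2 X and 2√2 Y. The image of 2√2 in F is nonzero since 2 ≠
    -- 0 there and (√2)² = 2.
    refine ⟨2 * ⟨_, sqrt_two_mem_coeffRing ζ⟩, ?_, ?_⟩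
    · rw [map_mul, map_ofNat]
      have h2F : (2 : F) ≠ 0 := by
        rw [h2] at hF
        exact_mod_cast hF
      refine mul_ne_zero h2F fun h => h2F ?_
      have h3 : (⟨_, sqrt_two_mem_coeffRing ζ⟩ * ⟨_, sqrt_two_mem_coeffRing ζ⟩ : coeffRing ζ) = 2 :=
        Subtype.ext sqrt_two_mul_self
      rw [← map_ofNat χ 2, ← h3, map_mul, h, zero_mul]
    · have hl' : l = 0 ∨ l = 1 := by omega
      rcases hl' with rfl | rfl
      · convert hcomm 1 using 1
        rw [Int.cast_one, one_smul, ← smul_add, add_add_sub_cancel, ← two_smul ℂ, smul_smul, mul_comm]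
        rfl
      · convert hcomm (-1) using 1
        have h3 : (((-1 : ℤ) : ℂ)) • (((Real.sqrt 2 : ℝ) : ℂ) • (X - Y)) =
            ((Real.sqrt 2 : ℝ) : ℂ) • (Y - X) := by
          rw [smul_comm, Int.cast_neg, Int.cast_one]
          exact congrArg _ ((neg_one_smul ℂ _).trans (neg_sub X Y))
        have h4 : X + Y + (Y - X) = Y + Y := by abel
        rw [h3, ← smul_add, h4, ← two_smul ℂ, smul_smul, mul_comm]
        rfl
  · refine ⟨(D.order : ℕ), by rwa [map_natCast], ?_⟩
    have h1 : (((D.order : ℕ) : coeffRing ζ) : ℂ) = (D.order : ℂ) := by simp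
    rw [h1, ← map_smul, ← sum_xTw hζ hp hs hl, map_sum]
    refine DivSpec.sum _ (fun r _ => ?_) fun r _ r' _ => ?_
    · rw [map_smul]
      exact (hM α hα r).coeff_smul (zpow_mem_coeffRing h0 hζ1 _)
    · rw [map_smul, map_smul]
      exact ((constLoop_commute (xTw_lie_xTw hm hp hs _ _)).smul_right _).smul_left _

theorem twistedEvaluation_surjective (hm : D.order = 1 ∨ D.order = 2 ∨ D.order = 3)
    (hζ : IsPrimitiveRoot ζ D.order) {O : D.OrbitReps}
    {φ : Hyper F (twistedForm ζ O) →ₐ[F] Hyper F (kostant C)} (hφ : IsTwistedEvaluation O χ a φ)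
    (hF : (D.order : F) ≠ 0) : Function.Surjective φ := by
  have key : ∀ y (hy : y ∈ kostant C), (1 : F) ⊗ₜ[ℤ] (⟨y, hy⟩ : kostant C) ∈ φ.range := by
    intro y hy
    induction hy using Algebra.adjoin_induction with
    | mem y hy =>
      obtain ⟨γ, k, rfl⟩ := hy
      rcases Nat.eq_zero_or_pos k with rfl | hk
      · convert one_mem φ.range using 1
        rw [Algebra.TensorProduct.one_def]
        congr 1
        exact Subtype.ext (divPow_zero _)
      · exact kostantGen_mem_range hm hζ hφ hF γ k hk
    | algebraMap n =>
      convert intCast_mem φ.range n using 1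
      have h1 : (n : Hyper F (kostant C)) = n • (1 : Hyper F (kostant C)) := (zsmul_one n).symm
      rw [h1, Algebra.TensorProduct.one_def, ← TensorProduct.tmul_smul]
      congr 1
      exact Subtype.ext (by simp)
    | add x y hx hy h h' =>
      have := add_mem h h'
      rwa [← TensorProduct.tmul_add] at this
    | mul x y hx hy h h' =>
      have := mul_mem h h'
      rwa [Algebra.TensorProduct.tmul_mul_tmul, one_mul] at this
  intro x
  change x ∈ φ.range
  induction x using TensorProduct.induction_on with
  | zero => exact zero_mem _
  | tmul c y =>
    have := Subalgebra.smul_mem _ (key y y.2) c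
    rwa [TensorProduct.smul_tmul', smul_eq_mul, mul_one] at this
  | add x y hx hy => exact add_mem hx hy

end Evaluation

/-! ### Drinfeld polynomials -/

section Polynomials

open Polynomial

variable {F : Type*} [Field F]

theorem coeff_one_sub_C_mul_X_pow (c : F) (n k : ℕ) :
    ((1 - C c * X) ^ n).coeff k = (-c) ^ k * (n.choose k : F) := by
  have h : (1 - C c * X) ^ n = ((1 + X) ^ n).comp (C (-c) * X) := by
    simp [sub_eq_add_neg]
  rw [h, comp_C_mul_X_coeff, coeff_one_add_X_pow, mul_comm]

theorem leadingCoeff_one_sub_C_mul_X {c : F} (hc : c ≠ 0) :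
    (1 - C c * X).leadingCoeff = -c := by
  have h : (1 - C c * X : F[X]) = C (-c) * X + C 1 := by simp; ring
  rw [h, leadingCoeff_linear (neg_ne_zero.mpr hc)]

theorem natDegree_one_sub_C_mul_X {c : F} (hc : c ≠ 0) : (1 - C c * X).natDegree = 1 := by
  have h : (1 - C c * X : F[X]) = C (-c) * X + C 1 := by simp; ring
  rw [h, natDegree_linear (neg_ne_zero.mpr hc)]

theorem natDegree_one_sub_C_mul_X_pow {c : F} (hc : c ≠ 0) (n : ℕ) :
    ((1 - C c * X) ^ n).natDegree = n := by
  rw [natDegree_pow, natDegree_one_sub_C_mul_X hc, mul_one]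

theorem minusPoly_mul (p q : F[X]) : minusPoly (p * q) = minusPoly p * minusPoly q := by
  rw [minusPoly, minusPoly, minusPoly, leadingCoeff_mul, mul_inv, C_mul, reverse_mul_of_domain]
  ring

theorem minusPoly_one_sub_C_mul_X {c : F} (hc : c ≠ 0) :
    minusPoly (1 - C c * X) = 1 - C c⁻¹ * X := by
  have h : (1 - C c * X : F[X]).reverse = X - C c := by
    ext k
    rw [coeff_reverse, natDegree_one_sub_C_mul_X hc]
    rcases k with _ | _ | k
    · simp [coeff_one]
    · simp [coeff_one]
    · rw [revAt_eq_self_of_lt (by omega)]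
      simp [coeff_one, coeff_X]
  rw [minusPoly, h, leadingCoeff_one_sub_C_mul_X hc, mul_sub, ← C_mul, inv_neg, neg_mul,
    inv_mul_cancel₀ hc]
  simp only [C_neg, C_1]
  ring

theorem minusPoly_one_sub_C_mul_X_pow {c : F} (hc : c ≠ 0) (n : ℕ) :
    minusPoly ((1 - C c * X) ^ n) = (1 - C c⁻¹ * X) ^ n := by
  induction n with
  | zero =>
    have h : (1 : Polynomial F).reverse = 1 := Polynomial.reverse_C 1
    simp [minusPoly, h]
  | succ n ih => rw [pow_succ, minusPoly_mul, ih, minusPoly_one_sub_C_mul_X hc, pow_succ]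

end Polynomials

/-! ### The action on a highest-weight vector -/

universe u

open scoped IsMulCommutative in
-- The exponential identities are proved over commutative algebras; pairwise commuting elements are
-- handled by working in the commutative subalgebra they generate.
theorem exists_commRing_algHom {A : Type u} [Ring A] [Algebra ℂ A] (s : Set A)
    (hs : ∀ x ∈ s, ∀ y ∈ s, x * y = y * x) :
    ∃ (B : Type u) (_ : CommRing B) (_ : Algebra ℂ B) (φ : B →ₐ[ℂ] A), ∀ x ∈ s, ∃ y, φ y = x := by
  have := Algebra.isMulCommutative_adjoin ℂ hs
  exact ⟨Algebra.adjoin ℂ s, inferInstance, inferInstance, (Algebra.adjoin ℂ s).val,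
    fun x hx => ⟨⟨x, Algebra.subset_adjoin hx⟩, rfl⟩⟩

section Acts

open LieAlgebra LieAlgebra.IsKilling

variable {g : Type u} [LieRing g] [LieAlgebra ℂ g] [FiniteDimensional ℂ g] [LieAlgebra.IsSimple ℂ g]
variable {H : LieSubalgebra ℂ g} [H.IsCartanSubalgebra]
variable {C : ChevalleyBasis H} {ζ : ℂ} {F : Type*} [Field F] (χ : coeffRing ζ →+* F) (a : Fˣ)
variable {V : Type*} [AddCommGroup V] [Module F V]
  (ρ : Hyper F (kostant C) →ₐ[F] Module.End F V) (v : V)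

/-- The specialization of `w` exists and acts on `v` by the scalar `c`. -/
def Acts (w : LoopEnv g) (c : F) : Prop := ∃ x, Spec C χ a w x ∧ ρ x v = c • v

variable {χ a ρ v}

theorem Acts.add {w w' : LoopEnv g} {c c' : F} (h : Acts χ a ρ v w c) (h' : Acts χ a ρ v w' c') :
    Acts χ a ρ v (w + w') (c + c') := by
  obtain ⟨x, hx, hc⟩ := h
  obtain ⟨x', hx', hc'⟩ := h'
  exact ⟨x + x', hx.add hx', by rw [map_add, LinearMap.add_apply, hc, hc', add_smul]⟩

theorem Acts.mul {w w' : LoopEnv g} {c c' : F} (h : Acts χ a ρ v w c) (h' : Acts χ a ρ v w' c') :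
    Acts χ a ρ v (w * w') (c * c') := by
  obtain ⟨x, hx, hc⟩ := h
  obtain ⟨x', hx', hc'⟩ := h'
  exact ⟨x * x', hx.mul hx', by
    rw [map_mul, Module.End.mul_apply, hc', map_smul, hc, smul_smul, mul_comm]⟩

theorem Acts.zero : Acts χ a ρ v 0 0 := ⟨0, Spec.zero, by simp⟩

theorem Acts.one : Acts χ a ρ v 1 1 := ⟨1, Spec.one, by simp⟩

theorem Acts.pow {w : LoopEnv g} {c : F} (h : Acts χ a ρ v w c) (n : ℕ) :
    Acts χ a ρ v (w ^ n) (c ^ n) := by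
  induction n with
  | zero => simpa using Acts.one
  | succ n ih => rw [pow_succ, pow_succ]; exact ih.mul h

theorem Acts.sum {J : Type*} (s : Finset J) {w : J → LoopEnv g} {c : J → F}
    (h : ∀ j ∈ s, Acts χ a ρ v (w j) (c j)) : Acts χ a ρ v (∑ j ∈ s, w j) (∑ j ∈ s, c j) := by
  classical
  induction s using Finset.induction_on with
  | empty => exact Acts.zero
  | insert j s hj ih =>
    rw [Finset.sum_insert hj, Finset.sum_insert hj]
    exact (h j (Finset.mem_insert_self j s)).add
      (ih fun i hi => h i (Finset.mem_insert_of_mem hi))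

theorem Acts.coeff_smul (d : coeffRing ζ) {w : LoopEnv g} {c : F} (h : Acts χ a ρ v w c) :
    Acts χ a ρ v ((d : ℂ) • w) (χ d * c) := by
  obtain ⟨x, hx, hc⟩ := h
  exact ⟨_, hx.coeff_smul d, by rw [map_smul, LinearMap.smul_apply, hc, smul_smul]⟩

theorem Acts.T_smul (r : ℤ) {w : LoopEnv g} {c : F} (h : Acts χ a ρ v w c) :
    Acts χ a ρ v ((LaurentPolynomial.T r : ℂ[T;T⁻¹]) • w) (((a ^ r : Fˣ) : F) * c) := by
  obtain ⟨x, hx, hc⟩ := h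
  exact ⟨_, hx.T_smul r, by rw [map_smul, LinearMap.smul_apply, hc, smul_smul]⟩

theorem Acts.neg {w : LoopEnv g} {c : F} (h : Acts χ a ρ v w c) :
    Acts χ a ρ v (-w) (-c) := by
  have := h.coeff_smul (-1)
  rw [map_neg, map_one, neg_one_mul] at this
  have h1 : ((-1 : coeffRing ζ) : ℂ) • w = -w := by
    rw [NegMemClass.coe_neg, OneMemClass.coe_one]
    exact neg_one_smul ℂ w
  rwa [h1] at this

/-- The elements x_α, x_{-α}, h_α form an `sl₂`-triple whose root vectors have divided powers in
U_ℤ(g), and the binomial is a polynomial in h_α. -/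
theorem binom_ι_coroot_mem_kostantCartan (C : ChevalleyBasis H) (α : H.root) (k : ℕ) :
    binom (UniversalEnvelopingAlgebra.ι ℂ (((rootSystem H).coroot α : H) : g)) k ∈
      kostantCartan C := by
  refine ⟨?_, ?_⟩
  · have two : ∀ x : UniversalEnvelopingAlgebra ℂ g, 2 * x = (2 : ℂ) • x := fun x => by
      rw [two_mul, two_smul]
    refine binom_mem_of_divPow_mem (e := UniversalEnvelopingAlgebra.ι ℂ (C.x α))
      (f := UniversalEnvelopingAlgebra.ι ℂ (C.x (negRoot α))) ?_ ?_ ?_ _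
      (fun k => (kostantGen C _ k).2) (fun k => (kostantGen C _ k).2) k
    · rw [← C.lie_neg α, LieHom.map_lie, LieRing.of_associative_ring_bracket]
      abel
    · have h := congrArg (UniversalEnvelopingAlgebra.ι ℂ)
        (lie_rootVector_coroot C (negRoot α) ((rootSystem H).coroot α))
      rw [LieHom.map_lie, LieRing.of_associative_ring_bracket, root_negRoot, LinearMap.neg_apply,
        map_smul] at h
      have h2 : (rootSystem H).root α ((rootSystem H).coroot α) = 2 :=
        (rootSystem H).root_coroot_two α
      rw [h2, neg_smul] at h
      rw [two, sub_eq_iff_eq_add'.mp h, ← sub_eq_add_neg]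
    · have h := congrArg (UniversalEnvelopingAlgebra.ι ℂ)
        (lie_rootVector_coroot C α ((rootSystem H).coroot α))
      rw [LieHom.map_lie, LieRing.of_associative_ring_bracket, map_smul] at h
      have h2 : (rootSystem H).root α ((rootSystem H).coroot α) = 2 :=
        (rootSystem H).root_coroot_two α
      rw [h2] at h
      rw [two, sub_eq_iff_eq_add'.mp h]
  · refine Subalgebra.smul_mem (Algebra.adjoin ℂ
      {y | ∃ h : H, y = UniversalEnvelopingAlgebra.ι ℂ (h : g)}) ?_ _
    have hs : UniversalEnvelopingAlgebra.ι ℂ (((rootSystem H).coroot α : H) : g) ∈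
        {y | ∃ h : H, y = UniversalEnvelopingAlgebra.ι ℂ (h : g)} := ⟨_, rfl⟩
    exact Algebra.adjoin_mono (Set.singleton_subset_iff.mpr hs)
      (Polynomial.aeval_mem_adjoin_singleton ℂ _)

variable {b : (rootSystem H).Base}

theorem acts_binom {n : b.support → ℕ} (h : IsHighestWeightVector ρ n v) (i : b.support) (k : ℕ) :
    Acts χ a ρ v (binom (constLoop g (((rootSystem H).coroot i : H) : g)) k)
      ((n i).choose k : F) := by
  obtain ⟨μ, hμ, hv⟩ := h.weight
  let y : kostantCartan C := ⟨_, binom_ι_coroot_mem_kostantCartan C (i : H.root) k⟩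
  refine ⟨1 ⊗ₜ Subalgebra.inclusion inf_le_left y, ?_, ?_⟩
  · have h1 : binom (constLoop g (((rootSystem H).coroot i : H) : g)) k = (1 : ℂ[T;T⁻¹]) ⊗ₜ[ℂ]
        binom (UniversalEnvelopingAlgebra.ι ℂ (((rootSystem H).coroot i : H) : g)) k :=
      (map_binom (Algebra.TensorProduct.includeRight :
        UniversalEnvelopingAlgebra ℂ g →ₐ[ℂ] LoopEnv g) _ k).symm
    rw [h1]
    exact Spec.coe (Subalgebra.inclusion inf_le_left y)
  · rw [← hμ i k y rfl]
    exact hv (1 ⊗ₜ y)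

theorem constLoop_commute_cartan (h h' : H) :
    Commute (constLoop g (h : g)) (constLoop g (h' : g)) := by
  refine constLoop_commute ?_
  have : ⁅h, h'⁆ = 0 := trivial_lie_zero H H h h'
  rw [← LieSubalgebra.coe_bracket, this, ZeroMemClass.coe_zero]

variable (H) in
/-- The subalgebra of `ℂ[t,t⁻¹] ⊗ U(g)` generated by the scalars and `h` is the image of a
commutative algebra. -/
theorem exists_commRing_cartan : ∃ (B : Type u) (_ : CommRing B) (_ : Algebra ℂ B)
    (φ : B →ₐ[ℂ] LoopEnv g), (∀ p : ℂ[T;T⁻¹], ∃ y, φ y = p • (1 : LoopEnv g)) ∧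
      ∀ h : H, ∃ y, φ y = constLoop g (h : g) := by
  obtain ⟨B, i₁, i₂, φ, hφ⟩ := exists_commRing_algHom (A := LoopEnv g)
    (Set.range (fun p : ℂ[T;T⁻¹] => p • (1 : LoopEnv g)) ∪
      Set.range fun h : H => constLoop g (h : g)) (by
    rintro _ (⟨p, rfl⟩ | ⟨h, rfl⟩) y (⟨q, rfl⟩ | ⟨h', rfl⟩)
    · simp only [smul_mul_assoc, one_mul, smul_smul, mul_comm]
    · simp only [smul_mul_assoc, mul_smul_comm, one_mul, mul_one]
    · simp only [smul_mul_assoc, mul_smul_comm, one_mul, mul_one]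
    · exact constLoop_commute_cartan h h')
  exact ⟨B, i₁, i₂, φ, fun p => hφ _ (Or.inl ⟨p, rfl⟩), fun h => hφ _ (Or.inr ⟨h, rfl⟩)⟩

variable {B : Type*} [CommRing B] [Algebra ℂ B] {φ : B →ₐ[ℂ] LoopEnv g}

variable (χ a ρ v φ) in
/-- The coefficients of the series `W` act on `v` by the coefficients of `f`. -/
def ActsSeries (W : PowerSeries B) (f : Polynomial F) : Prop :=
  ∀ r, Acts χ a ρ v (φ (PowerSeries.coeff r W)) (f.coeff r)

theorem ActsSeries.mul {W W' : PowerSeries B} {f f' : Polynomial F}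
    (h : ActsSeries χ a ρ v φ W f) (h' : ActsSeries χ a ρ v φ W' f') :
    ActsSeries χ a ρ v φ (W * W') (f * f') := by
  intro r
  rw [PowerSeries.coeff_mul, Polynomial.coeff_mul, map_sum]
  refine Acts.sum _ fun p _ => ?_
  rw [map_mul]
  exact (h p.1).mul (h' p.2)

theorem ActsSeries.one : ActsSeries χ a ρ v φ 1 1 := by
  intro r
  rw [PowerSeries.coeff_one, Polynomial.coeff_one]
  split_ifs <;> first | (rw [map_one]; exact Acts.one) | (rw [map_zero]; exact Acts.zero)

theorem ActsSeries.prod {J : Type*} (s : Finset J) {W : J → PowerSeries B} {f : J → Polynomial F}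
    (h : ∀ j ∈ s, ActsSeries χ a ρ v φ (W j) (f j)) :
    ActsSeries χ a ρ v φ (∏ j ∈ s, W j) (∏ j ∈ s, f j) := by
  classical
  induction s using Finset.induction_on with
  | empty => exact ActsSeries.one
  | insert j s hj ih =>
    rw [Finset.prod_insert hj, Finset.prod_insert hj]
    exact (h j (Finset.mem_insert_self j s)).mul
      (ih fun i hi => h i (Finset.mem_insert_of_mem hi))

/-- In degree r the operator (-c)^r times a binomial of h_i acts by (-d)^r times the binomial
coefficient of n i, which is the r-th coefficient of (1 - du)^{n i}. No division occurs in F, so the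
characteristic plays no role. -/
theorem actsSeries_binomSeries {n : b.support → ℕ} (hv : IsHighestWeightVector ρ n v)
    {c h : B} {d : F} {i : b.support}
    (hc : Acts χ a ρ v (φ c) d) (hh : φ h = constLoop g (((rootSystem H).coroot i : H) : g)) :
    ActsSeries χ a ρ v φ (binomSeries c h) ((1 - Polynomial.C d * Polynomial.X) ^ n i) := by
  intro r
  rw [binomSeries, PowerSeries.coeff_mk, coeff_one_sub_C_mul_X_pow, map_mul, map_pow, map_neg,
    map_binom, hh]
  exact (hc.neg.pow r).mul (acts_binom hv i r)

end Acts

/-! ### The series `Λ` and the highest `ℓ`-weight -/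

section EllWeight

open LieAlgebra LieAlgebra.IsKilling

variable {g : Type u} [LieRing g] [LieAlgebra ℂ g] [FiniteDimensional ℂ g] [LieAlgebra.IsSimple ℂ g]
variable {H : LieSubalgebra ℂ g} [H.IsCartanSubalgebra]
variable {C : ChevalleyBasis H} {ζ : ℂ} {F : Type*} [Field F] {χ : coeffRing ζ →+* F} {a : Fˣ}
variable {V : Type*} [AddCommGroup V] [Module F V]
  {ρ : Hyper F (kostant C) →ₐ[F] Module.End F V} {v : V}
variable {b : (rootSystem H).Base} {D : DiagramAut C b} {O : D.OrbitReps}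

theorem perm_iterate_ne (hm : D.order = 1 ∨ D.order = 2 ∨ D.order = 3) {α : H.root}
    (hα : D.perm α ≠ α) {j : ℕ} (hj : 0 < j) (hj' : j < D.order) : D.perm^[j] α ≠ α := by
  have hord := D.perm_iterate_order α
  have h2 : j = 1 ∨ j = 2 ∧ D.order = 3 := by omega
  rcases h2 with rfl | ⟨rfl, h3⟩
  · exact hα
  · intro h
    rw [h3, Function.iterate_succ_apply', h] at hord
    exact hα hord

theorem extend_self (lam : D.DominantWeight ζ O) (i : O.I₀) :
    lam.extend ⟨i.1, i.2.1⟩ = lam.val i := by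
  rw [DiagramAut.DominantWeight.extend, dif_pos i.2.2]
  rfl

/-- O meets the orbit of i only in i, so the extension of λ by zero applies to the other vertices of
the orbit. -/
theorem extend_perm_iterate (hm : D.order = 1 ∨ D.order = 2 ∨ D.order = 3)
    (lam : D.DominantWeight ζ O) (i : O.I₀) (hi : D.perm i.1 ≠ i.1) {j : ℕ} (hj : 0 < j)
    (hj' : j < D.order) :
    lam.extend ⟨D.perm^[j] i.1, D.perm_iterate_mem_base i.2.1 j⟩ = 0 := by
  rw [DiagramAut.DominantWeight.extend, dif_neg]
  intro h
  obtain ⟨β, -, hβ⟩ := O.existsUnique i.1 (O.pos _ i.2.2)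
  exact perm_iterate_ne hm hi hj hj'
    ((hβ _ ⟨h, j, rfl⟩).trans (hβ _ ⟨i.2.2, 0, rfl⟩).symm)

variable (H) in
/-- The restriction of `constLoop` to the Cartan subalgebra. -/
def cartanLoop : H →ₗ[ℂ] LoopEnv g := constLoop g ∘ₗ H.toSubmodule.subtype

theorem evFormal_loopElt_cartan (h : H) (r : ℤ) :
    evFormal g (loopElt (h : g) r) = (LaurentPolynomial.T r : ℂ[T;T⁻¹]) • cartanLoop H h :=
  evFormal_loopElt _ _

variable {B : Type u} [CommRing B] [Algebra ℂ B] {φ : B →ₐ[ℂ] LoopEnv g}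

/-- Algebra maps commute with `expSeries`, so a series that evaluates to a sum of logarithmic series
over a commutative algebra B has its exponential given by the product formula in B. -/
theorem evFormal_coeff_expSeries {J : Type*} (t : Finset J) (c h : J → B)
    (f : ℕ → UniversalEnvelopingAlgebra ℂ (Loop g)) (h0 : f 0 = 0)
    (hf : ∀ n, 0 < n → evFormal g (f n) = ∑ j ∈ t, (n : ℂ)⁻¹ • (φ (h j) * φ (c j) ^ n)) (r : ℕ) :
    evFormal g (PowerSeries.coeff r (expSeries (-PowerSeries.mk f))) =
      φ (PowerSeries.coeff r (∏ j ∈ t, binomSeries (c j) (h j))) := by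
  have h1 : PowerSeries.map (evFormal g : UniversalEnvelopingAlgebra ℂ (Loop g) →+* LoopEnv g)
      (-PowerSeries.mk f) =
      PowerSeries.map (φ : B →+* LoopEnv g) (-∑ j ∈ t, logSeries (c j) (h j)) := by
    rw [map_neg, map_neg]
    congr 1
    ext n
    rw [PowerSeries.coeff_map, PowerSeries.coeff_map, PowerSeries.coeff_mk, map_sum, map_sum]
    rcases Nat.eq_zero_or_pos n with rfl | hn
    · simp [h0, logSeries]
    · refine (hf n hn).trans (Finset.sum_congr rfl fun j _ => ?_)
      rw [logSeries, PowerSeries.coeff_mk, if_neg hn.ne']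
      change _ = φ _
      rw [map_smul, map_mul, map_pow]
  have h2 := congrArg (PowerSeries.coeff r) (map_expSeries (evFormal g) (-PowerSeries.mk f))
  rw [h1, ← map_expSeries, expSeries_neg_sum_logSeries, PowerSeries.coeff_map,
    PowerSeries.coeff_map] at h2
  exact h2

/-- The product of the polynomials attached to the orbit of `i`. -/
theorem prod_extend (hm : D.order = 1 ∨ D.order = 2 ∨ D.order = 3)
    (lam : D.DominantWeight ζ O) (i : O.I₀) (hi : D.perm i.1 ≠ i.1) (f : ℕ → Polynomial F) :
    ∏ j ∈ Finset.range D.order,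
      f j ^ lam.extend ⟨D.perm^[j] i.1, D.perm_iterate_mem_base i.2.1 j⟩ = f 0 ^ lam.val i := by
  rw [Finset.prod_eq_single 0]
  · rw [← extend_self lam i]
    rfl
  · intro j hj hj0
    rw [extend_perm_iterate hm lam i hi (Nat.pos_of_ne_zero hj0) (Finset.mem_range.mp hj), pow_zero]
  · intro h
    simp only [Finset.mem_range, not_lt, nonpos_iff_eq_zero] at h
    omega

/-- For a moved vertex, h_{i,∓n} ⊗ t^{±n} evaluates to the sum of h_{σ^j(i)} c_j^n with c_j = ζ^{±j}
t^{±1}. So Λ becomes the product of the (1 - c_j u)^{h_{σ^j(i)}}, and only j = 0, where c_0 =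
t^{±1}, acts nontrivially on v. For a fixed vertex there is one factor, with c = t^{±m}. -/
theorem acts_lambdaSeries (hm : D.order = 1 ∨ D.order = 2 ∨ D.order = 3)
    (hζ : ζ ^ D.order = 1) (lam : D.DominantWeight ζ O)
    (hv : IsHighestWeightVector ρ lam.extend v) (i : O.I₀) (s : ℤˣ) (e : ℕ)
    (he : D.perm i.1 = i.1 ∧ e = D.order ∨ D.perm i.1 ≠ i.1 ∧ e = 1) (r : ℕ) :
    Acts χ a ρ v (evFormal g (PowerSeries.coeff r (lambdaSeries ζ O i s)))
      (((1 - Polynomial.C ((a ^ ((s : ℤ) * e) : Fˣ) : F) * Polynomial.X) ^ lam.val i).coeff r) := by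
  obtain ⟨B, _, _, φ, hT, hH⟩ := exists_commRing_cartan H
  choose τ hτ using hT
  choose η hη using hH
  have hacts : ∀ (d : coeffRing ζ) (k : ℤ), Acts χ a ρ v
      (φ ((d : ℂ) • τ (LaurentPolynomial.T k))) (χ d * ((a ^ k : Fˣ) : F)) := by
    intro d k
    rw [map_smul, hτ]
    have := ((Acts.one (χ := χ) (a := a) (ρ := ρ) (v := v)).T_smul k).coeff_smul d
    rwa [mul_one] at this
  have hpow : ∀ (d : ℂ) (k : ℤ) (h : H) (n : ℕ),
      φ (η h) * φ (d • τ (LaurentPolynomial.T k)) ^ n =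
        d ^ n • (LaurentPolynomial.T (k * n) : ℂ[T;T⁻¹]) • cartanLoop H h := by
    intro d k h n
    rw [map_smul, hτ, hη, smul_pow, smul_pow, one_pow, mul_smul_comm, mul_smul_comm, mul_one,
      LaurentPolynomial.T_pow, mul_comm k]
    rfl
  rcases he with ⟨hi, rfl⟩ | ⟨hi, rfl⟩
  · rw [lambdaSeries, evFormal_coeff_expSeries (φ := φ) (Finset.range 1)
      (fun _ => (1 : ℂ) • τ (LaurentPolynomial.T ((s : ℤ) * D.order)))
      (fun _ => η ((rootSystem H).coroot i.1)) _ (if_pos rfl)]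
    · rw [Finset.prod_range_one, ← extend_self lam i]
      have h1 := hacts 1 ((s : ℤ) * D.order)
      rw [map_one, one_mul] at h1
      exact actsSeries_binomSeries hv (i := ⟨i.1, i.2.1⟩) h1 (hη _) r
    · intro n hn
      rw [if_neg hn.ne', if_pos hi, Finset.sum_range_one, hpow, one_pow, one_smul, map_smul,
        evFormal_loopElt_cartan, DiagramAut.hTw, if_pos hi, if_pos (dvd_zero _), mul_assoc]
  · have hz : ∀ j : ℕ, ζ ^ ((j : ℤ) * s) ∈ coeffRing ζ := fun j =>
      zpow_mem_coeffRing (by omega) hζ _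
    rw [lambdaSeries, evFormal_coeff_expSeries (φ := φ) (Finset.range D.order)
      (fun j => ζ ^ ((j : ℤ) * s) • τ (LaurentPolynomial.T (s : ℤ)))
      (fun j => η ((rootSystem H).coroot (D.perm^[j] i.1))) _ (if_pos rfl)]
    · have h1 := prod_extend hm lam i hi fun j =>
        (1 - Polynomial.C (χ ⟨_, hz j⟩ * ((a ^ (s : ℤ) : Fˣ) : F)) * Polynomial.X)
      have h2 : (⟨_, hz 0⟩ : coeffRing ζ) = 1 := Subtype.ext (by simp)
      rw [h2, map_one, one_mul] at h1
      rw [Nat.cast_one, mul_one, ← h1]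
      exact ActsSeries.prod _ (fun j _ => actsSeries_binomSeries hv
        (i := ⟨D.perm^[j] i.1, D.perm_iterate_mem_base i.2.1 j⟩) (hacts ⟨_, hz j⟩ s) (hη _)) r
    · intro n hn
      rw [if_neg hn.ne', if_neg hi, map_smul, evFormal_loopElt_cartan, DiagramAut.hTw, if_neg hi,
        map_sum, Finset.smul_sum, Finset.smul_sum]
      refine Finset.sum_congr rfl fun j _ => ?_
      have h3 : ζ ^ (-((j : ℤ) * -((s : ℤ) * n))) = (ζ ^ ((j : ℤ) * s)) ^ n := by
        rw [← zpow_natCast, ← zpow_mul]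
        congr 1
        ring
      rw [hpow, map_smul, h3]
      exact congrArg _ (smul_comm _ _ _)

theorem acts_binom_hTw (hm : D.order = 1 ∨ D.order = 2 ∨ D.order = 3)
    (lam : D.DominantWeight ζ O)
    (hv : IsHighestWeightVector ρ lam.extend v) (i : O.I₀) (k : ℕ) :
    Acts χ a ρ v (evFormal g (binom (loopElt (D.hTw ζ i.1 0 : g) 0) k))
      ((lam.val i).choose k : F) := by
  rw [map_binom, evFormal_loopElt_cartan, LaurentPolynomial.T_zero, one_smul, DiagramAut.hTw]
  split_ifs with hi h0
  · rw [← extend_self lam i]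
    exact acts_binom hv ⟨i.1, i.2.1⟩ k
  · exact absurd (dvd_zero _) h0
  · obtain ⟨B, _, _, φ, -, hH⟩ := exists_commRing_cartan H
    choose η hη using hH
    have h1 : (fun j : ℕ => ζ ^ (-((j : ℤ) * 0)) • (rootSystem H).coroot (D.perm^[j] i.1)) =
        fun j => (rootSystem H).coroot (D.perm^[j] i.1) := by
      funext j
      simp
    have hact : ∀ j : ℕ, ActsSeries χ a ρ v φ
        -- With c = -1 the series is the generating function (1 + u)^h of the binomials;
        -- multiplicativity in h is Vandermonde's identity for the sum over the orbit.
        (binomSeries (-1) (η ((rootSystem H).coroot (D.perm^[j] i.1))))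
        ((1 - Polynomial.C (-1) * Polynomial.X) ^
          lam.extend ⟨D.perm^[j] i.1, D.perm_iterate_mem_base i.2.1 j⟩) := fun j =>
      actsSeries_binomSeries hv (by rw [map_neg, map_one]; exact Acts.one.neg) (hη _)
    have h2 := ActsSeries.prod (Finset.range D.order) (fun j _ => hact j) k
    rw [← binomSeries_sum, prod_extend hm lam i hi fun _ => _, coeff_one_sub_C_mul_X_pow,
      binomSeries, PowerSeries.coeff_mk, neg_neg, one_pow, one_mul, neg_neg, one_pow, one_mul,
      map_binom, map_sum] at h2
    rw [h1, map_sum]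
    simp only [hη] at h2
    exact h2

end EllWeight

/-! ### The character of the twisted Cartan form and the highest-ℓ-weight vector -/

section Main

open LieAlgebra LieAlgebra.IsKilling

/-- The scalars are unique because v ≠ 0, and uniqueness forces them to be additive and
multiplicative in x. -/
theorem exists_character {F A V : Type*} [Field F] [Ring A] [Algebra F A] [AddCommGroup V]
    [Module F V] (π : A →ₐ[F] Module.End F V) {v : V} (hv : v ≠ 0)
    (h : ∀ x, ∃ c : F, π x v = c • v) : ∃ ξ : A →ₐ[F] F, ∀ x, π x v = ξ x • v := by
  choose f hf using h
  have inj : ∀ {c d : F}, c • v = d • v → c = d := fun h => smul_left_injective F hv h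
  refine ⟨AlgHom.ofLinearMap
    { toFun := f
      map_add' := fun x y => inj ?_
      map_smul' := fun c x => inj ?_ } (inj ?_) fun x y => inj ?_, hf⟩
  · rw [← hf, map_add, LinearMap.add_apply, hf, hf, add_smul]
  · rw [← hf, map_smul, LinearMap.smul_apply, hf, smul_smul]
    rfl
  · exact (hf 1).symm.trans (by rw [map_one, one_smul]; rfl)
  · exact (hf (x * y)).symm.trans
      (by rw [map_mul, Module.End.mul_apply, hf y, map_smul, hf, smul_smul, mul_comm]; rfl)

theorem exists_scalar_of_tmul {F A V : Type*} [Field F] [Ring A] {S : Subalgebra ℤ A}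
    [AddCommGroup V] [Module F V] (π : Hyper F S →ₐ[F] Module.End F V) {v : V}
    (h : ∀ y : S, ∃ c : F, π (1 ⊗ₜ y) v = c • v) (x : Hyper F S) : ∃ c : F, π x v = c • v := by
  induction x using TensorProduct.induction_on with
  | zero => exact ⟨0, by rw [map_zero, LinearMap.zero_apply, zero_smul]⟩
  | add x y hx hy =>
    obtain ⟨c, hc⟩ := hx
    obtain ⟨d, hd⟩ := hy
    exact ⟨c + d, by rw [map_add, LinearMap.add_apply, hc, hd, add_smul]⟩
  | tmul d y =>
    obtain ⟨c, hc⟩ := h y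
    have h1 : (d ⊗ₜ y : Hyper F S) = d • ((1 : F) ⊗ₜ[ℤ] y) := by
      rw [TensorProduct.smul_tmul', smul_eq_mul, mul_one]
    exact ⟨d * c, by rw [h1, map_smul, LinearMap.smul_apply, hc, smul_smul]⟩

variable {g : Type*} [LieRing g] [LieAlgebra ℂ g] [FiniteDimensional ℂ g] [LieAlgebra.IsSimple ℂ g]
variable {H : LieSubalgebra ℂ g} [H.IsCartanSubalgebra]
variable {C : ChevalleyBasis H} {ζ : ℂ} {F : Type*} [Field F] {χ : coeffRing ζ →+* F} {a : Fˣ}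
variable {V : Type*} [AddCommGroup V] [Module F V]
  {ρ : Hyper F (kostant C) →ₐ[F] Module.End F V} {v : V}
variable {b : (rootSystem H).Base} {D : DiagramAut C b} {O : D.OrbitReps}

theorem evFormal_mem_span_of_mem_twistedCartan {y : UniversalEnvelopingAlgebra ℂ (Loop g)}
    (hy : y ∈ twistedCartan ζ O) :
    evFormal g y ∈ Submodule.span ℂ {y | ∃ (p : ℂ[T;T⁻¹]) (u : UniversalEnvelopingAlgebra ℂ g),
      u ∈ Algebra.adjoin ℂ {y | ∃ h : H, y = UniversalEnvelopingAlgebra.ι ℂ (h : g)} ∧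
        y = p ⊗ₜ u} := by
  let U := Algebra.adjoin ℂ {y : UniversalEnvelopingAlgebra ℂ g |
    ∃ h : H, y = UniversalEnvelopingAlgebra.ι ℂ (h : g)}
  let f : ℂ[T;T⁻¹] ⊗[ℂ] U →ₐ[ℂ] LoopEnv g :=
    Algebra.TensorProduct.map (AlgHom.id ℂ ℂ[T;T⁻¹]) U.val
  have h1 : y ∈ f.range.comap (evFormal g) := by
    refine Algebra.adjoin_le ?_ hy.2
    rintro _ ⟨h, r, -, rfl⟩
    change evFormal g (loopElt (h : g) r) ∈ f.range
    rw [evFormal_loopElt]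
    refine ⟨LaurentPolynomial.T r ⊗ₜ ⟨_, Algebra.subset_adjoin ⟨h, rfl⟩⟩, ?_⟩
    rw [constLoop_apply, TensorProduct.smul_tmul', smul_eq_mul, mul_one]
    rfl
  obtain ⟨t, ht⟩ := h1
  change f t = evFormal g y at ht
  rw [← ht]
  clear ht
  induction t using TensorProduct.induction_on with
  | zero => rw [map_zero]; exact zero_mem _
  | tmul p u => exact Submodule.subset_span ⟨p, u, u.2, rfl⟩
  | add x y hx hy => rw [map_add]; exact add_mem hx hy

/-- The twisted Cartan form is defined as an intersection, with no generators at hand. Its elements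
evaluate into ℂ[t,t⁻¹] ⊗ U(h), hence by descent into R[t,t⁻¹] ⊗ U_ℤ(h), and v is an eigenvector for
U_F(h). -/
theorem exists_scalar_of_mem_twistedCartan (h0 : 0 < D.order) (hζ : ζ ^ D.order = 1)
    {n : b.support → ℕ} (hv : IsHighestWeightVector ρ n v)
    {φ : Hyper F (twistedForm ζ O) →ₐ[F] Hyper F (kostant C)} (hφ : IsTwistedEvaluation O χ a φ)
    (x : Hyper F (twistedCartan ζ O)) :
    ∃ c : F, ((ρ.comp φ).comp
      (hyperIncl F (inf_le_left : twistedCartan ζ O ≤ twistedForm ζ O))) x v = c • v := by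
  obtain ⟨μ, -, hμ⟩ := hv.weight
  have hz : ∀ z ∈ AddSubmonoid.closure {y | ∃ (p : (coeffRing ζ)[T;T⁻¹]) (n : kostantCartan C),
      y = p ⊗ₜ[ℤ] (Subalgebra.inclusion (inf_le_left : kostantCartan C ≤ kostant C) n)},
      ∃ c : F, ρ (specialize C χ a z) v = c • v := by
    intro z hz
    induction hz using AddSubmonoid.closure_induction with
    | mem y hy =>
      obtain ⟨p, n, rfl⟩ := hy
      exact ⟨_, hμ (LaurentPolynomial.eval₂ χ a p ⊗ₜ n)⟩
    | zero => exact ⟨0, by rw [map_zero, map_zero, LinearMap.zero_apply, zero_smul]⟩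
    | add x y _ _ hx hy =>
      obtain ⟨c, hc⟩ := hx
      obtain ⟨d, hd⟩ := hy
      exact ⟨c + d, by rw [map_add, map_add, LinearMap.add_apply, hc, hd, add_smul]⟩
  refine exists_scalar_of_tmul _ (fun y => ?_) x
  obtain ⟨z, hzy, hzφ⟩ := hφ (Subalgebra.inclusion inf_le_left y)
  have hmem := evFormal_mem_span_of_mem_twistedCartan y.2
  have hzy' : toComplex C ζ z = evFormal g (y : UniversalEnvelopingAlgebra ℂ (Loop g)) := hzy
  rw [← hzy'] at hmem
  change ∃ c : F, ρ (φ (1 ⊗ₜ Subalgebra.inclusion inf_le_left y)) v = c • v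
  rw [hzφ]
  exact hz z (mem_span_kostantCartan b h0 hζ z hmem)

theorem isHighestEllWeightVector_comp (hm : D.order = 1 ∨ D.order = 2 ∨ D.order = 3)
    (hζ : ζ ^ D.order = 1) (lam : D.DominantWeight ζ O)
    (hv : IsHighestWeightVector ρ lam.extend v)
    {φ : Hyper F (twistedForm ζ O) →ₐ[F] Hyper F (kostant C)} (hφ : IsTwistedEvaluation O χ a φ)
    (hplus : ∀ (i : O.I₀) (r : ℕ), Acts χ a ρ v (evFormal g (PowerSeries.coeff r
      (lambdaSeries ζ O i 1))) (((lam.drinfeld a).1 i).coeff r))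
    (hminus : ∀ (i : O.I₀) (r : ℕ), Acts χ a ρ v (evFormal g (PowerSeries.coeff r
      (lambdaSeries ζ O i (-1)))) ((minusPoly ((lam.drinfeld a).1 i)).coeff r)) :
    IsHighestEllWeightVector (ρ.comp φ) (lam.drinfeld a) v := by
  have h0 : 0 < D.order := by omega
  refine ⟨hv.ne_zero, ?_, ?_⟩
  · obtain ⟨ξ, hξ⟩ := exists_character ((ρ.comp φ).comp
      (hyperIncl F (inf_le_left : twistedCartan ζ O ≤ twistedForm ζ O))) hv.ne_zero
      (exists_scalar_of_mem_twistedCartan h0 hζ hv hφ)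
    have key : ∀ (y : twistedCartan ζ O) (c : F),
        Acts χ a ρ v (evFormal g (y : UniversalEnvelopingAlgebra ℂ (Loop g))) c →
          ξ (1 ⊗ₜ y) = c := by
      rintro y c ⟨x, hx, hc⟩
      have h1 : φ (1 ⊗ₜ Subalgebra.inclusion inf_le_left y) = x :=
        Spec.unique b h0 hζ (hφ (Subalgebra.inclusion inf_le_left y)) hx
      have h2 := hξ (1 ⊗ₜ y)
      refine smul_left_injective F hv.ne_zero (h2.symm.trans ?_)
      change ρ (φ (1 ⊗ₜ Subalgebra.inclusion inf_le_left y)) v = c • v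
      rw [h1, hc]
    refine ⟨ξ, ⟨fun i k y hy => key y _ ?_, fun i r y hy => key y _ ?_,
      fun i r y hy => key y _ ?_⟩, hξ⟩
    · have h1 : ((lam.drinfeld a).1 i).natDegree = lam.val i :=
        natDegree_one_sub_C_mul_X_pow (pow_ne_zero _ a.ne_zero) _
      rw [hy, h1]
      exact acts_binom_hTw hm lam hv i k
    · rw [hy]
      exact hplus i r
    · rw [hy]
      exact hminus i r
  · intro α r k hk
    -- The annihilator of v is a left ideal, hence a non-unital subalgebra. For α in O every root
    -- whose height is a positive multiple of that of α is positive, so its divided powers lie in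
    -- it.
    let M : NonUnitalSubalgebra F (Hyper F (kostant C)) :=
      { carrier := {x | ρ x v = 0}
        add_mem' := fun {x y} (hx : ρ x v = 0) (hy : ρ y v = 0) => by
          change ρ (x + y) v = 0
          rw [map_add, LinearMap.add_apply, hx, hy, add_zero]
        zero_mem' := by
          change ρ 0 v = 0
          rw [map_zero, LinearMap.zero_apply]
        mul_mem' := fun {x y} _ (hy : ρ y v = 0) => by
          change ρ (x * y) v = 0
          rw [map_mul, Module.End.mul_apply, hy, map_zero]
        smul_mem' := fun c x (hx : ρ x v = 0) => by
          change ρ (c • x) v = 0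
          rw [map_smul, LinearMap.smul_apply, hx, smul_zero] }
    have h1 : DivSpec χ a M (constLoop g (D.xTw ζ α.1 (-r))) := by
      refine divSpec_xTw hm hζ α.1 (-r) ?_
      rintro β ⟨n, hn, hβ⟩ k hk
      refine hv.pos β ?_ k hk
      rw [RootPairing.Base.IsPos, hβ]
      exact mul_pos (by exact_mod_cast hn) (O.pos _ α.2)
    obtain ⟨x, hx, hs⟩ := (specIn_of_pos hk).mp (specIn_loopElt h1 k)
    have h2 : φ (1 ⊗ₜ twistedGen ζ O α r k) = x := Spec.unique b h0 hζ (hφ _) hs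
    change ρ (φ (1 ⊗ₜ twistedGen ζ O α r k)) v = 0
    rw [h2]
    exact hx

open Classical in
theorem acts_lambdaSeries_one (hm : D.order = 1 ∨ D.order = 2 ∨ D.order = 3)
    (hζ : ζ ^ D.order = 1) (lam : D.DominantWeight ζ O)
    (hv : IsHighestWeightVector ρ lam.extend v) (i : O.I₀) (r : ℕ) :
    Acts χ a ρ v (evFormal g (PowerSeries.coeff r (lambdaSeries ζ O i 1)))
      (((lam.drinfeld a).1 i).coeff r) := by
  have h := acts_lambdaSeries (χ := χ) (a := a) hm hζ lam hv i 1
    (if D.perm i.1 = i.1 then D.order else 1) (by split_ifs with h <;> simp [h]) r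
  rw [Units.val_one, one_mul, zpow_natCast, Units.val_pow_eq_pow_val] at h
  exact h

open Classical in
-- The sign inverts the power of a, and `minusPoly` turns (1 - cu)^n into (1 - c⁻¹u)^n.
theorem acts_lambdaSeries_neg_one (hm : D.order = 1 ∨ D.order = 2 ∨ D.order = 3)
    (hζ : ζ ^ D.order = 1) (lam : D.DominantWeight ζ O)
    (hv : IsHighestWeightVector ρ lam.extend v) (i : O.I₀) (r : ℕ) :
    Acts χ a ρ v (evFormal g (PowerSeries.coeff r (lambdaSeries ζ O i (-1))))
      ((minusPoly ((lam.drinfeld a).1 i)).coeff r) := by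
  have h := acts_lambdaSeries (χ := χ) (a := a) hm hζ lam hv i (-1)
    (if D.perm i.1 = i.1 then D.order else 1) (by split_ifs with h <;> simp [h]) r
  rw [Units.val_neg, Units.val_one, neg_one_mul, zpow_neg, zpow_natCast, Units.val_inv_eq_inv_val,
    Units.val_pow_eq_pow_val] at h
  have h1 : minusPoly ((lam.drinfeld a).1 i) = _ :=
    minusPoly_one_sub_C_mul_X_pow (pow_ne_zero _ a.ne_zero) _
  rw [h1]
  exact h

end Main

end

end TwistedHyperLoop

theorem proposition3p4
    {g : Type*} [LieRing g] [LieAlgebra ℂ g] [FiniteDimensional ℂ g] [LieAlgebra.IsSimple ℂ g]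
    {H : LieSubalgebra ℂ g} [H.IsCartanSubalgebra]
    (b : (LieAlgebra.IsKilling.rootSystem H).Base)
    (C : TwistedHyperLoop.ChevalleyBasis H)
    (D : TwistedHyperLoop.DiagramAut C b)
    (hm : D.order = 1 ∨ D.order = 2 ∨ D.order = 3)
    (ζ : ℂ) (hζ : IsPrimitiveRoot ζ D.order)
    (O : D.OrbitReps)
    {F : Type*} [Field F] [IsAlgClosed F]
    (χ : TwistedHyperLoop.coeffRing ζ →+* F)
    (a : Fˣ)
    (lam : D.DominantWeight ζ O) :
    ∃ φ : TwistedHyperLoop.Hyper F (TwistedHyperLoop.twistedForm ζ O) →ₐ[F]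
        TwistedHyperLoop.Hyper F (TwistedHyperLoop.kostant C),
      TwistedHyperLoop.IsTwistedEvaluation O χ a φ ∧
      (∀ ψ, TwistedHyperLoop.IsTwistedEvaluation O χ a ψ → ψ = φ) ∧
      ∀ {V : Type*} [AddCommGroup V] [Module F V]
        (ρ : TwistedHyperLoop.Hyper F (TwistedHyperLoop.kostant C) →ₐ[F] Module.End F V) (v : V),
        TwistedHyperLoop.IsHighestWeightVector ρ lam.extend v →
        TwistedHyperLoop.IsGeneratedBy ρ v →
          TwistedHyperLoop.IsHighestEllWeightVector (ρ.comp φ) (lam.drinfeld a) v ∧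
          ((D.order : F) ≠ 0 → TwistedHyperLoop.IsGeneratedBy (ρ.comp φ) v) ∧
          ∀ (i : O.I₀) (r : ℕ),
            (∃ x, TwistedHyperLoop.EvaluatesTo C χ a
                (PowerSeries.coeff r (TwistedHyperLoop.lambdaSeries ζ O i 1)) x ∧
              ρ x v = ((lam.drinfeld a).1 i).coeff r • v) ∧
            (∃ x, TwistedHyperLoop.EvaluatesTo C χ a
                (PowerSeries.coeff r (TwistedHyperLoop.lambdaSeries ζ O i (-1))) x ∧
              ρ x v = (TwistedHyperLoop.minusPoly ((lam.drinfeld a).1 i)).coeff r • v) := by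
  have h0 : 0 < D.order := by omega
  have hζ1 := hζ.pow_eq_one
  obtain ⟨φ, hφ⟩ := TwistedHyperLoop.exists_twistedEvaluation (χ := χ) (a := a) hm hζ1 O
  refine ⟨φ, hφ, fun ψ hψ => TwistedHyperLoop.twistedEvaluation_unique b h0 hζ1 O hφ hψ, ?_⟩
  intro V _ _ ρ v hv hgen
  have hplus := fun i r => TwistedHyperLoop.acts_lambdaSeries_one (χ := χ) (a := a) hm hζ1 lam hv i r
  have hminus := fun i r =>
    TwistedHyperLoop.acts_lambdaSeries_neg_one (χ := χ) (a := a) hm hζ1 lam hv i r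
  refine ⟨TwistedHyperLoop.isHighestEllWeightVector_comp hm hζ1 lam hv hφ hplus hminus, ?_,
    fun i r => ⟨hplus i r, hminus i r⟩⟩
  intro hF w
  obtain ⟨x, hx⟩ := hgen w
  -- Pullback along a surjective homomorphism has the same cyclic vectors.
  obtain ⟨y, rfl⟩ := TwistedHyperLoop.twistedEvaluation_surjective hm hζ hφ hF x
  exact ⟨y, hx⟩
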